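/- **Setting.** Let $n\ge 2$. On $\mathbb R^{n+2}=\mathbb R^{n+1}\times\mathbb R$ let $(x,y)=x^0y^0+\dots+x^ny^n-x^{n+1}y^{n+1}$, and let $P^{n+1}$ be the projective space of $\mathbb R^{n+2}$. Let $Q^n=\{(x,x)=0\}\subset P^{n+1}$ be the Darboux hyperquadric (absolute) and let the de Sitter space be its exterior, $S^{n+1}_1=\{(x,x)>0\}$. The conformal space $C^n$ is the unit sphere of $\mathbb R^{n+1}$, identified with $Q^n$ by the Darboux map $p\mapsto[(p,1)]$. A point $x\in S^{n+1}_1$ corresponds to the hypersphere $\sigma_x\subset C^n$ cut out on $Q^n$ by the hyperplane polar-conjugate to $x$. A parabolic pencil with zero-radius hypersphere $p$ is the set of all hyperspheres tangent at $p$ to a given hypersphere through $p$. An isotropic line is a straight line of $P^{n+1}$ tangent to $Q^n$; all its points except its point of tangency lie in $S^{n+1}_1$. A hypersurface $V^{n-1}$ of $C^n$ is a $C^\infty$ embedded submanifold of codimension one (not necessarily closed or connected). A *regular lightlike hypersurface* $H$ of $S^{n+1}_1$ is a $C^\infty$ embedded hypersurface of $S^{n+1}_1$, all of whose tangent hyperplanes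 are tangent to $Q^n$; its rank is the number of parameters on which its tangent hyperplane depends, i.e. the rank of the map sending a point of $H$ to its tangent hyperplane. For $w\in H$ let $l_w(H)$ be the isotropic line joining $w$ to the point at which the tangent hyperplane $T_wH$ touches $Q^n$. For $U\subset S^{n+1}_1$, an *isotropic rectilinear generator* of $U$ is an isotropic line all of whose points in $S^{n+1}_1$ belong to $U$. A *lightlike hypersurface $U^n$ of maximal rank $n-1$* (containing its generators entirely, singular points being allowed) is a set $U\subset S^{n+1}_1$ that is the union of (the parts in $S^{n+1}_1$ of) its isotropic generators and such that for each generator $l$ there are a regular lightlike hypersurface $H$ of rank $n-1$ and a point $w\in H$ with $l=l_w(H)$, such that every line $l_u(H)$, $u\in H$, is a generator of $U$, and for every neighbourhood $N$ of $w$ every generator of $U$ whose tangency point with $Q^n$ is sufficiently close to that of $l$ is of the form $l_u(H)$ with $u\in H\cap N$. **Theorem 3.** For a hypersurface $V=V^{n-1}$ of $C^n$ let $U(V)\subset S^{n+1}_1$ be the set of the points $x$ whose hyperspheres $\sigma_x$ are tangent to $V$ at some point of $V$. 1. The map $V\mapsto U(V)$ is a bijection from the set of hypersurfaces of $C^n$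 onto the set of lightlike hypersurfaces of maximal rank $r=n-1$ of $S^{n+1}_1$. Its inverse takes $U$ to the set of the points $p \in C^n$ whose images on $Q^n$ are the tangency points of the isotropic generators of $U$ with $Q^n$. 2. Let $V$ be a hypersurface of $C^n$. For each $p\in V$ the hyperspheres tangent to $V$ at $p$ form a parabolic pencil with zero-radius hypersphere $p$. The map $l\mapsto\{\sigma_x : x\in l\cap S^{n+1}_1\}$ is a bijection from the set of isotropic rectilinear generators of $U(V)$ onto the set of these pencils, $p\in V$. The generator corresponding to the pencil at $p$ is the line polar-conjugate to the projective tangent subspace of $V$ at $p$, and it touches $Q^n$ at the image of $p$. 3. Every regular lightlike hypersurface $H$ of rank $n-1$ is locally a part of such a $U(V)$: each point of $H$ has a neighbourhood in $H$ such that the points of tangency with $Q^n$ of the tangent hyperplanes of $H$ at the points of this neighbourhood form a hypersurface $V$ of $C^n$, and the neighbourhood is contained in $U(V)$. -/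

import Mathlib

open Set Topology
open scoped ContDiff

namespace DeSitter

/-- The Euclidean space `ℝⁿ⁺¹`, whose unit sphere is the conformal space. -/
abbrev Euc (n : ℕ) : Type := EuclideanSpace ℝ (Fin (n + 1))

/-- The vector space `ℝⁿ⁺²` of homogeneous coordinates of the projective space `Pⁿ⁺¹`. -/
abbrev Amb (n : ℕ) : Type := Euc n × ℝ

/-- The projective space `Pⁿ⁺¹`. A projective subspace of dimension `k` is a linear subspace
of `Amb n` of dimension `k + 1`. -/
abbrev Proj (n : ℕ) : Type := Projectivization ℝ (Amb n)

/-- The symmetric bilinear form of signature `(n+1, 1)`: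
`(x, y) = x₀ y₀ + ⋯ + xₙ yₙ - xₙ₊₁ yₙ₊₁`. -/
noncomputable def form (n : ℕ) : LinearMap.BilinForm ℝ (Amb n) :=
  (innerₗ (Euc n)).compl₁₂ (LinearMap.fst ℝ (Euc n) ℝ) (LinearMap.fst ℝ (Euc n) ℝ) -
    (LinearMap.mul ℝ ℝ).compl₁₂ (LinearMap.snd ℝ (Euc n) ℝ) (LinearMap.snd ℝ (Euc n) ℝ)

theorem form_apply (n : ℕ) (x y : Amb n) :
    form n x y = inner ℝ x.1 y.1 - x.2 * y.2 := by
  simp [form]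

/-- The projective subspace polar-conjugate to `L` with respect to the absolute. -/
noncomputable def polar {n : ℕ} (L : Submodule ℝ (Amb n)) : Submodule ℝ (Amb n) :=
  (form n).orthogonal L

/-- The de Sitter space `Sⁿ⁺¹₁`: the exterior domain `(x, x) > 0` of the absolute. -/
def deSitter (n : ℕ) : Set (Proj n) := {x | 0 < form n x.rep x.rep}

/-- `v` represents a point of the Darboux hyperquadric (the absolute) `Qⁿ : (v, v) = 0`. -/
def IsAbsolutePoint {n : ℕ} (v : Amb n) : Prop := v ≠ 0 ∧ form n v v = 0

/-- The conformal space `Cⁿ`: the unit sphere of `ℝⁿ⁺¹`. -/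
def conformalSpace (n : ℕ) : Set (Euc n) := Metric.sphere 0 1

/-- The Darboux map `Cⁿ → Qⁿ`, given by the representing vector `(p, 1)`. -/
def darboux {n : ℕ} (p : Euc n) : Amb n := (p, 1)

/-- The vectors that represent the points of a subset of the projective space. -/
def cone {n : ℕ} (X : Set (Proj n)) : Set (Amb n) :=
  {w | ∃ h : w ≠ 0, Projectivization.mk ℝ w h ∈ X}

/-- The points of the projective subspace given by the linear subspace `L`. -/
def points {n : ℕ} (L : Submodule ℝ (Amb n)) : Set (Proj n) := {x | x.submodule ≤ L}

/-- The linear tangent space of a subset of a vector space at a point. For an embedded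
submanifold it is the usual tangent space. -/
noncomputable def tangentSubspace {F : Type} [NormedAddCommGroup F] [NormedSpace ℝ F]
    (A : Set F) (a : F) : Submodule ℝ F :=
  Submodule.span ℝ (tangentConeAt ℝ A a)

section Conformal

variable {n : ℕ}

/-- A (smooth, embedded) hypersurface `Vⁿ⁻¹` of the conformal space: near each of its points it
is the zero set on the sphere of a smooth function whose differential does not vanish on the
tangent space of the sphere. -/
def IsConformalHypersurface (V : Set (Euc n)) : Prop :=
  V ⊆ conformalSpace n ∧
  ∀ p ∈ V, ∃ (O : Set (Euc n)) (f : Euc n → ℝ), IsOpen O ∧ p ∈ O ∧ ContDiffOn ℝ ∞ f O ∧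
    V ∩ O = {q | q ∈ conformalSpace n ∧ q ∈ O ∧ f q = 0} ∧
    ∃ v : Euc n, inner ℝ p v = 0 ∧ fderiv ℝ f p v ≠ 0

/-- The hypersphere of `Cⁿ` that corresponds to a point `x` of the de Sitter space: the section
of the absolute by the hyperplane polar-conjugate to `x`, carried to `Cⁿ` by the Darboux map. -/
def hypersphere (x : Proj n) : Set (Euc n) :=
  {p | p ∈ conformalSpace n ∧ darboux p ∈ polar x.submodule}

def IsHypersphere (σ : Set (Euc n)) : Prop := ∃ x ∈ deSitter n, σ = hypersphere x

/-- Two hypersurfaces of `Cⁿ` are tangent at `p`. -/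
def TangentAt (A B : Set (Euc n)) (p : Euc n) : Prop :=
  p ∈ A ∧ p ∈ B ∧ tangentSubspace A p = tangentSubspace B p

/-- The hyperspheres tangent to `V` at `p`. -/
def tangentPencil (V : Set (Euc n)) (p : Euc n) : Set (Set (Euc n)) :=
  {σ | IsHypersphere σ ∧ TangentAt V σ p}

/-- A parabolic pencil of hyperspheres with the zero-radius hypersphere `p`: all the hyperspheres
that are tangent at `p` to a given hypersphere through `p`. -/
def IsParabolicPencil (P : Set (Set (Euc n))) (p : Euc n) : Prop :=
  ∃ σ, IsHypersphere σ ∧ p ∈ σ ∧ P = tangentPencil σ p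

/-- The subset of the de Sitter space associated with `V`: the points that correspond to the
hyperspheres tangent to `V`. -/
def tangentHyperspheres (V : Set (Euc n)) : Set (Proj n) :=
  {x | x ∈ deSitter n ∧ ∃ p ∈ V, TangentAt V (hypersphere x) p}

/-- The projective tangent subspace at the point `darboux p` of the image of `V` under the
Darboux map. -/
noncomputable def projTangent (V : Set (Euc n)) (p : Euc n) : Submodule ℝ (Amb n) :=
  Submodule.span ℝ {darboux p} ⊔
    (tangentSubspace V p).map (LinearMap.inl ℝ (Euc n) ℝ)

end Conformal

section Lightlike

variable {n : ℕ}

/-- A (smooth, embedded) hypersurface of the projective space, described by its cone: near each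
point the cone is the zero set of a smooth function with non-vanishing differential. -/
def IsSmoothHypersurface (H : Set (Proj n)) : Prop :=
  ∀ w ∈ cone H, ∃ (O : Set (Amb n)) (f : Amb n → ℝ), IsOpen O ∧ w ∈ O ∧ ContDiffOn ℝ ∞ f O ∧
    cone H ∩ O = {u | u ∈ O ∧ f u = 0} ∧ fderiv ℝ f w ≠ 0

/-- The projective tangent hyperplane of `H` at the point represented by `w`. -/
noncomputable def tangentHyperplane (H : Set (Proj n)) (w : Amb n) : Submodule ℝ (Amb n) :=
  tangentSubspace (cone H) w

/-- The hyperplane `η` is tangent to the absolute at the point represented by `v`: it is the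
polar hyperplane of this point of the absolute. -/
def HyperplaneTouchesAt (η : Submodule ℝ (Amb n)) (v : Amb n) : Prop :=
  IsAbsolutePoint v ∧ η = polar (Submodule.span ℝ {v})

/-- The tangent hyperplanes of `H` depend, near the point represented by `w`, on `r` parameters:
the map from the points of `H` to the poles `[Y]` of the tangent hyperplanes is smooth and its
differential at this point has rank `r`. The `+ 1` is the direction of the vector `Y w`. -/
def HasRankAt (H : Set (Proj n)) (w : Amb n) (r : ℕ) : Prop :=
  ∃ (O : Set (Amb n)) (Y : Amb n → Amb n), IsOpen O ∧ w ∈ O ∧ ContDiffOn ℝ ∞ Y O ∧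
    (∀ u ∈ cone H ∩ O, Y u ≠ 0 ∧ tangentHyperplane H u = polar (Submodule.span ℝ {Y u})) ∧
    Module.finrank ℝ ↥(Submodule.span ℝ {Y w} ⊔
      (tangentHyperplane H w).map (fderiv ℝ Y w : Amb n →ₗ[ℝ] Amb n)) = r + 1

/-- `H` is a regular (smooth, embedded) lightlike hypersurface of rank `r` of the de Sitter space:
all its tangent hyperplanes are tangent to the absolute, and they depend on `r` parameters. -/
def IsRegularLightlike (H : Set (Proj n)) (r : ℕ) : Prop :=
  H ⊆ deSitter n ∧ IsSmoothHypersurface H ∧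
  (∀ w ∈ cone H, ∃ v, HyperplaneTouchesAt (tangentHyperplane H w) v) ∧
  ∀ w ∈ cone H, HasRankAt H w r

/-- `L` is the straight line joining the point `w` of the lightlike hypersurface `H` with the
point where the tangent hyperplane of `H` at `w` touches the absolute. -/
def IsIsotropicLineAt (H : Set (Proj n)) (w : Amb n) (L : Submodule ℝ (Amb n)) : Prop :=
  ∃ v, HyperplaneTouchesAt (tangentHyperplane H w) v ∧ L = Submodule.span ℝ {w, v}

/-- `L` is an isotropic (lightlike) straight line: it is tangent to the absolute at the point
represented by `v`. -/
def LineTouchesAt (L : Submodule ℝ (Amb n)) (v : Amb n) : Prop :=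
  Module.finrank ℝ L = 2 ∧ IsAbsolutePoint v ∧ v ∈ L ∧ L ≤ polar (Submodule.span ℝ {v})

/-- The isotropic rectilinear generators of `U`: the isotropic straight lines that lie
in `U` entirely, that is, with all their points belonging to the de Sitter space. -/
def generators (U : Set (Proj n)) : Set (Submodule ℝ (Amb n)) :=
  {L | (∃ v, LineTouchesAt L v) ∧ points L ∩ deSitter n ⊆ U}

/-- `U` is a lightlike hypersurface of rank `r` of the de Sitter space that contains its isotropic
generators entirely, with singular points allowed: `U` is the union of its generators, and each
generator `L` passes through a point `w` of a regular lightlike hypersurface `H` of rank `r` with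
the following properties. `L` joins `w` with the tangency point of the tangent hyperplane of `H`;
all the lines so obtained from the points of `H` are generators of `U`; and every generator of `U`
whose point on the absolute is close to that of `L` is obtained so from a point of `H` close to
`w`. -/
def IsLightlikeHypersurface (U : Set (Proj n)) (r : ℕ) : Prop :=
  U ⊆ deSitter n ∧
  (∀ x ∈ U, ∃ L ∈ generators U, x ∈ points L) ∧
  ∀ L ∈ generators U, ∃ H : Set (Proj n), IsRegularLightlike H r ∧
    (∀ w ∈ cone H, ∀ L', IsIsotropicLineAt H w L' → L' ∈ generators U) ∧
    ∃ w ∈ cone H, IsIsotropicLineAt H w L ∧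
      ∀ v, LineTouchesAt L v → ∀ N ∈ 𝓝 w, ∃ O ∈ 𝓝 v,
        ∀ L' ∈ generators U, ∀ v' ∈ O, LineTouchesAt L' v' →
          ∃ w' ∈ cone H ∩ N, IsIsotropicLineAt H w' L'

/-- The set of hyperspheres that corresponds to the points of a line in the de Sitter space. -/
def pencilOfLine (L : Submodule ℝ (Amb n)) : Set (Set (Euc n)) :=
  hypersphere '' (points L ∩ deSitter n)

end Lightlike

end DeSitter

/-! A vector u with (u, u) > 0 gives a hypersphere tangent to V at p exactly when u lies on the line
spanned by (p, 1) and (N, 0), where N is the unit normal of V at p inside the sphere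
(`IsUnitNormal.tangentAt_iff`). This `normalLine` is isotropic, touches the absolute at (p, 1) and
is the polar of the projective tangent subspace. Hence U(V) is the union of the normal lines, and
the statements about pencils are linear algebra.

The delicate point is that U(V) contains no other isotropic line
(`IsConformalHypersurface.mem_generators_iff`). Let a line through (q, 1) and (m, 0) lie in U(V).
For every real a the hypersphere a(q, 1) + (m, 0) touches V at some point p_a. If p_a = q for one a,
the line is the normal line at q. Otherwise A(x) = ⟨m, x⟩ / (1 - ⟨q, x⟩) takes the value a at p_a,
and p_a is a critical point of A on V. Every real number would then be a critical value, contrary to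
Sard's theorem, which is proved here in the form that the critical values have Hausdorff dimension
zero. So V is recovered from the tangency points of the generators.

From lightlike to conformal (`IsRegularLightlike.exists_local`): let q(u) be the tangency point of
the tangent hyperplane at u. Differentiating (q, q) = 0 and (q, u) = 0 along H shows that dq is
orthogonal both to q and to the normal direction given by u. The rank hypothesis makes dq fill this
orthogonal complement at one point, a determinant keeps it so nearby, and a constant rank argument
makes the image of q a hypersurface, with u tangent to it at q(u).

From conformal to lightlike (`IsConformalHypersurface.exists_isRegularLightlike`): the normal lines
are parametrized by `normalMap`, homogeneous in the foot point. Far enough along a normal line its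
differential is invertible, so there are no focal points, and the image is a regular lightlike
hypersurface whose tangent hyperplane is the polar of the foot point. The closeness clause in
`IsLightlikeHypersurface` lets the two local descriptions be glued. -/

namespace DeSitter

/-! ### Smooth charts, regular level sets and their tangent spaces. -/

section Calculus

variable {X Y G : Type} [NormedAddCommGroup X] [NormedSpace ℝ X]
  [NormedAddCommGroup Y] [NormedSpace ℝ Y] [NormedAddCommGroup G] [NormedSpace ℝ G]

theorem contDiffOn_differentiableAt {f : X → Y} {D : Set X} (hD : IsOpen D)
    (hf : ContDiffOn ℝ ∞ f D) {x : X} (hx : x ∈ D) : DifferentiableAt ℝ f x :=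
  (hf.contDiffAt (hD.mem_nhds hx)).differentiableAt (by simp)

/-- The smooth inverse function theorem: the local inverse is smooth on its whole domain. -/
theorem exists_smooth_chart [CompleteSpace X] {f : X → Y} {D : Set X} (hD : IsOpen D)
    (hf : ContDiffOn ℝ ∞ f D) {a : X} (ha : a ∈ D) (e₀ : X ≃L[ℝ] Y)
    (he₀ : fderiv ℝ f a = (e₀ : X →L[ℝ] Y)) :
    ∃ e : OpenPartialHomeomorph X Y, a ∈ e.source ∧ e.source ⊆ D ∧ (∀ x, e x = f x) ∧
      ContDiffOn ℝ ∞ e.symm e.target := by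
  have hfa := hf.contDiffAt (hD.mem_nhds ha)
  have hd : HasFDerivAt f (e₀ : X →L[ℝ] Y) a :=
    he₀ ▸ (contDiffOn_differentiableAt hD hf ha).hasFDerivAt
  set e := hfa.toOpenPartialHomeomorph f hd (by simp) with he
  have hcont : ContinuousOn (fderiv ℝ f) D := hf.continuousOn_fderiv_of_isOpen hD (by simp)
  have hS : IsOpen (D ∩ fderiv ℝ f ⁻¹' range ((↑) : (X ≃L[ℝ] Y) → X →L[ℝ] Y)) :=
    hcont.isOpen_inter_preimage hD ContinuousLinearEquiv.isOpen
  -- Invertibility of the differential is an open condition. Restricting the chart to where it holds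
  -- makes the inverse smooth on the whole target and not only at the image of `a`.
  refine ⟨e.restr (D ∩ fderiv ℝ f ⁻¹' range ((↑) : (X ≃L[ℝ] Y) → X →L[ℝ] Y)), ?_, ?_, ?_, ?_⟩
  · rw [e.restr_source' _ hS]
    exact ⟨hfa.mem_toOpenPartialHomeomorph_source hd (by simp), ha, ⟨e₀, he₀.symm⟩⟩
  · rw [e.restr_source' _ hS]
    exact fun x hx => hx.2.1
  · intro x; rfl
  · intro y hy
    have hy' := OpenPartialHomeomorph.map_target _ hy
    rw [e.restr_source' _ hS] at hy'
    obtain ⟨-, hyD, e₁, he₁⟩ := hy'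
    refine (OpenPartialHomeomorph.contDiffAt_symm _ hy (f₀' := e₁) ?_ ?_).contDiffWithinAt
    · rw [he₁]
      exact (contDiffOn_differentiableAt hD hf hyD).hasFDerivAt
    · exact hf.contDiffAt (hD.mem_nhds hyD)

/-- A smooth map is straightened near a point where its differential is onto. -/
theorem exists_straightening [FiniteDimensional ℝ X] [FiniteDimensional ℝ G] {F : X → G}
    {D : Set X} (hD : IsOpen D) (hF : ContDiffOn ℝ ∞ F D) {a : X} (ha : a ∈ D)
    (hs : Function.Surjective (fderiv ℝ F a)) :
    ∃ (e : OpenPartialHomeomorph X (G × (fderiv ℝ F a).ker)) (P : X →L[ℝ] (fderiv ℝ F a).ker),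
      a ∈ e.source ∧ e.source ⊆ D ∧ (∀ x, e x = (F x, P x)) ∧
      ContDiffOn ℝ ∞ e.symm e.target := by
  have := FiniteDimensional.complete ℝ X
  have := FiniteDimensional.complete ℝ G
  -- A continuous projection onto the kernel completes `F` to a map `(F, P)` whose differential at
  -- `a` is invertible.
  obtain ⟨P, hP⟩ := (fderiv ℝ F a).ker_closedComplemented_of_finiteDimensional_range
  have hPr : P.range = ⊤ := LinearMap.range_eq_top.2 fun x => ⟨x, hP x⟩
  obtain ⟨e, h1, h2, h3, h4⟩ := exists_smooth_chart (f := fun x => (F x, P x)) hD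
    (hF.prodMk P.contDiff.contDiffOn) ha
    (ContinuousLinearMap.equivProdOfSurjectiveOfIsCompl (fderiv ℝ F a) P
      (LinearMap.range_eq_top.2 hs) hPr (LinearMap.isCompl_of_proj hP)) (by
        rw [DifferentiableAt.fderiv_prodMk (contDiffOn_differentiableAt hD hF ha)
          P.differentiableAt, P.fderiv]
        rfl)
  exact ⟨e, P, h1, h2, h3, h4⟩

/-- The differentials of a smooth chart and its inverse are mutually inverse. -/
theorem fderiv_chart_symm_apply {e : OpenPartialHomeomorph X Y} {f : X → Y} {D : Set X}
    (hD : IsOpen D) (hf : ContDiffOn ℝ ∞ f D) (heD : e.source ⊆ D) (hef : ∀ x, e x = f x)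
    (hes : ContDiffOn ℝ ∞ e.symm e.target) {x : X} (hx : x ∈ e.source) (v : X) :
    fderiv ℝ e.symm (e x) (fderiv ℝ f x v) = v := by
  have h1 : DifferentiableAt ℝ e.symm (f x) := by
    rw [← hef]; exact contDiffOn_differentiableAt e.open_target hes (e.map_source hx)
  have h2 := contDiffOn_differentiableAt hD hf (heD hx)
  have h3 : e.symm ∘ f =ᶠ[𝓝 x] id := by
    filter_upwards [e.open_source.mem_nhds hx] with y hy
    simp [← hef, e.left_inv hy]
  have h4 := fderiv_comp x h1 h2
  rw [h3.fderiv_eq, fderiv_id] at h4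
  rw [hef]
  exact (congrArg (fun T : X →L[ℝ] X => T v) h4).symm

theorem fderiv_apply_chart_symm {e : OpenPartialHomeomorph X Y} {f : X → Y} {D : Set X}
    (hD : IsOpen D) (hf : ContDiffOn ℝ ∞ f D) (heD : e.source ⊆ D) (hef : ∀ x, e x = f x)
    (hes : ContDiffOn ℝ ∞ e.symm e.target) {y : Y} (hy : y ∈ e.target) (v : Y) :
    fderiv ℝ f (e.symm y) (fderiv ℝ e.symm y v) = v := by
  have h1 := contDiffOn_differentiableAt e.open_target hes hy
  have h2 := contDiffOn_differentiableAt hD hf (heD (e.map_target hy))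
  have h3 : f ∘ e.symm =ᶠ[𝓝 y] id := by
    filter_upwards [e.open_target.mem_nhds hy] with z hz
    simp [← hef, e.right_inv hz]
  have h4 := fderiv_comp y h2 h1
  rw [h3.fderiv_eq, fderiv_id] at h4
  exact (congrArg (fun T : Y →L[ℝ] Y => T v) h4).symm

/-- The differential carries the tangent cone of `A` into that of the single point `h a`, which is
zero because a point does not accumulate at itself. -/
theorem mem_ker_of_mem_tangentSubspace {A : Set X} {h : X → G} {a : X}
    (hh : DifferentiableAt ℝ h a) (h0 : ∀ᶠ x in 𝓝 a, x ∈ A → h x = h a) {v : X}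
    (hv : v ∈ tangentSubspace A a) : fderiv ℝ h a v = 0 := by
  have : tangentSubspace A a ≤ (fderiv ℝ h a).ker := by
    refine Submodule.span_le.2 fun v hv => ?_
    rw [← tangentConeAt_inter_nhds h0] at hv
    have h1 := hh.hasFDerivAt.hasFDerivWithinAt.mapsTo_tangent_cone hv
    have h2 := tangentConeAt_mono (𝕜 := ℝ) (x := h a)
      (show h '' (A ∩ {x | x ∈ A → h x = h a}) ⊆ {h a} by
        rintro _ ⟨x, hx, rfl⟩; exact hx.2 hx.1) h1
    have h3 := tangentConeAt_subset_zero (𝕜 := ℝ) (x := h a) (s := {h a}) (by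
      rw [accPt_iff_frequently]; simp) h2
    exact h3
  exact this hv

/-- The tangent cone of a full neighbourhood is the whole space, and differentials push tangent
cones forward. -/
theorem fderiv_mem_tangentSubspace {A : Set X} {φ : Y → X} {y : Y}
    (hφ : DifferentiableAt ℝ φ y) (hA : ∀ᶠ z in 𝓝 y, φ z ∈ A) (v : Y) :
    fderiv ℝ φ y v ∈ tangentSubspace A (φ y) := by
  apply Submodule.subset_span
  have h1 := hφ.hasFDerivAt.hasFDerivWithinAt (s := {z | φ z ∈ A}).mapsTo_tangent_cone
    (show v ∈ _ by rw [tangentConeAt_of_mem_nhds hA]; trivial)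
  exact tangentConeAt_mono (by rintro _ ⟨z, hz, rfl⟩; exact hz) h1

theorem tangentSubspace_congr {A B : Set X} {O : Set X} {a : X} (hO : O ∈ 𝓝 a)
    (h : A ∩ O = B ∩ O) : tangentSubspace A a = tangentSubspace B a := by
  unfold tangentSubspace
  rw [← tangentConeAt_inter_nhds (s := A) hO, h, tangentConeAt_inter_nhds hO]

/-- A regular level set is parametrized by the kernel of the differential. -/
theorem exists_parametrization [FiniteDimensional ℝ X] [FiniteDimensional ℝ G] {F : X → G}
    {D : Set X} (hD : IsOpen D) (hF : ContDiffOn ℝ ∞ F D) {a : X} (ha : a ∈ D)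
    (hs : Function.Surjective (fderiv ℝ F a)) :
    ∃ (W : Set (fderiv ℝ F a).ker) (φ : (fderiv ℝ F a).ker → X) (P : X →L[ℝ] (fderiv ℝ F a).ker)
      (D' : Set X), IsOpen W ∧ ContDiffOn ℝ ∞ φ W ∧ IsOpen D' ∧ a ∈ D' ∧ D' ⊆ D ∧
      (∀ x ∈ D', F x = 0 → P x ∈ W ∧ φ (P x) = x) ∧
      (∀ z ∈ W, φ z ∈ D' ∧ F (φ z) = 0) ∧
      ∀ z ∈ W, ∀ v, fderiv ℝ F (φ z) v = 0 → fderiv ℝ φ z (P v) = v := by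
  obtain ⟨e, P, hae, heD, heF, hes⟩ := exists_straightening hD hF ha hs
  have hcont : Continuous fun z : (fderiv ℝ F a).ker => ((0 : G), z) := by fun_prop
  have hsm : ContDiffOn ℝ ∞ (fun z : (fderiv ℝ F a).ker => e.symm ((0 : G), z))
      ((fun z => ((0 : G), z)) ⁻¹' e.target) :=
    hes.comp (contDiff_const.prodMk contDiff_id).contDiffOn fun z hz => hz
  refine ⟨(fun z => ((0 : G), z)) ⁻¹' e.target, fun z => e.symm (0, z), P, e.source,
    e.open_target.preimage hcont, hsm, e.open_source, hae, heD, ?_, ?_, ?_⟩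
  · intro x hx hFx
    have h1 := e.map_source hx
    have h2 := e.left_inv hx
    rw [heF, hFx] at h1 h2
    exact ⟨h1, h2⟩
  · intro z hz
    have h1 := e.right_inv hz
    rw [heF] at h1
    exact ⟨e.map_target hz, congrArg Prod.fst h1⟩
  · intro z hz v hv
    have h1 := fderiv_chart_symm_apply hD (hF.prodMk P.contDiff.contDiffOn) heD heF hes
      (e.map_target hz) v
    rw [e.right_inv hz, DifferentiableAt.fderiv_prodMk
      (contDiffOn_differentiableAt hD hF (heD (e.map_target hz))) P.differentiableAt, P.fderiv,
      ContinuousLinearMap.prod_apply, hv] at h1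
    have h2 : HasFDerivAt (fun z : (fderiv ℝ F a).ker => ((0 : G), z))
        (ContinuousLinearMap.inr ℝ G _) z := (hasFDerivAt_const (0 : G) z).prodMk (hasFDerivAt_id z)
    have h3 := (contDiffOn_differentiableAt e.open_target hes hz).hasFDerivAt.comp z h2
    have h4 : fderiv ℝ (fun z => e.symm ((0 : G), z)) z = _ := h3.fderiv
    rw [h4]
    exact h1

/-- The tangent space of a regular level set. -/
theorem tangentSubspace_eq_ker [FiniteDimensional ℝ X] [FiniteDimensional ℝ G] {A O : Set X} {F : X → G}
    (hO : IsOpen O) (hF : ContDiffOn ℝ ∞ F O) (hA : A ∩ O = {x | x ∈ O ∧ F x = 0}) {a : X}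
    (ha : a ∈ A ∩ O) (hs : Function.Surjective (fderiv ℝ F a)) :
    tangentSubspace A a = (fderiv ℝ F a).ker := by
  have ha' : F a = 0 := by rw [hA] at ha; exact ha.2
  apply le_antisymm
  · intro v hv
    refine mem_ker_of_mem_tangentSubspace (contDiffOn_differentiableAt hO hF ha.2) ?_ hv
    filter_upwards [hO.mem_nhds ha.2] with x hx hxA
    have : x ∈ A ∩ O := ⟨hxA, hx⟩
    rw [hA] at this
    rw [this.2, ha']
  · intro v hv
    obtain ⟨W, φ, P, D', hW, hφ, hD', haD', hD'O, h1, h2, h3⟩ :=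
      exists_parametrization hO hF ha.2 hs
    obtain ⟨hPa, hφa⟩ := h1 a haD' ha'
    have hd := contDiffOn_differentiableAt hW hφ hPa
    have hv' := h3 (P a) hPa v (by rw [hφa]; exact hv)
    rw [← hv']
    have := fderiv_mem_tangentSubspace (A := A) hd (by
      filter_upwards [hW.mem_nhds hPa] with z hz
      have : φ z ∈ A ∩ O := by
        rw [hA]; exact ⟨hD'O (h2 z hz).1, (h2 z hz).2⟩
      exact this.1) (P v)
    rwa [hφa] at this

end Calculus

/-! ### Sard's theorem for real functions, by Hausdorff dimension. -/

section Sard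

open MeasureTheory Module

variable {X : Type} [NormedAddCommGroup X] [NormedSpace ℝ X]

theorem natCast_lt_smooth (k : ℕ) : (k : WithTop ℕ∞) < ∞ := by
  exact_mod_cast ENat.natCast_lt_top k

/-- Second countability reduces the local pieces to countably many, and the dimension of a countable
union is the supremum of the dimensions. -/
theorem dimH_image_eq_zero_of_locally {E : Type} [TopologicalSpace E] [SecondCountableTopology E]
    {f : E → ℝ} {s : Set E} (h : ∀ x ∈ s, ∃ t ∈ 𝓝[s] x, dimH (f '' (s ∩ t)) = 0) :
    dimH (f '' s) = 0 := by
  choose! t ht hd using h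
  obtain ⟨u, hus, huc, hu⟩ := TopologicalSpace.countable_cover_nhdsWithin ht
  have : f '' s ⊆ ⋃ x ∈ u, f '' (s ∩ t x) := by
    rintro _ ⟨y, hy, rfl⟩
    obtain ⟨x, hx, hyx⟩ := mem_iUnion₂.1 (hu hy)
    exact mem_iUnion₂.2 ⟨x, hx, y, ⟨hy, hyx⟩, rfl⟩
  refine le_antisymm ((dimH_mono this).trans ?_) bot_le
  rw [dimH_bUnion huc]
  exact iSup₂_le fun x hx => (hd x (hus hx)).le

/-- If the derivatives of orders `1, …, k` vanish at `x`, then `f` differs from `f x` by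
`O(‖y - x‖ ^ (k + 1))`, with the bound of the derivative of order `k + 1` as the constant. -/
theorem norm_iteratedFDeriv_le_of_flat {f : X → ℝ} {B : Set X} (hB : IsOpen B)
    (hc : Convex ℝ B) (hf : ContDiffOn ℝ ∞ f B) {k : ℕ} {C : ℝ}
    (hC : ∀ y ∈ B, ‖iteratedFDeriv ℝ (k + 1) f y‖ ≤ C) {x : X} (hx : x ∈ B)
    (h0 : ∀ j, 1 ≤ j → iteratedFDeriv ℝ j f x = 0) :
    ∀ j ≤ k, ∀ y ∈ B, ‖iteratedFDeriv ℝ (k + 1 - j) f y‖ ≤ C * ‖y - x‖ ^ j := by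
  intro j
  induction j with
  | zero => intro _ y hy; simpa using hC y hy
  | succ j ih =>
    intro hj y hy
    have hseg : segment ℝ x y ⊆ B := hc.segment_subset hx hy
    -- Since `j + 1 ≤ k`, the derivative considered has order at least one and vanishes at `x`. The
    -- mean value inequality on the segment from `x` turns the bound on the next derivative into one
    -- more power of the distance.
    have hm := (convex_segment x y).norm_image_sub_le_of_norm_fderiv_le (𝕜 := ℝ)
      (f := iteratedFDeriv ℝ (k + 1 - (j + 1)) f) (C := C * ‖y - x‖ ^ j) (x := x) (y := y)
      (fun z hz => (hf.contDiffAt (hB.mem_nhds (hseg hz))).differentiableAt_iteratedFDeriv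
        (natCast_lt_smooth _))
      (fun z hz => by
        rw [norm_fderiv_iteratedFDeriv, show k + 1 - (j + 1) + 1 = k + 1 - j by omega]
        refine (ih (by omega) z (hseg hz)).trans ?_
        have hCnn : 0 ≤ C := (norm_nonneg _).trans (hC x hx)
        have : ‖z - x‖ ≤ ‖y - x‖ := by
          obtain ⟨a, b, ha, hb, hab, rfl⟩ := hz
          have : a • x + b • y - x = b • (y - x) := by
            rw [← eq_sub_iff_add_eq] at hab; subst hab; module
          rw [this, norm_smul, Real.norm_of_nonneg hb]
          exact mul_le_of_le_one_left (norm_nonneg _) (by linarith)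
        gcongr)
      (left_mem_segment ℝ x y) (right_mem_segment ℝ x y)
    rw [h0 _ (by omega), sub_zero] at hm
    rw [pow_succ, ← mul_assoc]
    exact hm

/-- Near flat points `f` is Hölder of exponent `k + 1` on `s`, so its image has dimension at most
dim X / (k + 1). Here `k` is arbitrary. -/
theorem dimH_image_flat_le [FiniteDimensional ℝ X] {f : X → ℝ} {D s : Set X} (hD : IsOpen D)
    (hf : ContDiffOn ℝ ∞ f D) (hs : s ⊆ D)
    (h0 : ∀ x ∈ s, ∀ j, 1 ≤ j → iteratedFDeriv ℝ j f x = 0) : dimH (f '' s) = 0 := by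
  have key : ∀ k : ℕ, dimH (f '' s) ≤ finrank ℝ X / (k + 1 : ℕ) := by
    intro k
    have h1 : dimH (f '' s) ≤ dimH s / ((k + 1 : ℕ) : NNReal) := by
      refine dimH_image_le_of_locally_holder_on (by positivity) fun x hx => ?_
      have hc : ContinuousAt (iteratedFDeriv ℝ (k + 1) f) x :=
        ((hf.contDiffAt (hD.mem_nhds (hs hx))).differentiableAt_iteratedFDeriv
          (natCast_lt_smooth _)).continuousAt
      have hev : ∀ᶠ y in 𝓝 x, y ∈ D ∧ ‖iteratedFDeriv ℝ (k + 1) f y‖ <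
          ‖iteratedFDeriv ℝ (k + 1) f x‖ + 1 :=
        (hD.eventually_mem (hs hx)).and (hc.norm.eventually_lt_const (by simp))
      obtain ⟨ε, hε, hball⟩ := Metric.eventually_nhds_iff_ball.1 hev
      refine ⟨‖iteratedFDeriv ℝ (k + 1) f x‖₊ + 1, s ∩ Metric.ball x ε,
        inter_mem_nhdsWithin s (Metric.ball_mem_nhds x hε), ?_⟩
      rintro y ⟨hys, hy⟩ z ⟨hzs, hz⟩
      have hfB := hf.mono fun y hy => (hball y hy).1
      have h2 := norm_iteratedFDeriv_le_of_flat Metric.isOpen_ball (convex_ball x ε) hfB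
        (fun y hy => (hball y hy).2.le) hy (h0 y hys) k le_rfl
      have h3 := ((convex_ball x ε).segment_subset hy hz)
      have hm := (convex_segment y z).norm_image_sub_le_of_norm_fderiv_le (𝕜 := ℝ)
        (f := f) (C := (‖iteratedFDeriv ℝ (k + 1) f x‖ + 1) * ‖z - y‖ ^ k) (x := y) (y := z)
        (fun w hw => contDiffOn_differentiableAt Metric.isOpen_ball hfB (h3 hw))
        (fun w hw => by
          have h4 := h2 w (h3 hw)
          rw [show k + 1 - k = 0 + 1 by omega, ← norm_fderiv_iteratedFDeriv] at h4
          have h5 : ‖fderiv ℝ (iteratedFDeriv ℝ 0 f) w‖ = ‖fderiv ℝ f w‖ := by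
            rw [norm_fderiv_iteratedFDeriv, norm_iteratedFDeriv_one]
          rw [← h5]
          refine h4.trans ?_
          have : ‖w - y‖ ≤ ‖z - y‖ := by
            obtain ⟨a, b, ha, hb, hab, rfl⟩ := hw
            have : a • y + b • z - y = b • (z - y) := by
              rw [← eq_sub_iff_add_eq] at hab; subst hab; module
            rw [this, norm_smul, Real.norm_of_nonneg hb]
            exact mul_le_of_le_one_left (norm_nonneg _) (by linarith)
          gcongr)
        (left_mem_segment ℝ y z) (right_mem_segment ℝ y z)
      rw [mul_assoc, ← pow_succ] at hm
      have hm' : nndist (f y) (f z) ≤ (‖iteratedFDeriv ℝ (k + 1) f x‖₊ + 1) * nndist y z ^ (k + 1) := by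
        rw [← NNReal.coe_le_coe]
        push_cast
        rw [dist_comm (f y), dist_comm y, dist_eq_norm, dist_eq_norm]
        exact hm
      rw [edist_nndist, edist_nndist]
      have : (((k + 1 : ℕ) : NNReal) : ℝ) = ((k + 1 : ℕ) : ℝ) := by simp
      rw [this, ENNReal.rpow_natCast]
      exact_mod_cast hm'
    refine h1.trans ?_
    have : dimH s ≤ finrank ℝ X := by
      rw [← Real.dimH_univ_eq_finrank]; exact dimH_mono (subset_univ _)
    have h2 : (((k + 1 : ℕ) : NNReal) : ENNReal) = ((k + 1 : ℕ) : ENNReal) := by simp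
    rw [h2]
    gcongr
  have ht : Filter.Tendsto (fun k : ℕ => (finrank ℝ X : ENNReal) / (k + 1 : ℕ)) Filter.atTop
      (𝓝 0) := by
    refine (Filter.tendsto_add_atTop_iff_nat (f := fun k : ℕ => (finrank ℝ X : ENNReal) / k) 1).2 ?_
    have := ENNReal.Tendsto.const_mul (a := (finrank ℝ X : ENNReal))
      ENNReal.tendsto_inv_nat_nhds_zero (Or.inr (by simp))
    simpa [div_eq_mul_inv] using this
  exact le_antisymm (ge_of_tendsto' ht key) bot_le

/-- Sard's theorem for smooth real functions, in terms of the Hausdorff dimension. -/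
theorem dimH_image_critical_eq_zero (m : ℕ) : ∀ (X : Type) [NormedAddCommGroup X]
    [NormedSpace ℝ X] [FiniteDimensional ℝ X], finrank ℝ X = m → ∀ (D : Set X) (f : X → ℝ),
    IsOpen D → ContDiffOn ℝ ∞ f D → dimH (f '' {x | x ∈ D ∧ fderiv ℝ f x = 0}) = 0 := by
  induction m with
  | zero =>
    intro X _ _ _ hX D f _ _
    have := finrank_zero_iff.1 hX
    exact dimH_subsingleton ((subsingleton_of_subsingleton).image f)
  | succ m ih =>
    intro X _ _ _ hX D f hD hf
    -- At a critical point that is not flat, take the least order `j ≥ 1` with a nonzero derivative.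
    -- Then `j ≠ 1`, and the derivative of order `i = j - 1` vanishes there while its differential
    -- does not.
    have hcover : f '' {x | x ∈ D ∧ fderiv ℝ f x = 0} ⊆
        f '' {x | x ∈ D ∧ ∀ j, 1 ≤ j → iteratedFDeriv ℝ j f x = 0} ∪
        ⋃ i : ℕ, f '' {x | (x ∈ D ∧ fderiv ℝ f x = 0) ∧ iteratedFDeriv ℝ i f x = 0 ∧
          fderiv ℝ (iteratedFDeriv ℝ i f) x ≠ 0} := by
      rintro _ ⟨x, ⟨hxD, hx⟩, rfl⟩
      by_cases h : ∀ j, 1 ≤ j → iteratedFDeriv ℝ j f x = 0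
      · exact Or.inl ⟨x, ⟨hxD, h⟩, rfl⟩
      · right
        push Not at h
        classical
        have h1 := Nat.find_spec h
        set j := Nat.find h with hj
        have hj1 : j ≠ 1 := by
          intro hj1
          apply h1.2
          rw [← norm_eq_zero, hj1, norm_iteratedFDeriv_one, hx, norm_zero]
        refine mem_iUnion.2 ⟨j - 1, x, ⟨⟨hxD, hx⟩, ?_, ?_⟩, rfl⟩
        · by_contra hne
          have := Nat.find_min' h ⟨by omega, hne⟩
          omega
        · intro h0
          have h2 := norm_fderiv_iteratedFDeriv (𝕜 := ℝ) (f := f) (n := j - 1) (x := x)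
          rw [Nat.sub_add_cancel h1.1] at h2
          exact h1.2 (norm_eq_zero.1 (h2.symm.trans ((congrArg norm h0).trans
            (ContinuousLinearMap.opNorm_zero))))
    refine le_antisymm ((dimH_mono hcover).trans ?_) bot_le
    rw [dimH_union, dimH_iUnion, dimH_image_flat_le hD hf (fun x hx => hx.1) (fun x hx => hx.2)]
    refine max_le bot_le (iSup_le fun i => ?_)
    refine (dimH_image_eq_zero_of_locally fun x hx => ?_).le
    obtain ⟨⟨hxD, hx0⟩, hxi, hxd⟩ := hx
    have hg : ContDiffOn ℝ ∞ (iteratedFDeriv ℝ i f) D := fun y hy =>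
      ((hf.contDiffAt (hD.mem_nhds hy)).iteratedFDeriv_right (m := ∞) (by
        exact_mod_cast le_top)).contDiffWithinAt
    -- Some component of the derivative of order `i` has nonzero differential at `x`. Near `x` this
    -- stratum lies in the zero set of that component, a hypersurface of dimension `m`, and its
    -- points stay critical for the restriction of `f`, so induction applies.
    obtain ⟨v, hv⟩ := DFunLike.ne_iff.1 hxd
    obtain ⟨mv, hmv⟩ := DFunLike.ne_iff.1 hv
    have hw : ContDiffOn ℝ ∞ (fun y => iteratedFDeriv ℝ i f y mv) D :=
      (ContinuousMultilinearMap.apply ℝ (fun _ : Fin i => X) ℝ mv).contDiff.comp_contDiffOn hg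
    have hwd : fderiv ℝ (fun y => iteratedFDeriv ℝ i f y mv) x v ≠ 0 := by
      have := (ContinuousMultilinearMap.apply ℝ (fun _ : Fin i => X) ℝ mv).hasFDerivAt.comp x
        (contDiffOn_differentiableAt hD hg hxD).hasFDerivAt
      have h2 : fderiv ℝ (fun y => iteratedFDeriv ℝ i f y mv) x = _ := this.fderiv
      rw [h2]
      exact hmv
    set w := fun y => iteratedFDeriv ℝ i f y mv with hwdef
    have hsurj : Function.Surjective (fderiv ℝ w x) := fun c =>
      ⟨(c / fderiv ℝ w x v) • v, by simp [hwd]⟩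
    obtain ⟨W, φ, P, D', hW, hφ, hD', hxD', hD'D, h1, h2, h3⟩ :=
      exists_parametrization hD hw hxD hsurj
    have hker : finrank ℝ (fderiv ℝ w x).ker = m := by
      have h4 := LinearMap.finrank_range_add_finrank_ker (fderiv ℝ w x : X →ₗ[ℝ] ℝ)
      rw [LinearMap.range_eq_top.2 hsurj, finrank_top, finrank_self, hX] at h4
      have : finrank ℝ (fderiv ℝ w x : X →ₗ[ℝ] ℝ).ker = m := by omega
      exact this
    refine ⟨D', mem_nhdsWithin_of_mem_nhds (hD'.mem_nhds hxD'), ?_⟩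
    have h5 := ih (fderiv ℝ w x).ker hker W (f ∘ φ) hW
      (hf.comp hφ fun z hz => hD'D (h2 z hz).1)
    refine le_antisymm (le_trans (dimH_mono ?_) h5.le) bot_le
    rintro _ ⟨y, ⟨⟨⟨hyD, hy0⟩, hyi, -⟩, hyD'⟩, rfl⟩
    obtain ⟨hPW, hPφ⟩ := h1 y hyD' (by simp [hwdef, hyi])
    refine ⟨P y, ⟨hPW, ?_⟩, by simp [hPφ]⟩
    rw [fderiv_comp _ (by rw [hPφ]; exact contDiffOn_differentiableAt hD hf hyD)
      (contDiffOn_differentiableAt hW hφ hPW), hPφ, hy0]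
    simp

end Sard

/-! ### Hyperspheres, unit normals and normal lines. -/

section Geometry

open Module

variable {n : ℕ}

theorem mem_conformalSpace {p : Euc n} : p ∈ conformalSpace n ↔ ‖p‖ = 1 := by
  simp [conformalSpace]

theorem inner_self_of_mem {p : Euc n} (hp : p ∈ conformalSpace n) : inner ℝ p p = 1 := by
  rw [real_inner_self_eq_norm_sq, mem_conformalSpace.1 hp, one_pow]

theorem form_comm (x y : Amb n) : form n x y = form n y x := by
  rw [form_apply, form_apply, real_inner_comm, mul_comm]

theorem mem_polar {L : Submodule ℝ (Amb n)} {y : Amb n} :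
    y ∈ polar L ↔ ∀ x ∈ L, form n x y = 0 := Iff.rfl

theorem mem_polar_span_singleton {v y : Amb n} :
    y ∈ polar (Submodule.span ℝ {v}) ↔ form n v y = 0 := by
  rw [mem_polar]
  constructor
  · exact fun h => h v (Submodule.mem_span_singleton_self v)
  · intro h x hx
    obtain ⟨c, rfl⟩ := Submodule.mem_span_singleton.1 hx
    simp [h]

theorem form_darboux (p : Euc n) (y : Amb n) : form n (darboux p) y = inner ℝ p y.1 - y.2 := by
  simp [form_apply, darboux]

theorem darboux_ne_zero (p : Euc n) : darboux p ≠ 0 := by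
  intro h
  have := congrArg Prod.snd h
  simp [darboux] at this

theorem isAbsolutePoint_darboux {p : Euc n} (hp : p ∈ conformalSpace n) :
    IsAbsolutePoint (darboux p) := by
  refine ⟨darboux_ne_zero p, ?_⟩
  rw [form_darboux]
  simp [darboux, mem_conformalSpace.1 hp]

/-- The points of the absolute are the images of the Darboux map. -/
theorem IsAbsolutePoint.exists_darboux {v : Amb n} (hv : IsAbsolutePoint v) :
    v.2 ≠ 0 ∧ v.2⁻¹ • v.1 ∈ conformalSpace n ∧ v = v.2 • darboux (v.2⁻¹ • v.1) := by
  obtain ⟨h0, hf⟩ := hv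
  rw [form_apply, real_inner_self_eq_norm_sq] at hf
  have h2 : v.2 ≠ 0 := by
    intro h
    apply h0
    rw [h] at hf
    exact Prod.ext (by simpa using hf) h
  refine ⟨h2, ?_, ?_⟩
  · rw [mem_conformalSpace, norm_smul, norm_inv, Real.norm_eq_abs]
    have : ‖v.1‖ = |v.2| := by
      rw [← abs_norm, ← sq_eq_sq_iff_abs_eq_abs]; linarith
    rw [this, inv_mul_cancel₀ (abs_ne_zero.2 h2)]
  · exact Prod.ext (by simp [darboux, smul_smul, h2]) (by simp [darboux])

theorem span_singleton_smul_eq' {c : ℝ} (hc : c ≠ 0) (v : Amb n) :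
    Submodule.span ℝ {c • v} = Submodule.span ℝ {v} :=
  Submodule.span_singleton_smul_eq (IsUnit.mk0 c hc) v

theorem mem_deSitter_mk {u : Amb n} (hu : u ≠ 0) :
    Projectivization.mk ℝ u hu ∈ deSitter n ↔ 0 < form n u u := by
  obtain ⟨a, ha⟩ := Projectivization.exists_smul_eq_mk_rep ℝ u hu
  rw [deSitter, mem_ofPred_eq, ← ha, Units.smul_def]
  simp only [map_smul, LinearMap.smul_apply, smul_eq_mul, ← mul_assoc]
  exact mul_pos_iff_of_pos_left (mul_self_pos.2 a.ne_zero)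

theorem mem_points_mk {L : Submodule ℝ (Amb n)} {u : Amb n} (hu : u ≠ 0) :
    Projectivization.mk ℝ u hu ∈ points L ↔ u ∈ L := by
  rw [points, mem_ofPred_eq, Projectivization.submodule_mk, Submodule.span_singleton_le_iff_mem]

theorem mem_hypersphere_mk {u : Amb n} (hu : u ≠ 0) {p : Euc n} :
    p ∈ hypersphere (Projectivization.mk ℝ u hu) ↔
      p ∈ conformalSpace n ∧ inner ℝ u.1 p = u.2 := by
  rw [hypersphere, mem_ofPred_eq, Projectivization.submodule_mk, mem_polar_span_singleton,
    form_comm, form_darboux, sub_eq_zero, real_inner_comm]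

theorem ne_zero_of_form_pos {u : Amb n} (hu : 0 < form n u u) : u ≠ 0 := by
  rintro rfl
  simp at hu

/-- On the polar hyperplane of the absolute point `(p, 1)` the form is degenerate along that point,
so only the component with the multiple of `(p, 1)` removed contributes. -/
theorem form_self_eq (u : Amb n) (p : Euc n) (hp : p ∈ conformalSpace n)
    (hu : inner ℝ u.1 p = u.2) : form n u u = ‖u.1 - u.2 • p‖ ^ 2 := by
  rw [form_apply, ← real_inner_self_eq_norm_sq]
  simp only [inner_sub_left, inner_sub_right, real_inner_smul_left, real_inner_smul_right, hu,
    real_inner_comm u.1 p, inner_self_of_mem hp]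
  ring

/-- Adjoining the equation of the sphere to `f` presents a hypersurface of the sphere as a regular
level set in a linear space. -/
theorem contDiffOn_sphereLevel {O : Set (Euc n)} {f : Euc n → ℝ} (hf : ContDiffOn ℝ ∞ f O) :
    ContDiffOn ℝ ∞ (fun q : Euc n => (inner ℝ q q - (1 : ℝ), f q)) O :=
  ((contDiff_id.inner ℝ contDiff_id).sub contDiff_const).contDiffOn.prodMk hf

theorem fderiv_sphereLevel {O : Set (Euc n)} {f : Euc n → ℝ} {p : Euc n} (hO : IsOpen O)
    (hpO : p ∈ O) (hf : ContDiffOn ℝ ∞ f O) (t : Euc n) :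
    fderiv ℝ (fun q : Euc n => (inner ℝ q q - (1 : ℝ), f q)) p t =
      (2 * inner ℝ p t, fderiv ℝ f p t) := by
  have h1 : DifferentiableAt ℝ (fun q : Euc n => inner ℝ q q - (1 : ℝ)) p :=
    (differentiableAt_id.inner ℝ differentiableAt_id).sub_const 1
  have h2 := fderiv_inner_apply ℝ (f := fun q : Euc n => q) (g := fun q : Euc n => q) (x := p)
    differentiableAt_fun_id differentiableAt_fun_id t
  rw [DifferentiableAt.fderiv_prodMk h1 (contDiffOn_differentiableAt hO hf hpO),
    ContinuousLinearMap.prod_apply, fderiv_sub_const, h2]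
  simp [real_inner_comm p t, two_mul]

theorem surjective_fderiv_sphereLevel {O : Set (Euc n)} {f : Euc n → ℝ} {p : Euc n}
    (hO : IsOpen O) (hpO : p ∈ O) (hf : ContDiffOn ℝ ∞ f O) (hp : p ∈ conformalSpace n)
    (hv : ∃ v : Euc n, inner ℝ p v = 0 ∧ fderiv ℝ f p v ≠ 0) :
    Function.Surjective (fderiv ℝ (fun q : Euc n => (inner ℝ q q - (1 : ℝ), f q)) p) := by
  obtain ⟨v, hv1, hv2⟩ := hv
  rintro ⟨a, b⟩
  -- The radial part adjusts the sphere coordinate, whose derivative is `2 * inner ℝ p t`. The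
  -- direction `v` is tangent to the sphere and corrects the remaining coordinate.
  refine ⟨(a / 2) • p + ((b - a / 2 * fderiv ℝ f p p) / fderiv ℝ f p v) • v, ?_⟩
  rw [fderiv_sphereLevel hO hpO hf]
  simp only [inner_add_right, real_inner_smul_right, inner_self_of_mem hp, hv1, map_add,
    map_smul, smul_eq_mul]
  ext
  · simp; ring
  · simp; field_simp; ring

theorem sphereLevel_eq_zero_iff {f : Euc n → ℝ} {q : Euc n} :
    (inner ℝ q q - (1 : ℝ), f q) = 0 ↔ q ∈ conformalSpace n ∧ f q = 0 := by
  rw [Prod.mk_eq_zero, mem_conformalSpace, real_inner_self_eq_norm_sq, sub_eq_zero,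
    pow_eq_one_iff_of_nonneg (norm_nonneg _) two_ne_zero]

/-- The tangent space of a hypersurface of the conformal space given by an equation. -/
theorem mem_tangentSubspace_level {V O : Set (Euc n)} {f : Euc n → ℝ} {p : Euc n} (hO : IsOpen O)
    (hpO : p ∈ O) (hf : ContDiffOn ℝ ∞ f O) (hp : p ∈ V)
    (hV : V ∩ O = {q | q ∈ conformalSpace n ∧ q ∈ O ∧ f q = 0})
    (hv : ∃ v : Euc n, inner ℝ p v = 0 ∧ fderiv ℝ f p v ≠ 0) (t : Euc n) :
    t ∈ tangentSubspace V p ↔ inner ℝ p t = 0 ∧ fderiv ℝ f p t = 0 := by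
  have hpS : p ∈ conformalSpace n := by
    have : p ∈ V ∩ O := ⟨hp, hpO⟩
    rw [hV] at this; exact this.1
  rw [tangentSubspace_eq_ker hO (contDiffOn_sphereLevel hf) (a := p) (A := V) ?_ ⟨hp, hpO⟩
    (surjective_fderiv_sphereLevel hO hpO hf hpS hv)]
  · rw [LinearMap.mem_ker]
    erw [fderiv_sphereLevel hO hpO hf]
    simp
  · rw [hV]
    ext q
    simp only [mem_ofPred_eq, sphereLevel_eq_zero_iff]
    tauto

/-- A smooth parametrization of a hypersurface of the conformal space near a point. -/
theorem IsConformalHypersurface.exists_parametrization {V : Set (Euc n)}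
    (hV : IsConformalHypersurface V) {p : Euc n} (hp : p ∈ V) :
    ∃ (Z : Submodule ℝ (Euc n)) (W : Set Z) (φ : Z → Euc n) (P : Euc n → Z) (D : Set (Euc n)),
      IsOpen W ∧ ContDiffOn ℝ ∞ φ W ∧ D ∈ 𝓝 p ∧
      (∀ x ∈ V ∩ D, P x ∈ W ∧ φ (P x) = x) ∧ ∀ z ∈ W, φ z ∈ V := by
  obtain ⟨O, f, hO, hpO, hf, hVO, hv⟩ := hV.2 p hp
  obtain ⟨W, φ, P, D, hW, hφ, hD, hpD, hDO, h1, h2, -⟩ :=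
    DeSitter.exists_parametrization hO (contDiffOn_sphereLevel hf) hpO
      (surjective_fderiv_sphereLevel hO hpO hf (hV.1 hp) hv)
  refine ⟨_, W, φ, P, D, hW, hφ, hD.mem_nhds hpD, fun x hx => h1 x hx.2 ?_, fun z hz => ?_⟩
  · have : x ∈ V ∩ O := ⟨hx.1, hDO hx.2⟩
    rw [hVO] at this
    exact sphereLevel_eq_zero_iff.2 ⟨this.1, this.2.2⟩
  · obtain ⟨h3, h4⟩ := h2 z hz
    rw [sphereLevel_eq_zero_iff] at h4
    have : φ z ∈ V ∩ O := by rw [hVO]; exact ⟨h4.1, hDO h3, h4.2⟩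
    exact this.1

/-- A linear functional that does not vanish on the tangent space of the sphere. -/
theorem exists_unit_normal {p : Euc n} (hp : p ∈ conformalSpace n) (l : Euc n →L[ℝ] ℝ)
    (hl : ∃ v : Euc n, inner ℝ p v = 0 ∧ l v ≠ 0) :
    ∃ N : Euc n, ‖N‖ = 1 ∧ inner ℝ p N = 0 ∧
      ∀ t, (inner ℝ p t = 0 ∧ l t = 0 ↔ inner ℝ p t = 0 ∧ inner ℝ N t = 0) := by
  set g := (InnerProductSpace.toDual ℝ (Euc n)).symm l with hg
  have hgl : ∀ t, inner ℝ g t = l t := fun t => InnerProductSpace.toDual_symm_apply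
  -- Removing the radial part of the Riesz vector of `l` does not change its values on the tangent
  -- space of the sphere.
  set G := g - (inner ℝ p g : ℝ) • p with hG
  have hGl : ∀ t, inner ℝ p t = 0 → inner ℝ G t = l t := by
    intro t ht
    rw [hG, inner_sub_left, real_inner_smul_left, ht, mul_zero, sub_zero, hgl]
  have hG0 : G ≠ 0 := by
    obtain ⟨v, hv1, hv2⟩ := hl
    intro h
    apply hv2
    rw [← hGl v hv1, h, inner_zero_left]
  have hGn : ‖G‖ ≠ 0 := norm_ne_zero_iff.2 hG0
  refine ⟨‖G‖⁻¹ • G, ?_, ?_, ?_⟩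
  · rw [norm_smul, norm_inv, norm_norm, inv_mul_cancel₀ hGn]
  · rw [real_inner_smul_right, hG, inner_sub_right, real_inner_smul_right, inner_self_of_mem hp]
    ring
  · intro t
    refine and_congr_right fun ht => ?_
    rw [real_inner_smul_left, hGl t ht]
    simp [hGn]

/-- `N` is a unit normal of `V` at `p` in the conformal space. -/
def IsUnitNormal (V : Set (Euc n)) (p N : Euc n) : Prop :=
  p ∈ conformalSpace n ∧ p ∈ V ∧ ‖N‖ = 1 ∧ inner ℝ p N = 0 ∧
    ∀ t, t ∈ tangentSubspace V p ↔ inner ℝ p t = 0 ∧ inner ℝ N t = 0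

theorem IsConformalHypersurface.exists_isUnitNormal {V : Set (Euc n)}
    (hV : IsConformalHypersurface V) {p : Euc n} (hp : p ∈ V) : ∃ N, IsUnitNormal V p N := by
  obtain ⟨O, f, hO, hpO, hf, hVO, hv⟩ := hV.2 p hp
  obtain ⟨N, h1, h2, h3⟩ := exists_unit_normal (hV.1 hp) (fderiv ℝ f p) hv
  exact ⟨N, hV.1 hp, hp, h1, h2, fun t =>
    (mem_tangentSubspace_level hO hpO hf hp hVO hv t).trans (h3 t)⟩

theorem mem_tangentSubspace_hypersphere {u : Amb n} (hu : 0 < form n u u) {p : Euc n}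
    (hp : p ∈ hypersphere (Projectivization.mk ℝ u (ne_zero_of_form_pos hu))) (t : Euc n) :
    t ∈ tangentSubspace (hypersphere (Projectivization.mk ℝ u (ne_zero_of_form_pos hu))) p ↔
      inner ℝ p t = 0 ∧ inner ℝ u.1 t = 0 := by
  have hp' := (mem_hypersphere_mk _).1 hp
  have hd : ∀ t, fderiv ℝ (fun q : Euc n => inner ℝ u.1 q - u.2) p t = inner ℝ u.1 t := by
    intro t
    have h2 := fderiv_inner_apply ℝ (f := fun _ : Euc n => u.1) (g := fun q : Euc n => q) (x := p)
      (differentiableAt_const _) differentiableAt_fun_id t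
    rw [fderiv_sub_const, h2]
    simp
  rw [mem_tangentSubspace_level (f := fun q : Euc n => inner ℝ u.1 q - u.2) isOpen_univ
    (mem_univ p) ((contDiff_const.inner ℝ contDiff_id).sub contDiff_const).contDiffOn hp ?_ ?_ t, hd]
  · ext q
    simp [mem_hypersphere_mk, sub_eq_zero]
  · refine ⟨u.1 - u.2 • p, ?_, ?_⟩
    · rw [inner_sub_right, real_inner_smul_right, inner_self_of_mem hp'.1, real_inner_comm, hp'.2]
      ring
    · rw [hd, inner_sub_right, real_inner_smul_right, hp'.2]
      rw [form_apply] at hu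
      exact hu.ne'

/-- The line joining the point `p` of the absolute with the point `(N, 0)`. -/
noncomputable def normalLine (p N : Euc n) : Submodule ℝ (Amb n) :=
  Submodule.span ℝ {darboux p, (N, 0)}

theorem mem_normalLine {p N : Euc n} {u : Amb n} :
    u ∈ normalLine p N ↔ ∃ a b : ℝ, a • darboux p + b • ((N, 0) : Amb n) = u :=
  Submodule.mem_span_pair

theorem darboux_mem_normalLine (p N : Euc n) : darboux p ∈ normalLine p N :=
  Submodule.subset_span (by simp)

theorem form_normalLine {p N : Euc n} (hp : p ∈ conformalSpace n) (hN : ‖N‖ = 1)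
    (hpN : inner ℝ p N = 0) (a b : ℝ) :
    form n (a • darboux p + b • ((N, 0) : Amb n)) (a • darboux p + b • ((N, 0) : Amb n)) = b ^ 2 := by
  have h1 : inner ℝ N N = (1 : ℝ) := by rw [real_inner_self_eq_norm_sq, hN, one_pow]
  rw [form_apply]
  simp only [darboux, Prod.fst_add, Prod.smul_fst, Prod.snd_add, Prod.smul_snd, smul_eq_mul,
    inner_add_left, inner_add_right, real_inner_smul_left, real_inner_smul_right, hpN,
    real_inner_comm p N, h1, inner_self_of_mem hp]
  ring

/-- The hyperspheres tangent to `V` at `p` correspond to the points of the normal line. -/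
theorem IsUnitNormal.tangentAt_iff {V : Set (Euc n)} {p N : Euc n} (h : IsUnitNormal V p N)
    {u : Amb n} (hu : 0 < form n u u) :
    TangentAt V (hypersphere (Projectivization.mk ℝ u (ne_zero_of_form_pos hu))) p ↔
      u ∈ normalLine p N := by
  obtain ⟨hpS, hpV, hN, hpN, hT⟩ := h
  have hNN : inner ℝ N N = (1 : ℝ) := by rw [real_inner_self_eq_norm_sq, hN, one_pow]
  constructor
  · rintro ⟨-, hpσ, hTe⟩
    have hup := ((mem_hypersphere_mk _).1 hpσ).2
    -- The part of `u.1` orthogonal to `p` and `N` is tangent to `V`, hence to the hypersphere,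
    -- hence orthogonal to `u.1`. It is then orthogonal to itself and vanishes.
    set r := u.1 - u.2 • p - (inner ℝ u.1 N : ℝ) • N with hr
    have hpr : inner ℝ p r = 0 := by
      rw [hr]
      simp only [inner_sub_right, real_inner_smul_right, inner_self_of_mem hpS, hpN,
        real_inner_comm u.1 p, hup]
      ring
    have hNr : inner ℝ N r = 0 := by
      rw [hr]
      simp only [inner_sub_right, real_inner_smul_right, hNN, real_inner_comm p N, hpN,
        real_inner_comm u.1 N]
      ring
    have h1 : r ∈ tangentSubspace V p := (hT r).2 ⟨hpr, hNr⟩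
    rw [hTe, mem_tangentSubspace_hypersphere hu hpσ] at h1
    have h2 : inner ℝ r r = (0 : ℝ) := by
      conv_lhs => rw [hr]
      rw [inner_sub_left, inner_sub_left, real_inner_smul_left, real_inner_smul_left, h1.2, hpr,
        hNr]
      ring
    have h3 : r = 0 := inner_self_eq_zero.1 h2
    rw [mem_normalLine]
    refine ⟨u.2, inner ℝ u.1 N, ?_⟩
    rw [hr, sub_sub, sub_eq_zero] at h3
    exact Prod.ext (by simp [darboux, h3.symm]) (by simp [darboux])
  · intro hu'
    obtain ⟨a, b, rfl⟩ := mem_normalLine.1 hu'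
    have hb : b ≠ 0 := by
      rintro rfl
      rw [form_normalLine hpS hN hpN] at hu
      simp at hu
    have hpσ : p ∈ hypersphere (Projectivization.mk ℝ _ (ne_zero_of_form_pos hu)) := by
      rw [mem_hypersphere_mk]
      refine ⟨hpS, ?_⟩
      simp [darboux, inner_add_left, real_inner_smul_left, mem_conformalSpace.1 hpS,
        real_inner_comm p N, hpN]
    refine ⟨hpV, hpσ, ?_⟩
    ext t
    rw [hT, mem_tangentSubspace_hypersphere hu hpσ]
    refine and_congr_right fun ht => ?_
    simp [darboux, inner_add_left, real_inner_smul_left, ht, hb]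

/-- Conjugacy to `(p, 1)` fixes the radial part of a vector and conjugacy to the tangent space kills
the tangential part, which leaves the normal direction. As the polar does not involve `N`, the
normal line depends on `V` and `p` only. -/
theorem IsUnitNormal.polar_projTangent {V : Set (Euc n)} {p N : Euc n} (h : IsUnitNormal V p N) :
    polar (projTangent V p) = normalLine p N := by
  obtain ⟨hpS, hpV, hN, hpN, hT⟩ := h
  have hNN : inner ℝ N N = (1 : ℝ) := by rw [real_inner_self_eq_norm_sq, hN, one_pow]
  apply le_antisymm
  · intro u hu
    rw [mem_polar] at hu
    have h1 := hu (darboux p) (Submodule.mem_sup_left (Submodule.mem_span_singleton_self _))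
    rw [form_darboux, sub_eq_zero] at h1
    have h2 : ∀ t ∈ tangentSubspace V p, inner ℝ t u.1 = 0 := by
      intro t ht
      have := hu (t, 0) (Submodule.mem_sup_right ⟨t, ht, rfl⟩)
      simpa [form_apply] using this
    set r := u.1 - u.2 • p - (inner ℝ N u.1 : ℝ) • N with hr
    have hpr : inner ℝ p r = 0 := by
      rw [hr]
      simp only [inner_sub_right, real_inner_smul_right, inner_self_of_mem hpS, hpN, h1]
      ring
    have hNr : inner ℝ N r = 0 := by
      rw [hr]
      simp only [inner_sub_right, real_inner_smul_right, hNN, real_inner_comm p N, hpN]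
      ring
    have h4 := h2 r ((hT r).2 ⟨hpr, hNr⟩)
    have h2 : inner ℝ r r = (0 : ℝ) := by
      conv_lhs => arg 3; rw [hr]
      rw [inner_sub_right, inner_sub_right, h4, real_inner_smul_right, real_inner_smul_right,
        real_inner_comm, hpr, real_inner_comm N r, hNr]
      ring
    have h3 : r = 0 := inner_self_eq_zero.1 h2
    rw [mem_normalLine]
    refine ⟨u.2, inner ℝ N u.1, ?_⟩
    rw [hr, sub_sub, sub_eq_zero] at h3
    exact Prod.ext (by simp [darboux, h3.symm]) (by simp [darboux])
  · intro u hu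
    obtain ⟨a, b, rfl⟩ := mem_normalLine.1 hu
    rw [mem_polar]
    intro x hx
    obtain ⟨y, hy, z, hz, rfl⟩ := Submodule.mem_sup.1 hx
    obtain ⟨c, rfl⟩ := Submodule.mem_span_singleton.1 hy
    obtain ⟨t, ht, rfl⟩ := hz
    obtain ⟨h1, h2⟩ := (hT t).1 ht
    simp [form_apply, darboux, inner_add_left, inner_add_right, real_inner_smul_left,
      real_inner_smul_right, mem_conformalSpace.1 hpS, hpN, real_inner_comm p t, h1,
      real_inner_comm N t, h2, mul_comm]

theorem lineTouchesAt_normalLine {p N : Euc n} (hp : p ∈ conformalSpace n) (hN : ‖N‖ = 1)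
    (hpN : inner ℝ p N = 0) : LineTouchesAt (normalLine p N) (darboux p) := by
  have hN0 : N ≠ 0 := by rintro rfl; simp at hN
  refine ⟨?_, isAbsolutePoint_darboux hp, darboux_mem_normalLine p N, ?_⟩
  · have : LinearIndependent ℝ ![darboux p, ((N, 0) : Amb n)] := by
      rw [LinearIndependent.pair_iff]
      intro s t hst
      have h1 := congrArg Prod.snd hst
      have h2 := congrArg Prod.fst hst
      simp [darboux] at h1 h2
      subst h1
      simpa [hN0] using h2
    have := finrank_span_eq_card this
    rw [Matrix.range_cons, Matrix.range_cons, Matrix.range_empty, union_empty, ← insert_eq,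
      Fintype.card_fin] at this
    exact this
  · intro u hu
    obtain ⟨a, b, rfl⟩ := mem_normalLine.1 hu
    rw [mem_polar_span_singleton, form_darboux]
    simp [darboux, inner_add_right, real_inner_smul_right, mem_conformalSpace.1 hp, hpN]

/-- An isotropic line is the normal line of its point on the absolute. -/
theorem LineTouchesAt.exists_normalLine {L : Submodule ℝ (Amb n)} {q : Euc n}
    (hq : q ∈ conformalSpace n) (hL : LineTouchesAt L (darboux q)) :
    ∃ m : Euc n, ‖m‖ = 1 ∧ inner ℝ q m = 0 ∧ L = normalLine q m := by
  obtain ⟨hd, -, hqL, hpol⟩ := hL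
  have hne : ¬ L ≤ Submodule.span ℝ {darboux q} := by
    intro hle
    have := Submodule.finrank_mono hle
    rw [hd, finrank_span_singleton (darboux_ne_zero q)] at this
    omega
  obtain ⟨y, hyL, hy⟩ := SetLike.not_le_iff_exists.1 hne
  have h1 := hpol hyL
  rw [mem_polar_span_singleton, form_darboux] at h1
  -- Subtracting the multiple of `darboux q` that cancels the last coordinate leaves `(g, 0)` in the
  -- line. Tangency makes `g` orthogonal to `q`.
  set g := y.1 - y.2 • q with hg
  have hg0 : g ≠ 0 := by
    intro h0
    apply hy
    rw [Submodule.mem_span_singleton]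
    refine ⟨y.2, ?_⟩
    rw [hg, sub_eq_zero] at h0
    exact Prod.ext (by simp [darboux, h0]) (by simp [darboux])
  have hgn : ‖g‖ ≠ 0 := norm_ne_zero_iff.2 hg0
  have hgL : ((g, 0) : Amb n) ∈ L := by
    have : ((g, 0) : Amb n) = y - y.2 • darboux q :=
      Prod.ext (by simp [darboux, hg]) (by simp [darboux])
    rw [this]
    exact L.sub_mem hyL (L.smul_mem _ hqL)
  have hm1 : ‖‖g‖⁻¹ • g‖ = 1 := by rw [norm_smul, norm_inv, norm_norm, inv_mul_cancel₀ hgn]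
  have hm2 : inner ℝ q (‖g‖⁻¹ • g) = 0 := by
    rw [real_inner_smul_right, hg, inner_sub_right, real_inner_smul_right, inner_self_of_mem hq]
    rw [mul_one, h1, mul_zero]
  refine ⟨‖g‖⁻¹ • g, hm1, hm2, ?_⟩
  symm
  apply Submodule.eq_of_le_of_finrank_eq
  · rw [normalLine, Submodule.span_le]
    rintro x (rfl | rfl)
    · exact hqL
    · have : ((‖g‖⁻¹ • g, 0) : Amb n) = ‖g‖⁻¹ • (g, 0) := by simp
      rw [this]
      exact L.smul_mem _ hgL
  · rw [hd, (lineTouchesAt_normalLine hq hm1 hm2).1]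

theorem LineTouchesAt.smul {L : Submodule ℝ (Amb n)} {v : Amb n} {c : ℝ} (hc : c ≠ 0)
    (h : LineTouchesAt L v) : LineTouchesAt L (c • v) := by
  obtain ⟨h1, ⟨h2, h3⟩, h4, h5⟩ := h
  refine ⟨h1, ⟨smul_ne_zero hc h2, by simp [h3]⟩, L.smul_mem _ h4, ?_⟩
  rwa [span_singleton_smul_eq' hc]

theorem LineTouchesAt.darboux {L : Submodule ℝ (Amb n)} {v : Amb n} (h : LineTouchesAt L v) :
    LineTouchesAt L (darboux (v.2⁻¹ • v.1)) := by
  obtain ⟨h1, -, h3⟩ := h.2.1.exists_darboux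
  have := h.smul (inv_ne_zero h1)
  rwa [h3, smul_smul, ← h3, inv_mul_cancel₀ h1, one_smul] at this

/-- An isotropic line has only one point on the absolute. -/
theorem LineTouchesAt.eq_of_darboux {L : Submodule ℝ (Amb n)} {p q : Euc n}
    (hp : p ∈ conformalSpace n) (hq : q ∈ conformalSpace n)
    (h : LineTouchesAt L (DeSitter.darboux p)) (h' : LineTouchesAt L (DeSitter.darboux q)) :
    p = q := by
  have h1 := h.2.2.2 h'.2.2.1
  rw [mem_polar_span_singleton, form_darboux, sub_eq_zero] at h1
  exact (inner_eq_one_iff_of_norm_eq_one (mem_conformalSpace.1 hp) (mem_conformalSpace.1 hq)).1 h1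

theorem mk_rep_cases {P : Proj n → Prop} (h : ∀ (u : Amb n) (hu : u ≠ 0), P (.mk ℝ u hu))
    (x : Proj n) : P x := by
  rw [← Projectivization.mk_rep x]; exact h _ _

/-- The normal line is a generator of the union of the tangent hyperspheres. -/
theorem IsUnitNormal.normalLine_mem_generators {V : Set (Euc n)} {p N : Euc n}
    (h : IsUnitNormal V p N) : normalLine p N ∈ generators (tangentHyperspheres V) := by
  refine ⟨⟨_, lineTouchesAt_normalLine h.1 h.2.2.1 h.2.2.2.1⟩, ?_⟩
  refine mk_rep_cases fun u hu => ?_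
  rintro ⟨h1, h2⟩
  rw [mem_points_mk] at h1
  exact ⟨h2, p, h.2.1, (h.tangentAt_iff ((mem_deSitter_mk hu).1 h2)).2 h1⟩

theorem IsUnitNormal.pencilOfLine_eq {V : Set (Euc n)} {p N : Euc n} (h : IsUnitNormal V p N) :
    pencilOfLine (normalLine p N) = tangentPencil V p := by
  ext σ
  constructor
  · rintro ⟨x, ⟨hx1, hx2⟩, rfl⟩
    refine ⟨⟨x, hx2, rfl⟩, ?_⟩
    rw [← Projectivization.mk_rep x] at hx1 hx2 ⊢
    rw [mem_points_mk] at hx1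
    exact (h.tangentAt_iff ((mem_deSitter_mk _).1 hx2)).2 hx1
  · rintro ⟨⟨x, hx, rfl⟩, ht⟩
    refine ⟨x, ⟨?_, hx⟩, rfl⟩
    rw [← Projectivization.mk_rep x] at hx ht ⊢
    rw [mem_points_mk]
    exact (h.tangentAt_iff ((mem_deSitter_mk _).1 hx)).1 ht

theorem form_normal_pos {N : Euc n} (hN : ‖N‖ = 1) : 0 < form n ((N, 0) : Amb n) (N, 0) := by
  simp [form_apply, hN]

/-- The great hypersphere with pole `(N, 0)` touches `V` at `p` and serves as the given member.
Tangency at `p` is equality of tangent spaces, hence transitive. -/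
theorem IsUnitNormal.isParabolicPencil {V : Set (Euc n)} {p N : Euc n} (h : IsUnitNormal V p N) :
    IsParabolicPencil (tangentPencil V p) p := by
  have h1 := form_normal_pos h.2.2.1
  have h2 : TangentAt V (hypersphere (Projectivization.mk ℝ _ (ne_zero_of_form_pos h1))) p :=
    (h.tangentAt_iff h1).2 (Submodule.subset_span (by simp))
  refine ⟨_, ⟨_, (mem_deSitter_mk _).2 h1, rfl⟩, h2.2.1, ?_⟩
  ext σ
  refine and_congr_right fun _ => ?_
  exact ⟨fun h3 => ⟨h2.2.1, h3.2.1, h2.2.2.symm.trans h3.2.2⟩,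
    fun h3 => ⟨h2.1, h3.2.1, h2.2.2.trans h3.2.2⟩⟩

theorem mem_tangentHyperspheres_iff {V : Set (Euc n)} (hV : IsConformalHypersurface V) {u : Amb n}
    (hu : 0 < form n u u) :
    Projectivization.mk ℝ u (ne_zero_of_form_pos hu) ∈ tangentHyperspheres V ↔
      ∃ p N, IsUnitNormal V p N ∧ u ∈ normalLine p N := by
  constructor
  · rintro ⟨-, p, hp, ht⟩
    obtain ⟨N, hN⟩ := hV.exists_isUnitNormal hp
    exact ⟨p, N, hN, (hN.tangentAt_iff hu).1 ht⟩
  · rintro ⟨p, N, hN, ht⟩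
    exact ⟨(mem_deSitter_mk _).2 hu, p, hN.2.1, (hN.tangentAt_iff hu).2 ht⟩

end Geometry

/-! ### The generators of U(V) are exactly the normal lines. -/

section Generators

open Module

variable {n : ℕ}

/-- Sard's theorem for a smooth function on a hypersurface of the conformal space. -/
theorem IsConformalHypersurface.dimH_image_critical_eq_zero {V : Set (Euc n)}
    (hV : IsConformalHypersurface V) {D : Set (Euc n)} (hD : IsOpen D) {A : Euc n → ℝ}
    (hA : ContDiffOn ℝ ∞ A D) :
    dimH (A '' {p | p ∈ V ∧ p ∈ D ∧ ∀ t ∈ tangentSubspace V p, fderiv ℝ A p t = 0}) = 0 := by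
  refine dimH_image_eq_zero_of_locally fun p hp => ?_
  obtain ⟨Z, W, φ, P, D', hW, hφ, hD', h1, h2⟩ := hV.exists_parametrization hp.1
  have hWD : IsOpen (W ∩ φ ⁻¹' D) := hφ.continuousOn.isOpen_inter_preimage hW hD
  refine ⟨D', mem_nhdsWithin_of_mem_nhds hD', ?_⟩
  have h5 := DeSitter.dimH_image_critical_eq_zero (finrank ℝ Z) Z rfl (W ∩ φ ⁻¹' D) (A ∘ φ) hWD
    (hA.comp (hφ.mono inter_subset_left) fun z hz => hz.2)
  refine le_antisymm (le_trans (dimH_mono ?_) h5.le) bot_le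
  rintro _ ⟨x, ⟨⟨hxV, hxD, hxc⟩, hxD'⟩, rfl⟩
  obtain ⟨h3, h4⟩ := h1 x ⟨hxV, hxD'⟩
  refine ⟨P x, ⟨⟨h3, by simpa [h4] using hxD⟩, ?_⟩, by simp [h4]⟩
  have hd := contDiffOn_differentiableAt hW hφ h3
  rw [fderiv_comp _ (by rw [h4]; exact contDiffOn_differentiableAt hD hA hxD) hd, h4]
  ext v
  have := fderiv_mem_tangentSubspace (A := V) hd
    (by filter_upwards [hW.mem_nhds h3] with z hz using h2 z hz) v
  rw [h4] at this
  exact hxc _ this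

/-- The isotropic lines that lie in the union of the hyperspheres tangent to `V` are the normal
lines of `V`. -/
theorem IsConformalHypersurface.mem_generators_iff {V : Set (Euc n)}
    (hV : IsConformalHypersurface V) {L : Submodule ℝ (Amb n)} :
    L ∈ generators (tangentHyperspheres V) ↔ ∃ p N, IsUnitNormal V p N ∧ L = normalLine p N := by
  constructor
  swap
  · rintro ⟨p, N, h, rfl⟩
    exact h.normalLine_mem_generators
  rintro ⟨⟨v, hv⟩, hLU⟩
  have hq := hv.2.1.exists_darboux.2.1
  obtain ⟨m, hm, hqm, hL⟩ := hv.darboux.exists_normalLine hq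
  set q := v.2⁻¹ • v.1 with hqdef
  -- All points of the line except its tangency point are of this form up to a factor, so each real
  -- `a` has a point of `V` at which its hypersphere is tangent.
  have hua : ∀ a : ℝ, ∃ p N, IsUnitNormal V p N ∧
      a • darboux q + (1 : ℝ) • ((m, 0) : Amb n) ∈ normalLine p N := by
    intro a
    have hform : 0 < form n (a • darboux q + (1 : ℝ) • ((m, 0) : Amb n))
        (a • darboux q + (1 : ℝ) • ((m, 0) : Amb n)) := by
      rw [form_normalLine hq hm hqm]; norm_num
    refine (mem_tangentHyperspheres_iff hV hform).1 (hLU ⟨?_, ?_⟩)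
    · rw [mem_points_mk, hL, mem_normalLine]
      exact ⟨a, 1, rfl⟩
    · exact (mem_deSitter_mk _).2 hform
  -- If one of these hyperspheres is tangent to `V` at `q` itself, the line shares two points with
  -- the normal line at `q` and coincides with it. The other case contradicts Sard's theorem.
  by_cases hex : ∃ N, IsUnitNormal V q N ∧
      ∃ a : ℝ, a • darboux q + (1 : ℝ) • ((m, 0) : Amb n) ∈ normalLine q N
  · obtain ⟨N, hN, a, ha⟩ := hex
    refine ⟨q, N, hN, ?_⟩
    rw [hL]
    apply Submodule.eq_of_le_of_finrank_eq
    · rw [normalLine, Submodule.span_le]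
      rintro x (rfl | rfl)
      · exact darboux_mem_normalLine q N
      · have h1 := Submodule.sub_mem _ ha
          (Submodule.smul_mem _ a (darboux_mem_normalLine q N))
        rw [add_sub_cancel_left, one_smul] at h1
        exact h1
    · rw [(lineTouchesAt_normalLine hq hm hqm).1,
        (lineTouchesAt_normalLine hq hN.2.2.1 hN.2.2.2.1).1]
  · exfalso
    -- Solving for `a` the condition that the hypersphere `a • darboux q + (m, 0)` passes through
    -- `x` gives `A x`.
    set A : Euc n → ℝ := fun x => inner ℝ m x / (1 - inner ℝ q x) with hA
    set D : Set (Euc n) := {x | (1 : ℝ) - inner ℝ q x ≠ 0} with hD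
    have hin : ∀ w : Euc n, ContDiff ℝ ∞ fun x : Euc n => (inner ℝ w x : ℝ) := fun w =>
      contDiff_const.inner ℝ contDiff_id
    have hB : ContDiff ℝ ∞ fun x : Euc n => (1 : ℝ) - inner ℝ q x := contDiff_const.sub (hin q)
    have hDo : IsOpen D := isOpen_ne.preimage hB.continuous
    have hAs : ContDiffOn ℝ ∞ A D := (hin m).contDiffOn.div hB.contDiffOn fun x hx => hx
    have hfd : ∀ (w p t : Euc n), fderiv ℝ (fun x : Euc n => (inner ℝ w x : ℝ)) p t =
        inner ℝ w t := by
      intro w p t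
      have h2 := fderiv_inner_apply ℝ (f := fun _ : Euc n => w) (g := fun x : Euc n => x) (x := p)
        (differentiableAt_const _) differentiableAt_fun_id t
      rw [h2]; simp
    have hS := hV.dimH_image_critical_eq_zero hDo hAs
    -- Passing through the contact point `p` gives `A p = a`, and tangency there makes `p` critical
    -- for `A` on `V`. So every real number is a critical value.
    have huniv : A '' {p | p ∈ V ∧ p ∈ D ∧ ∀ t ∈ tangentSubspace V p, fderiv ℝ A p t = 0} =
        univ := by
      refine eq_univ_of_forall fun a => ?_
      obtain ⟨p, N, hN, hpN⟩ := hua a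
      have hpq : p ≠ q := by
        rintro rfl
        exact hex ⟨N, hN, a, hpN⟩
      have hpD : p ∈ D := by
        intro h0
        apply hpq
        rw [sub_eq_zero, eq_comm] at h0
        exact ((inner_eq_one_iff_of_norm_eq_one (mem_conformalSpace.1 hq)
          (mem_conformalSpace.1 hN.1)).1 h0).symm
      obtain ⟨α, β, hαβ⟩ := mem_normalLine.1 hpN
      have h1 : a = α := by simpa [darboux] using (congrArg Prod.snd hαβ).symm
      have h2 : α • p + β • N = a • q + m := by simpa [darboux] using congrArg Prod.fst hαβ
      have h3 : ∀ t, inner ℝ p t = 0 → inner ℝ N t = 0 → a * inner ℝ q t + inner ℝ m t = 0 := by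
        intro t h4 h5
        have := congrArg (fun x : Euc n => (inner ℝ x t : ℝ)) h2
        simpa [inner_add_left, real_inner_smul_left, h4, h5] using this.symm
      have h4 : inner ℝ m p = a * (1 - inner ℝ q p) := by
        have := congrArg (fun x : Euc n => (inner ℝ x p : ℝ)) h2
        simp only [inner_add_left, real_inner_smul_left, inner_self_of_mem hN.1,
          real_inner_comm p N, hN.2.2.2.1, ← h1] at this
        linarith
      have hAp : A p = a := by
        simp only [hA]
        rw [h4, mul_div_cancel_right₀ _ hpD]
      refine ⟨p, ⟨hN.2.1, hpD, fun t ht => ?_⟩, hAp⟩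
      obtain ⟨ht1, ht2⟩ := (hN.2.2.2.2 t).1 ht
      -- Differentiating A (1 - ⟨q, ·⟩) = ⟨m, ·⟩ at `p` gives (1 - ⟨q, p⟩) dA t = a⟨q, t⟩ + ⟨m, t⟩,
      -- which vanishes for `t` tangent to `V` by `h3`.
      have h5 : A * (fun x : Euc n => (1 : ℝ) - inner ℝ q x) =ᶠ[𝓝 p]
          fun x : Euc n => (inner ℝ m x : ℝ) := by
        filter_upwards [hDo.mem_nhds hpD] with x hx
        exact div_mul_cancel₀ _ hx
      have h6 := fderiv_mul (contDiffOn_differentiableAt hDo hAs hpD)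
        (hB.differentiable (by simp) p)
      rw [h5.fderiv_eq, fderiv_const_sub, hAp] at h6
      have h7 := congrArg (fun T : Euc n →L[ℝ] ℝ => T t) h6
      simp only [add_apply, smul_apply,
        neg_apply, hfd, smul_eq_mul] at h7
      have h8 := h3 t ht1 ht2
      have h9 : (1 - inner ℝ q p) * fderiv ℝ A p t = 0 := by linarith
      exact (mul_eq_zero.1 h9).resolve_left hpD
    rw [huniv, Real.dimH_univ] at hS
    exact one_ne_zero hS

theorem IsUnitNormal.unique_normalLine {V : Set (Euc n)} {p N N' : Euc n}
    (h : IsUnitNormal V p N) (h' : IsUnitNormal V p N') : normalLine p N = normalLine p N' := by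
  rw [← h.polar_projTangent, h'.polar_projTangent]

/-- The hypersurface is recovered from the generators. -/
theorem IsConformalHypersurface.eq_setOf_touches {V : Set (Euc n)}
    (hV : IsConformalHypersurface V) :
    V = {p | p ∈ conformalSpace n ∧
      ∃ L ∈ generators (tangentHyperspheres V), LineTouchesAt L (darboux p)} := by
  ext p
  constructor
  · intro hp
    obtain ⟨N, hN⟩ := hV.exists_isUnitNormal hp
    exact ⟨hV.1 hp, _, hN.normalLine_mem_generators,
      lineTouchesAt_normalLine hN.1 hN.2.2.1 hN.2.2.2.1⟩
  · rintro ⟨hp, L, hL, ht⟩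
    obtain ⟨q, N, hN, rfl⟩ := hV.mem_generators_iff.1 hL
    rw [ht.eq_of_darboux hp hN.1 (lineTouchesAt_normalLine hN.1 hN.2.2.1 hN.2.2.2.1)]
    exact hN.2.1

/-- Two members of a parabolic pencil meet at one point only. -/
theorem eq_of_tangentPencil_subset {V : Set (Euc n)} {p q N : Euc n} (h : IsUnitNormal V p N)
    (hq : q ∈ conformalSpace n) (hsub : ∀ σ ∈ tangentPencil V p, q ∈ σ) : q = p := by
  have key : ∀ a : ℝ, inner ℝ (a • p + N) q = a := by
    intro a
    have hform : 0 < form n (a • darboux p + (1 : ℝ) • ((N, 0) : Amb n))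
        (a • darboux p + (1 : ℝ) • ((N, 0) : Amb n)) := by
      rw [form_normalLine h.1 h.2.2.1 h.2.2.2.1]; norm_num
    have h1 := hsub _ ⟨⟨_, (mem_deSitter_mk (ne_zero_of_form_pos hform)).2 hform, rfl⟩,
      (h.tangentAt_iff hform).2 (mem_normalLine.2 ⟨a, 1, rfl⟩)⟩
    rw [mem_hypersphere_mk] at h1
    simpa [darboux] using h1.2
  -- The members with `a = 0` and `a = 1` give ⟨N, q⟩ = 0 and ⟨p + N, q⟩ = 1, so ⟨p, q⟩ = 1, which
  -- forces `q = p` for unit vectors.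
  have h0 := key 0
  have h1 := key 1
  rw [inner_add_left, real_inner_smul_left] at h0 h1
  have h2 : inner ℝ q p = (1 : ℝ) := by rw [real_inner_comm]; linarith
  exact (inner_eq_one_iff_of_norm_eq_one (mem_conformalSpace.1 hq) (mem_conformalSpace.1 h.1)).1 h2

/-- Injectivity: a pencil determines its contact point as the only point common to its members, and
the contact point determines the normal line. -/
theorem IsConformalHypersurface.bijOn_pencilOfLine {V : Set (Euc n)}
    (hV : IsConformalHypersurface V) :
    BijOn (fun L : Submodule ℝ (Amb n) => pencilOfLine L) (generators (tangentHyperspheres V))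
      ((fun p => tangentPencil V p) '' V) := by
  refine ⟨?_, ?_, ?_⟩
  · intro L hL
    obtain ⟨p, N, hN, rfl⟩ := hV.mem_generators_iff.1 hL
    exact ⟨p, hN.2.1, hN.pencilOfLine_eq.symm⟩
  · intro L hL L' hL' heq
    obtain ⟨p, N, hN, rfl⟩ := hV.mem_generators_iff.1 hL
    obtain ⟨p', N', hN', rfl⟩ := hV.mem_generators_iff.1 hL'
    have heq' : tangentPencil V p = tangentPencil V p' := by
      rw [← hN.pencilOfLine_eq, ← hN'.pencilOfLine_eq]; exact heq
    have : p' = p := eq_of_tangentPencil_subset hN hN'.1 fun σ hσ => by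
      rw [heq'] at hσ
      exact hσ.2.2.1
    subst this
    exact hN.unique_normalLine hN'
  · rintro _ ⟨p, hp, rfl⟩
    obtain ⟨N, hN⟩ := hV.exists_isUnitNormal hp
    exact ⟨_, hN.normalLine_mem_generators, hN.pencilOfLine_eq⟩

end Generators

/-! ### The tangency points of a regular lightlike hypersurface. -/

section LocalStructure

open Module

variable {n : ℕ}

theorem form_nondegenerate : (form n).Nondegenerate := by
  have h1 : ∀ x, (∀ y, form n x y = 0) → x = 0 := by
    intro x hx
    -- Pairing with the vector whose last coordinate is reversed turns the form into a sum of
    -- squares.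
    have h := hx (x.1, -x.2)
    rw [form_apply, real_inner_self_eq_norm_sq] at h
    have h2 : ‖x.1‖ ^ 2 + x.2 ^ 2 = 0 := by simpa [pow_two] using h
    have h3 : ‖x.1‖ = 0 := by nlinarith [sq_nonneg ‖x.1‖, sq_nonneg x.2]
    have h4 : x.2 = 0 := by nlinarith [sq_nonneg ‖x.1‖, sq_nonneg x.2]
    exact Prod.ext (norm_eq_zero.1 h3) h4
  exact ⟨h1, fun y hy => h1 y fun x => by rw [form_comm]; exact hy x⟩

theorem polar_polar (L : Submodule ℝ (Amb n)) : polar (polar L) = L :=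
  LinearMap.BilinForm.orthogonal_orthogonal form_nondegenerate
    (fun x y h => by rw [form_comm]; exact h) L

theorem span_eq_of_polar_eq {v v' : Amb n}
    (h : polar (Submodule.span ℝ {v}) = polar (Submodule.span ℝ {v'})) :
    Submodule.span ℝ {v} = Submodule.span ℝ {v'} := by
  rw [← polar_polar (Submodule.span ℝ {v}), h, polar_polar]

theorem exists_smul_of_polar_eq {v v' : Amb n} (hv : v ≠ 0)
    (h : polar (Submodule.span ℝ {v}) = polar (Submodule.span ℝ {v'})) :
    ∃ c : ℝ, c ≠ 0 ∧ v = c • v' := by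
  have h1 : v ∈ Submodule.span ℝ {v'} := by
    rw [← span_eq_of_polar_eq h]; exact Submodule.mem_span_singleton_self v
  obtain ⟨c, rfl⟩ := Submodule.mem_span_singleton.1 h1
  exact ⟨c, fun h0 => hv (by simp [h0]), rfl⟩

theorem mem_conformalSpace_of_isAbsolutePoint {q : Euc n} (h : IsAbsolutePoint (darboux q)) :
    q ∈ conformalSpace n := by
  simpa [darboux] using h.exists_darboux.2.1

theorem HyperplaneTouchesAt.mem_conformalSpace {η : Submodule ℝ (Amb n)} {q : Euc n}
    (h : HyperplaneTouchesAt η (darboux q)) : q ∈ conformalSpace n :=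
  mem_conformalSpace_of_isAbsolutePoint h.1

theorem HyperplaneTouchesAt.eq_of_darboux {η : Submodule ℝ (Amb n)} {q q' : Euc n}
    (h : HyperplaneTouchesAt η (darboux q)) (h' : HyperplaneTouchesAt η (darboux q')) :
    q = q' := by
  obtain ⟨c, -, hc⟩ := exists_smul_of_polar_eq (darboux_ne_zero q) (h.2.symm.trans h'.2)
  have h1 : (1 : ℝ) = c := by simpa [darboux] using congrArg Prod.snd hc
  have h2 : q = c • q' := by simpa [darboux] using congrArg Prod.fst hc
  rw [h2, ← h1, one_smul]

theorem HyperplaneTouchesAt.darboux {η : Submodule ℝ (Amb n)} {v : Amb n}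
    (h : HyperplaneTouchesAt η v) : HyperplaneTouchesAt η (darboux (v.2⁻¹ • v.1)) := by
  obtain ⟨h1, h2, h3⟩ := h.1.exists_darboux
  refine ⟨isAbsolutePoint_darboux h2, ?_⟩
  rw [h.2]
  conv_lhs => rw [h3, span_singleton_smul_eq' h1]

theorem smul_mem_cone {H : Set (Proj n)} {u : Amb n} (hu : u ∈ cone H) {c : ℝ} (hc : c ≠ 0) :
    c • u ∈ cone H := by
  obtain ⟨h0, h1⟩ := hu
  refine ⟨smul_ne_zero hc h0, ?_⟩
  rwa [(Projectivization.mk_eq_mk_iff' ℝ (c • u) u (smul_ne_zero hc h0) h0).2 ⟨c, rfl⟩]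

/-- The cone is invariant under nonzero factors, so the curve `t • u` stays in it. This yields the
incidence of a point with its own tangent hyperplane. -/
theorem self_mem_tangentHyperplane {H : Set (Proj n)} {u : Amb n} (hu : u ∈ cone H) :
    u ∈ tangentHyperplane H u := by
  have hd : HasFDerivAt (fun t : ℝ => t • u)
      ((ContinuousLinearMap.id ℝ ℝ).smulRight u) 1 := (hasFDerivAt_id (1 : ℝ)).smul_const u
  have := fderiv_mem_tangentSubspace (A := cone H) hd.differentiableAt
    (by filter_upwards [isOpen_ne.mem_nhds (one_ne_zero (α := ℝ))] with t ht
        using smul_mem_cone hu ht) 1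
  rw [hd.fderiv] at this
  simpa [tangentHyperplane] using this

theorem form_pos_of_mem_cone {H : Set (Proj n)} (hH : H ⊆ deSitter n) {u : Amb n}
    (hu : u ∈ cone H) : 0 < form n u u := by
  obtain ⟨h0, h1⟩ := hu
  exact (mem_deSitter_mk h0).1 (hH h1)

/-- Near a point of a regular lightlike hypersurface, the tangency point of the tangent hyperplane
with the absolute is a smooth function, and its differential has rank at least `n - 1`. -/
theorem IsRegularLightlike.exists_touching_map (hn : 1 ≤ n) {H : Set (Proj n)}
    (hH : IsRegularLightlike H (n - 1)) {w : Amb n} (hw : w ∈ cone H) {N₀ : Set (Amb n)}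
    (hN₀ : N₀ ∈ 𝓝 w) :
    ∃ (D : Set (Amb n)) (g : Amb n → ℝ) (q : Amb n → Euc n), IsOpen D ∧ w ∈ D ∧ D ⊆ N₀ ∧
      ContDiffOn ℝ ∞ g D ∧ ContDiffOn ℝ ∞ q D ∧ cone H ∩ D = {u | u ∈ D ∧ g u = 0} ∧
      fderiv ℝ g w ≠ 0 ∧
      (∀ u ∈ cone H ∩ D, HyperplaneTouchesAt (tangentHyperplane H u) (darboux (q u))) ∧
      n ≤ 1 + finrank ℝ ((tangentHyperplane H w).map (fderiv ℝ q w : Amb n →ₗ[ℝ] Euc n)) := by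
  obtain ⟨-, hsm, htouch, hrank⟩ := hH
  obtain ⟨O₁, g, hO₁, hwO₁, hg, hgH, hgw⟩ := hsm w hw
  obtain ⟨O₂, Y, hO₂, hwO₂, hY, hYH, hYr⟩ := hrank w hw
  -- The pole `Y u` of a hyperplane is unique up to a factor, so it is proportional to the tangency
  -- point and lies on the absolute.
  have hYabs : ∀ u ∈ cone H ∩ O₂, HyperplaneTouchesAt (tangentHyperplane H u) (Y u) := by
    intro u hu
    obtain ⟨h1, h2⟩ := hYH u hu
    obtain ⟨v, hv1, hv2⟩ := htouch u hu.1
    obtain ⟨c, hc, hvc⟩ := exists_smul_of_polar_eq h1 (h2.symm.trans hv2)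
    refine ⟨⟨h1, ?_⟩, h2⟩
    rw [hvc]
    simp [hv1.2]
  have hO₃ : IsOpen (O₂ ∩ (fun u => (Y u).2) ⁻¹' {0}ᶜ) :=
    (continuous_snd.comp_continuousOn hY.continuousOn).isOpen_inter_preimage hO₂
      isOpen_compl_singleton
  have hY2w : (Y w).2 ≠ 0 := (hYabs w ⟨hw, hwO₂⟩).1.exists_darboux.1
  obtain ⟨O₄, hO₄N, hO₄, hwO₄⟩ := mem_nhds_iff.1 hN₀
  set D := (O₁ ∩ (O₂ ∩ (fun u => (Y u).2) ⁻¹' {0}ᶜ)) ∩ O₄ with hD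
  have hDo : IsOpen D := (hO₁.inter hO₃).inter hO₄
  have hwD : w ∈ D := ⟨⟨hwO₁, hwO₂, hY2w⟩, hwO₄⟩
  have hY2 : ContDiffOn ℝ ∞ (fun u => (Y u).2) D :=
    (contDiff_snd.comp_contDiffOn hY).mono fun u hu => hu.1.2.1
  have hqs : ContDiffOn ℝ ∞ (fun u => (Y u).2⁻¹ • (Y u).1) D :=
    (hY2.inv fun u hu => hu.1.2.2).smul
      ((contDiff_fst.comp_contDiffOn hY).mono fun u hu => hu.1.2.1)
  refine ⟨D, g, fun u => (Y u).2⁻¹ • (Y u).1, hDo, hwD, fun u hu => hO₄N hu.2,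
    hg.mono fun u hu => hu.1.1, hqs, ?_, hgw, ?_, ?_⟩
  · ext u
    constructor
    · rintro ⟨hu, huD⟩
      have : u ∈ cone H ∩ O₁ := ⟨hu, huD.1.1⟩
      rw [hgH] at this
      exact ⟨huD, this.2⟩
    · rintro ⟨huD, hu⟩
      have : u ∈ cone H ∩ O₁ := by rw [hgH]; exact ⟨huD.1.1, hu⟩
      exact ⟨this.1, huD⟩
  · exact fun u hu => (hYabs u ⟨hu.1, hu.2.1.2.1⟩).darboux
  · set q : Amb n → Euc n := fun u => (Y u).2⁻¹ • (Y u).1 with hq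
    set T := tangentHyperplane H w with hT
    have hYq : Y =ᶠ[𝓝 w] fun u => (Y u).2 • darboux (q u) := by
      filter_upwards [hDo.mem_nhds hwD] with u hu
      have : (Y u).2 ≠ 0 := hu.1.2.2
      exact Prod.ext (by simp [darboux, hq, smul_smul, this]) (by simp [darboux])
    have hqd := contDiffOn_differentiableAt hDo hqs hwD
    have hd : HasFDerivAt (fun u => darboux (q u))
        ((fderiv ℝ q w).prod (0 : Amb n →L[ℝ] ℝ)) w :=
      hqd.hasFDerivAt.prodMk (hasFDerivAt_const (1 : ℝ) w)
    have hYd := ((contDiffOn_differentiableAt hDo hY2 hwD).hasFDerivAt.smul hd).congr_of_eventuallyEq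
      hYq
    -- Differentiating `Y = Y.2 • darboux q` shows that `dY` adds to the line of `darboux (q w)`
    -- only the image of `dq`. The rank of `q` is therefore at least the rank hypothesis `n` less
    -- one.
    have hle : Submodule.span ℝ {Y w} ⊔ T.map (fderiv ℝ Y w : Amb n →ₗ[ℝ] Amb n) ≤
        Submodule.span ℝ {darboux (q w)} ⊔
          (T.map (fderiv ℝ q w : Amb n →ₗ[ℝ] Euc n)).map (LinearMap.inl ℝ (Euc n) ℝ) := by
      refine sup_le ?_ ?_
      · rw [Submodule.span_singleton_le_iff_mem, hYq.self_of_nhds]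
        exact Submodule.smul_mem _ _ (Submodule.mem_sup_left (Submodule.mem_span_singleton_self _))
      · rintro _ ⟨ξ, hξ, rfl⟩
        have h1 : (fderiv ℝ Y w : Amb n →ₗ[ℝ] Amb n) ξ = (Y w).2 • ((fderiv ℝ q w ξ, 0) : Amb n) +
            fderiv ℝ (fun u => (Y u).2) w ξ • darboux (q w) := by
          rw [hYd.fderiv]
          simp
        rw [h1]
        refine Submodule.add_mem _ (Submodule.smul_mem _ _ (Submodule.mem_sup_right ?_))
          (Submodule.smul_mem _ _ (Submodule.mem_sup_left (Submodule.mem_span_singleton_self _)))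
        exact ⟨_, ⟨ξ, hξ, rfl⟩, rfl⟩
    have h2 := Submodule.finrank_mono hle
    rw [hYr, Nat.sub_add_cancel hn] at h2
    refine h2.trans ((Submodule.finrank_add_le_finrank_add_finrank _ _).trans ?_)
    rw [finrank_span_singleton (darboux_ne_zero _)]
    exact Nat.add_le_add_left (Submodule.finrank_map_le _ _) 1

/-- The differential of the tangency point is orthogonal to the normal line. -/
theorem inner_fderiv_touching_eq_zero {H : Set (Proj n)} {D : Set (Amb n)} {q : Amb n → Euc n}
    (hD : IsOpen D) (hq : ContDiffOn ℝ ∞ q D)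
    (ht : ∀ u ∈ cone H ∩ D, HyperplaneTouchesAt (tangentHyperplane H u) (darboux (q u)))
    {u : Amb n} (hu : u ∈ cone H ∩ D) {ξ : Amb n} (hξ : ξ ∈ tangentHyperplane H u) :
    inner ℝ (q u) (fderiv ℝ q u ξ) = 0 ∧ inner ℝ u.1 (fderiv ℝ q u ξ) = 0 := by
  have hinc : ∀ u' ∈ cone H ∩ D, inner ℝ (q u') u'.1 - u'.2 = (0 : ℝ) := by
    intro u' hu'
    have := self_mem_tangentHyperplane hu'.1
    rwa [(ht u' hu').2, mem_polar_span_singleton, form_darboux] at this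
  have hqd := contDiffOn_differentiableAt hD hq hu.2
  constructor
  · have h1 : fderiv ℝ (fun u' => (inner ℝ (q u') (q u') : ℝ)) u ξ = 0 := by
      refine mem_ker_of_mem_tangentSubspace (A := cone H) (hqd.inner ℝ hqd) ?_ hξ
      filter_upwards [hD.mem_nhds hu.2] with u' hu' huc
      rw [inner_self_of_mem (ht u' ⟨huc, hu'⟩).mem_conformalSpace,
        inner_self_of_mem (ht u hu).mem_conformalSpace]
    rw [fderiv_inner_apply ℝ hqd hqd, real_inner_comm (q u)] at h1
    linarith
  · have hd1 : DifferentiableAt ℝ (fun u' : Amb n => u'.1) u := differentiableAt_fst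
    have hd2 : DifferentiableAt ℝ (fun u' : Amb n => u'.2) u := differentiableAt_snd
    have h1 : fderiv ℝ (fun u' => (inner ℝ (q u') u'.1 : ℝ) - u'.2) u ξ = 0 := by
      refine mem_ker_of_mem_tangentSubspace (A := cone H) ((hqd.inner ℝ hd1).sub hd2) ?_ hξ
      filter_upwards [hD.mem_nhds hu.2] with u' hu' huc
      exact (hinc u' ⟨huc, hu'⟩).trans (hinc u hu).symm
    rw [fderiv_fun_sub (hqd.inner ℝ hd1) hd2, sub_apply,
      fderiv_inner_apply ℝ hqd hd1, fderiv_fst, fderiv_snd] at h1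
    -- The vector `ξ` lies in the polar of the tangency point, which cancels the terms containing
    -- `ξ` itself. Only the derivative of `q` remains.
    rw [(ht u hu).2, mem_polar_span_singleton, form_darboux] at hξ
    rw [real_inner_comm]
    simp only [ContinuousLinearMap.coe_fst', ContinuousLinearMap.coe_snd'] at h1
    linarith

/-- The pair of the coordinates of a vector along `p` and `N`. -/
noncomputable def pairCoord (p N : Euc n) : Euc n →L[ℝ] ℝ × ℝ :=
  (innerSL ℝ p).prod (innerSL ℝ N)

theorem mem_ker_pairCoord {p N x : Euc n} :
    x ∈ (pairCoord p N).ker ↔ inner ℝ p x = 0 ∧ inner ℝ N x = 0 := by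
  simp [pairCoord, LinearMap.mem_ker]

theorem finrank_ker_pairCoord {p N : Euc n} (hp : p ∈ conformalSpace n) (hN : ‖N‖ = 1)
    (hpN : inner ℝ p N = 0) : finrank ℝ (pairCoord p N).ker + 1 = n := by
  have h := LinearMap.finrank_range_add_finrank_ker (pairCoord p N : Euc n →ₗ[ℝ] ℝ × ℝ)
  have hs : (pairCoord p N : Euc n →ₗ[ℝ] ℝ × ℝ).range = ⊤ := by
    refine LinearMap.range_eq_top.2 fun ⟨a, b⟩ => ⟨a • p + b • N, ?_⟩
    simp [pairCoord, real_inner_smul_right, inner_add_right, mem_conformalSpace.1 hp, hN, hpN,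
      real_inner_comm p N]
  rw [hs, finrank_top, finrank_prod, finrank_self, finrank_euclideanSpace, Fintype.card_fin] at h
  have : finrank ℝ (pairCoord p N : Euc n →ₗ[ℝ] ℝ × ℝ).ker + 1 = n := by omega
  exact this

theorem sub_mem_ker_pairCoord {p N : Euc n} (hp : p ∈ conformalSpace n) (hN : ‖N‖ = 1)
    (hpN : inner ℝ p N = 0) (x : Euc n) :
    x - (inner ℝ p x : ℝ) • p - (inner ℝ N x : ℝ) • N ∈ (pairCoord p N).ker := by
  have hNN : inner ℝ N N = (1 : ℝ) := by rw [real_inner_self_eq_norm_sq, hN, one_pow]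
  rw [mem_ker_pairCoord]
  simp only [inner_sub_right, real_inner_smul_right, inner_self_of_mem hp, hpN, hNN,
    real_inner_comm p N]
  constructor <;> ring

/-- The orthogonal projection to the orthogonal complement of an orthonormal pair. -/
theorem exists_pairProj {p N : Euc n} (hp : p ∈ conformalSpace n) (hN : ‖N‖ = 1)
    (hpN : inner ℝ p N = 0) : ∃ P : Euc n →L[ℝ] (pairCoord p N).ker,
      (∀ x, (P x : Euc n) = x - (inner ℝ p x : ℝ) • p - (inner ℝ N x : ℝ) • N) ∧
      ∀ x : (pairCoord p N).ker, P x = x := by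
  set P₀ : Euc n →L[ℝ] Euc n := ContinuousLinearMap.id ℝ _ - (innerSL ℝ p).smulRight p -
    (innerSL ℝ N).smulRight N with hP₀
  have hP₀x : ∀ x, P₀ x = x - (inner ℝ p x : ℝ) • p - (inner ℝ N x : ℝ) • N := by
    intro x; simp [hP₀]
  have hmem : ∀ x, P₀ x ∈ (pairCoord p N).ker := by
    intro x
    rw [hP₀x]
    exact sub_mem_ker_pairCoord hp hN hpN x
  refine ⟨P₀.codRestrict _ hmem, fun x => by simp [hP₀x], fun x => ?_⟩
  obtain ⟨h1, h2⟩ := mem_ker_pairCoord.1 x.2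
  ext1
  simp only [ContinuousLinearMap.coe_codRestrict_apply, hP₀x, h1, h2]
  simp

section PairProj

variable {p N : Euc n} {P : Euc n →L[ℝ] (pairCoord p N).ker}

theorem inner_eq_pairProj
    (hP : ∀ x, (P x : Euc n) = x - (inner ℝ p x : ℝ) • p - (inner ℝ N x : ℝ) • N) (x y : Euc n) :
    (inner ℝ x y : ℝ) = inner ℝ ((P x : Euc n)) y +
      inner ℝ p x * inner ℝ p y + inner ℝ N x * inner ℝ N y := by
  rw [hP, inner_sub_left, inner_sub_left, real_inner_smul_left, real_inner_smul_left]
  ring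

theorem inner_pairProj_self
    (hP : ∀ x, (P x : Euc n) = x - (inner ℝ p x : ℝ) • p - (inner ℝ N x : ℝ) • N) (x : Euc n) :
    (inner ℝ ((P x : Euc n)) x : ℝ) = ‖P x‖ ^ 2 := by
  obtain ⟨h1, h2⟩ := mem_ker_pairCoord.1 (P x).2
  have h := inner_eq_pairProj hP x ((P x : Euc n))
  rw [h1, h2, mul_zero, mul_zero, add_zero, add_zero] at h
  rw [real_inner_comm, h, real_inner_self_eq_norm_sq, Submodule.coe_norm]

theorem eq_of_pairProj_eq
    (hP : ∀ x, (P x : Euc n) = x - (inner ℝ p x : ℝ) • p - (inner ℝ N x : ℝ) • N) {x y : Euc n}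
    (h : P x = P y) (h1 : (inner ℝ p x : ℝ) = inner ℝ p y)
    (h2 : (inner ℝ N x : ℝ) = inner ℝ N y) : x = y := by
  have := congrArg Subtype.val h
  simp only [hP, h1, h2] at this
  simpa using this

/-- A point of the sphere near `p` is determined by its projection and one coordinate. -/
theorem eq_of_pairProj_eq_of_pos
    (hP : ∀ x, (P x : Euc n) = x - (inner ℝ p x : ℝ) • p - (inner ℝ N x : ℝ) • N) {x y : Euc n}
    (hx : x ∈ conformalSpace n) (hy : y ∈ conformalSpace n) (h : P x = P y)
    (h2 : (inner ℝ N x : ℝ) = inner ℝ N y) (hxp : 0 < (inner ℝ p x : ℝ))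
    (hyp : 0 < (inner ℝ p y : ℝ)) : x = y := by
  have h6 := inner_eq_pairProj hP x x
  have h7 := inner_eq_pairProj hP y y
  rw [inner_self_of_mem hx, inner_pairProj_self hP, h2, h] at h6
  rw [inner_self_of_mem hy, inner_pairProj_self hP] at h7
  have h8 : (inner ℝ p x : ℝ) ^ 2 = inner ℝ p y ^ 2 := by linarith
  exact eq_of_pairProj_eq hP h ((pow_left_inj₀ hxp.le hyp.le two_ne_zero).1 h8) h2

/-- A piece of the sphere given as a graph over the complement of the pair `p`, `N` is a
hypersurface of the conformal space. -/
theorem sphereGraph_level (hp : p ∈ conformalSpace n) (hN : ‖N‖ = 1) (hpN : inner ℝ p N = 0)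
    (hP : ∀ x, (P x : Euc n) = x - (inner ℝ p x : ℝ) • p - (inner ℝ N x : ℝ) • N)
    {ε : ℝ} {c : (pairCoord p N).ker → ℝ} (hc : ContDiffOn ℝ ∞ c (Metric.ball 0 ε)) :
    ∃ O : Set (Euc n), O = {x | 0 < (inner ℝ p x : ℝ) ∧ ‖P x‖ < ε} ∧ IsOpen O ∧
      ContDiffOn ℝ ∞ (fun x => inner ℝ N x - c (P x)) O ∧
      (∀ x ∈ O, ∀ t, P t = 0 →
        fderiv ℝ (fun x => inner ℝ N x - c (P x)) x t = inner ℝ N t) ∧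
      ∀ x ∈ O, ∃ v : Euc n, inner ℝ x v = 0 ∧
        fderiv ℝ (fun x => inner ℝ N x - c (P x)) x v = 1 := by
  have hNN : inner ℝ N N = (1 : ℝ) := by rw [real_inner_self_eq_norm_sq, hN, one_pow]
  have hNp : inner ℝ N p = (0 : ℝ) := by rw [real_inner_comm]; exact hpN
  have hball : ∀ x, ‖P x‖ < ε → P x ∈ Metric.ball 0 ε := fun x hx => by simpa using hx
  have hfd : ∀ x ∈ {x | 0 < (inner ℝ p x : ℝ) ∧ ‖P x‖ < ε}, ∀ t, P t = 0 →
        fderiv ℝ (fun x => inner ℝ N x - c (P x)) x t = inner ℝ N t := by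
    intro x hx t ht
    have h1 : HasFDerivAt (fun x => inner ℝ N x - c (P x)) _ x := (innerSL ℝ N).hasFDerivAt.sub
      ((contDiffOn_differentiableAt Metric.isOpen_ball hc
        (hball x hx.2)).hasFDerivAt.comp x P.hasFDerivAt)
    rw [h1.fderiv]
    simp [ht]
  refine ⟨_, rfl, ?_, ?_, hfd, ?_⟩
  · have h1 : IsOpen {x : Euc n | 0 < (inner ℝ p x : ℝ)} :=
      isOpen_lt continuous_const (continuous_const.inner continuous_id)
    have h2 : IsOpen {x : Euc n | ‖P x‖ < ε} :=
      isOpen_lt (continuous_norm.comp P.continuous) continuous_const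
    exact h1.inter h2
  · exact (contDiff_const.inner ℝ contDiff_id).contDiffOn.sub
      (hc.comp P.contDiff.contDiffOn fun x hx => hball x hx.2)
  · intro x hx
    have hxp : (inner ℝ p x : ℝ) ≠ 0 := hx.1.ne'
    -- This vector is tangent to the sphere at `x`, and `P` kills it, so the graph function `c` does
    -- not contribute to the derivative.
    refine ⟨N - (inner ℝ N x / inner ℝ p x : ℝ) • p, ?_, ?_⟩
    · rw [inner_sub_right, real_inner_smul_right, real_inner_comm p x, real_inner_comm N x,
        div_mul_cancel₀ _ hxp, sub_self]
    · rw [hfd x hx]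
      · rw [inner_sub_right, real_inner_smul_right, hNN, hNp]; ring
      · ext1
        rw [hP]
        simp only [inner_sub_right, real_inner_smul_right, hNN, hNp, hpN, inner_self_of_mem hp,
          Submodule.coe_zero]
        module

end PairProj

/-- Two hyperplanes of the tangent space of the sphere, one of which is contained in the other. -/
theorem eq_zero_of_kernels {x ν : Euc n} {l : Euc n → ℝ} {v₀ : Euc n}
    (hx : inner ℝ x x = (1 : ℝ)) (hl : ∀ t (c : ℝ), l (t - c • v₀) = l t - c * l v₀)
    (hv₀ : inner ℝ x v₀ = 0) (hlv : l v₀ = 1)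
    (hsub : ∀ t, inner ℝ x t = 0 → l t = 0 → inner ℝ ν t = 0)
    (hν : ν - (inner ℝ ν x : ℝ) • x ≠ 0) (t : Euc n) (ht : inner ℝ x t = 0)
    (hνt : inner ℝ ν t = 0) : l t = 0 := by
  -- On the tangent space of the sphere, `ν` acts as `l` times the factor `inner ℝ ν v₀`. A zero
  -- factor would make `ν` radial, against `hν`.
  have key : ∀ t, inner ℝ x t = 0 → inner ℝ ν t = l t * inner ℝ ν v₀ := by
    intro t ht
    have h1 := hsub (t - l t • v₀)
      (by rw [inner_sub_right, real_inner_smul_right, ht, hv₀]; ring)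
      (by rw [hl, hlv]; ring)
    rw [inner_sub_right, real_inner_smul_right] at h1
    linarith
  by_contra hne
  have h0 : inner ℝ ν v₀ = 0 := by
    have := key t ht
    rw [hνt] at this
    exact (mul_eq_zero.1 this.symm).resolve_left hne
  apply hν
  have hperp : inner ℝ x (ν - (inner ℝ ν x : ℝ) • x) = 0 := by
    rw [inner_sub_right, real_inner_smul_right, hx, real_inner_comm]; ring
  have h2 := key _ hperp
  rw [h0, mul_zero] at h2
  have h3 : inner ℝ (ν - (inner ℝ ν x : ℝ) • x) (ν - (inner ℝ ν x : ℝ) • x) = (0 : ℝ) := by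
    rw [inner_sub_left, h2, real_inner_smul_left, hperp]; ring
  exact inner_self_eq_zero.1 h3

/-- The tangency map of a lightlike hypersurface near `w`, in the position used to describe its
image as a graph over the complement of the orthonormal pair `p`, `m`. -/
theorem IsRegularLightlike.exists_transversal (hn : 1 ≤ n) {H : Set (Proj n)}
    (hH : IsRegularLightlike H (n - 1)) {w : Amb n} (hw : w ∈ cone H) {N₀ : Set (Amb n)}
    (hN₀ : N₀ ∈ 𝓝 w) :
    ∃ (D : Set (Amb n)) (g : Amb n → ℝ) (q : Amb n → Euc n) (p m : Euc n), IsOpen D ∧ w ∈ D ∧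
      D ⊆ N₀ ∧ ContDiffOn ℝ ∞ g D ∧ ContDiffOn ℝ ∞ q D ∧ cone H ∩ D = {u | u ∈ D ∧ g u = 0} ∧
      Function.Surjective (fderiv ℝ g w) ∧
      (∀ u ∈ cone H ∩ D, HyperplaneTouchesAt (tangentHyperplane H u) (darboux (q u)) ∧
        inner ℝ u.1 (q u) = u.2 ∧ u.1 - u.2 • q u ≠ 0) ∧
      p ∈ conformalSpace n ∧ ‖m‖ = 1 ∧ inner ℝ p m = 0 ∧ q w = p ∧
      (∀ u ∈ D, 0 < (inner ℝ p (q u) : ℝ) ∧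
        inner ℝ p (q u) * inner ℝ m (u.1 - u.2 • q u) -
          inner ℝ m (q u) * inner ℝ p (u.1 - u.2 • q u) ≠ (0 : ℝ)) ∧
      (tangentHyperplane H w).map (fderiv ℝ q w : Amb n →ₗ[ℝ] Euc n) = (pairCoord p m).ker := by
  obtain ⟨D₀, g, q, hD₀, hwD₀, hD₀N, hg, hq, hgH, hgw, ht, hrank⟩ :=
    hH.exists_touching_map hn hw hN₀
  set p := q w with hp
  have hpS : p ∈ conformalSpace n := (ht w ⟨hw, hwD₀⟩).mem_conformalSpace
  have hinc : ∀ u ∈ cone H ∩ D₀, inner ℝ u.1 (q u) = u.2 := by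
    intro u hu
    have := self_mem_tangentHyperplane hu.1
    rwa [(ht u hu).2, mem_polar_span_singleton, form_darboux, sub_eq_zero, real_inner_comm] at this
  -- The vector `ν u` points along the normal at `q u`. On the cone its squared length is (u, u), so
  -- it does not vanish.
  set ν : Amb n → Euc n := fun u => u.1 - u.2 • q u with hν
  have hν0 : ∀ u ∈ cone H ∩ D₀, ν u ≠ 0 := by
    intro u hu h0
    have h1 := form_self_eq u (q u) (ht u hu).mem_conformalSpace (hinc u hu)
    have h2 := form_pos_of_mem_cone hH.1 hu.1
    simp only [hν] at h0
    rw [h1, h0] at h2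
    simp at h2
  have hνn : ‖ν w‖ ≠ 0 := norm_ne_zero_iff.2 (hν0 w ⟨hw, hwD₀⟩)
  have hpν : inner ℝ p (ν w) = 0 := by
    have := hinc w ⟨hw, hwD₀⟩
    rw [← hp] at this
    simp only [hν]
    rw [inner_sub_right, real_inner_smul_right, ← hp, inner_self_of_mem hpS, real_inner_comm, this]
    ring
  obtain ⟨m, hm⟩ : ∃ m, m = ‖ν w‖⁻¹ • ν w := ⟨_, rfl⟩
  have hmn : ‖m‖ = 1 := by rw [hm, norm_smul, norm_inv, norm_norm, inv_mul_cancel₀ hνn]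
  have hpm : inner ℝ p m = 0 := by rw [hm, real_inner_smul_right, hpν, mul_zero]
  have hνc : ContinuousOn ν D₀ :=
    continuous_fst.continuousOn.sub (continuous_snd.continuousOn.smul hq.continuousOn)
  -- The determinant of `q u` and `ν u` in the coordinates along `p` and `m` equals `‖ν w‖` at `w`.
  -- Where it is nonzero, a vector orthogonal to both is determined by its part orthogonal to `p`
  -- and `m`.
  obtain ⟨δ, hδ⟩ : ∃ δ : Amb n → ℝ, δ = fun u => inner ℝ p (q u) * inner ℝ m (ν u) -
    inner ℝ m (q u) * inner ℝ p (ν u) := ⟨_, rfl⟩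
  have hδc : ContinuousOn δ D₀ := by
    have h1 := hq.continuousOn
    rw [hδ]
    exact ((continuousOn_const.inner h1).mul (continuousOn_const.inner hνc)).sub
      ((continuousOn_const.inner h1).mul (continuousOn_const.inner hνc))
  have hpqc : ContinuousOn (fun u => (inner ℝ p (q u) : ℝ)) D₀ :=
    continuousOn_const.inner hq.continuousOn
  obtain ⟨D, hDdef⟩ : ∃ D, D = (D₀ ∩ δ ⁻¹' {0}ᶜ) ∩
    (D₀ ∩ (fun u => (inner ℝ p (q u) : ℝ)) ⁻¹' Ioi 0) := ⟨_, rfl⟩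
  have hDD₀ : D ⊆ D₀ := fun u hu => by rw [hDdef] at hu; exact hu.1.1
  have hD : IsOpen D := by
    rw [hDdef]
    exact (hδc.isOpen_inter_preimage hD₀ isOpen_compl_singleton).inter
      (hpqc.isOpen_inter_preimage hD₀ isOpen_Ioi)
  have hwD : w ∈ D := by
    rw [hDdef]
    refine ⟨⟨hwD₀, ?_⟩, hwD₀, ?_⟩
    · rw [mem_preimage, mem_compl_iff, mem_singleton_iff, hδ]
      simp only [hpν]
      rw [← hp, inner_self_of_mem hpS, hm, real_inner_smul_left, real_inner_self_eq_norm_sq]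
      simp [hνn]
    · rw [mem_preimage, mem_Ioi, ← hp, inner_self_of_mem hpS]
      exact one_pos
  refine ⟨D, g, q, p, m, hD, hwD, hDD₀.trans hD₀N, hg.mono hDD₀, hq.mono hDD₀, ?_, ?_,
    fun u hu => ?_, hpS, hmn, hpm, rfl, fun u hu => ?_, ?_⟩
  · ext u
    constructor
    · rintro ⟨h1, h2⟩
      have : u ∈ cone H ∩ D₀ := ⟨h1, hDD₀ h2⟩
      rw [hgH] at this
      exact ⟨h2, this.2⟩
    · rintro ⟨h1, h2⟩
      have : u ∈ cone H ∩ D₀ := by rw [hgH]; exact ⟨hDD₀ h1, h2⟩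
      exact ⟨this.1, h1⟩
  · obtain ⟨v, hv⟩ := DFunLike.ne_iff.1 hgw
    exact fun c => ⟨(c / fderiv ℝ g w v) • v, by
      rw [map_smul, smul_eq_mul, div_mul_cancel₀ _ hv]⟩
  · have hu' : u ∈ cone H ∩ D₀ := ⟨hu.1, hDD₀ hu.2⟩
    exact ⟨ht u hu', hinc u hu', hν0 u hu'⟩
  · rw [hDdef] at hu
    refine ⟨hu.2.2, ?_⟩
    have : δ u ≠ 0 := hu.1.2
    rw [hδ] at this
    exact this
  -- Orthogonality gives one inclusion. The complement of the pair has dimension `n - 1`, which the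
  -- rank bound on `dq` attains.
  · apply Submodule.eq_of_le_of_finrank_le
    · rintro _ ⟨ξ, hξ, rfl⟩
      obtain ⟨h1, h2⟩ := inner_fderiv_touching_eq_zero hD₀ hq ht ⟨hw, hwD₀⟩ hξ
      rw [mem_ker_pairCoord]
      refine ⟨h1, ?_⟩
      simp only [hm, hν, ContinuousLinearMap.coe_coe]
      rw [real_inner_smul_left, inner_sub_left, real_inner_smul_left, h1, h2]
      ring
    · have := finrank_ker_pairCoord hpS hmn hpm
      omega

/-- The constant rank theorem for a map whose differential on a level set is injective modulo
the kernel of the differential of its projection. -/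
theorem exists_constant_rank {X Y K : Type} [NormedAddCommGroup X] [NormedSpace ℝ X]
    [FiniteDimensional ℝ X] [NormedAddCommGroup Y] [NormedSpace ℝ Y] [NormedAddCommGroup K]
    [NormedSpace ℝ K] [FiniteDimensional ℝ K] {D : Set X} {g : X → ℝ} {q : X → Y} {P : Y →L[ℝ] K}
    (hD : IsOpen D) (hg : ContDiffOn ℝ ∞ g D) (hq : ContDiffOn ℝ ∞ q D) {w : X} (hwD : w ∈ D)
    (hgw : g w = 0) (hPw : P (q w) = 0) (hgs : Function.Surjective (fderiv ℝ g w))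
    (hPs : ∀ k, ∃ ξ, fderiv ℝ g w ξ = 0 ∧ P (fderiv ℝ q w ξ) = k)
    (hzero : ∀ u ∈ D, g u = 0 → Function.Surjective (fderiv ℝ g u) → ∀ ξ, fderiv ℝ g u ξ = 0 →
      P (fderiv ℝ q u ξ) = 0 → fderiv ℝ q u ξ = 0) :
    ∃ (N : Set X) (ε : ℝ) (Q : K → Y), IsOpen N ∧ w ∈ N ∧ N ⊆ D ∧
      ContDiffOn ℝ ∞ Q (Metric.ball 0 ε) ∧
      (∀ u ∈ N, g u = 0 → ‖P (q u)‖ < ε ∧ q u = Q (P (q u))) ∧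
      (∀ k, ‖k‖ < ε → ∃ u ∈ N, g u = 0 ∧ P (q u) = k) ∧
      ∀ u ∈ N, Function.Surjective (fderiv ℝ g u) ∧
        ∀ k, ∃ ξ, fderiv ℝ g u ξ = 0 ∧ P (fderiv ℝ q u ξ) = k := by
  have hqd := fun u (hu : u ∈ D) => contDiffOn_differentiableAt hD hq hu
  -- The pair of the equation `g` and the projection of `q` is a submersion at `w`. In straightening
  -- coordinates the rest of the argument is the constancy of `q` along its fibres.
  obtain ⟨F, hF⟩ : ∃ F : X → ℝ × K, F = fun u => (g u, P (q u)) := ⟨_, rfl⟩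
  have hFs : ContDiffOn ℝ ∞ F D := by
    rw [hF]; exact hg.prodMk (P.contDiff.comp_contDiffOn hq)
  have hFd : ∀ u ∈ D, ∀ ξ, fderiv ℝ F u ξ = (fderiv ℝ g u ξ, P (fderiv ℝ q u ξ)) := by
    intro u hu ξ
    have h1 : HasFDerivAt (fun u => (g u, P (q u))) _ u :=
      (contDiffOn_differentiableAt hD hg hu).hasFDerivAt.prodMk
        (P.hasFDerivAt.comp u (hqd u hu).hasFDerivAt)
    rw [hF, h1.fderiv]
    rfl
  have hFsurj : Function.Surjective (fderiv ℝ F w) := by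
    rintro ⟨a, k⟩
    obtain ⟨ξ₁, hξ₁⟩ := hgs a
    obtain ⟨ξ₂, h3, h4⟩ := hPs (k - P (fderiv ℝ q w ξ₁))
    refine ⟨ξ₁ + ξ₂, ?_⟩
    rw [hFd w hwD, map_add, map_add, map_add, hξ₁, h3, h4]
    simp
  obtain ⟨e, R, hwe, heD, heF, hes⟩ := exists_straightening hD hFs hwD hFsurj
  generalize (fderiv ℝ F w).ker = Z at e R
  have hsurj : ∀ u ∈ e.source, ∀ (a : ℝ) (k : K) (ζ : Z),
      fderiv ℝ g u (fderiv ℝ e.symm (e u) ((a, k), ζ)) = a ∧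
      P (fderiv ℝ q u (fderiv ℝ e.symm (e u) ((a, k), ζ))) = k := by
    intro u hu a k ζ
    have h1 := fderiv_apply_chart_symm hD (hFs.prodMk R.contDiff.contDiffOn) heD heF hes
      (e.map_source hu) ((a, k), ζ)
    rw [e.left_inv hu, DifferentiableAt.fderiv_prodMk (contDiffOn_differentiableAt hD hFs (heD hu))
      R.differentiableAt, ContinuousLinearMap.prod_apply, hFd u (heD hu), Prod.mk.injEq,
      Prod.mk.injEq] at h1
    exact h1.1
  have hgsurj : ∀ u ∈ e.source, Function.Surjective (fderiv ℝ g u) := fun u hu c =>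
    ⟨_, (hsurj u hu c 0 0).1⟩
  obtain ⟨ε, hε, hball⟩ := Metric.isOpen_iff.1 e.open_target _ (e.map_source hwe)
  have hew : e w = ((0, 0), R w) := by rw [heF, hF]; simp only [hgw, hPw]
  have hmemball : ∀ (k : K) (z : Z), ‖k‖ < ε → z ∈ Metric.ball (R w) ε →
      (((0 : ℝ), k), z) ∈ Metric.ball (e w) ε := by
    intro k z hk hz
    rw [hew, Metric.mem_ball, Prod.dist_eq, Prod.dist_eq]
    simp only [dist_self, dist_zero_right]
    exact max_lt (max_lt hε hk) hz
  have hκ : ∀ (k : K) (z : Z), ‖k‖ < ε → z ∈ Metric.ball (R w) ε →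
      e.symm ((0, k), z) ∈ e.source ∧ g (e.symm ((0, k), z)) = 0 ∧
        P (q (e.symm ((0, k), z))) = k := by
    intro k z hk hz
    have h1 := hball (hmemball k z hk hz)
    have h3 := e.right_inv h1
    rw [heF, hF, Prod.mk.injEq, Prod.mk.injEq] at h3
    exact ⟨e.map_target h1, h3.1⟩
  -- A vector along a fibre is killed by `dg` and by `P ∘ dq`, hence by `dq` through `hzero`. On a
  -- ball, which is convex, `q` then depends on `k` alone.
  have hconst : ∀ (k : K) (z : Z), ‖k‖ < ε → z ∈ Metric.ball (R w) ε →
      q (e.symm ((0, k), z)) = q (e.symm ((0, k), R w)) := by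
    intro k z hk hz
    have hd : ∀ z ∈ Metric.ball (R w) ε,
        HasFDerivAt (fun z : Z => q (e.symm ((0, k), z))) (0 : Z →L[ℝ] Y) z := by
      intro z hz
      have h1 := hball (hmemball k z hk hz)
      obtain ⟨h2, h3, -⟩ := hκ k z hk hz
      have h4 : HasFDerivAt (fun z : Z => (((0 : ℝ), k), z))
        (ContinuousLinearMap.inr ℝ (ℝ × K) Z) z :=
        (hasFDerivAt_const _ z).prodMk (hasFDerivAt_id z)
      have h5 := ((hqd _ (heD h2)).hasFDerivAt.comp _
        (contDiffOn_differentiableAt e.open_target hes h1).hasFDerivAt).comp z h4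
      refine h5.congr_fderiv ?_
      ext1 ζ
      obtain ⟨h6, h7⟩ := hsurj _ h2 0 0 ζ
      have h8 := hzero _ (heD h2) h3 (hgsurj _ h2) _ h6 h7
      rw [e.right_inv h1] at h8
      exact h8
    exact (convex_ball (R w) ε).is_const_of_fderivWithin_eq_zero (𝕜 := ℝ)
      (f := fun z : Z => q (e.symm ((0, k), z)))
      (fun z hz => (hd z hz).differentiableAt.differentiableWithinAt)
      (fun z hz => by
        rw [fderivWithin_of_isOpen Metric.isOpen_ball hz]; exact (hd z hz).fderiv)
      hz (Metric.mem_ball_self hε)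
  refine ⟨e.source ∩ e ⁻¹' Metric.ball (e w) ε, ε, fun k => q (e.symm ((0, k), R w)),
    e.continuousOn.isOpen_inter_preimage e.open_source Metric.isOpen_ball,
    ⟨hwe, Metric.mem_ball_self hε⟩, fun u hu => heD hu.1, ?_, ?_, ?_, fun u hu =>
    ⟨hgsurj u hu.1, fun k => ⟨_, hsurj u hu.1 0 k 0⟩⟩⟩
  · have h1 : ContDiffOn ℝ ∞ (fun k : K => e.symm ((0, k), R w)) (Metric.ball 0 ε) :=
      hes.comp ((contDiff_const.prodMk contDiff_id).prodMk contDiff_const).contDiffOn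
        fun k hk => hball (hmemball k _ (by simpa using hk) (Metric.mem_ball_self hε))
    exact hq.comp h1 fun k hk => heD (hκ k _ (by simpa using hk) (Metric.mem_ball_self hε)).1
  · rintro u ⟨hue, hub⟩ hgu
    have h2 : e u = ((0, P (q u)), R u) := by rw [heF, hF]; simp only [hgu]
    have h3 : u = e.symm ((0, P (q u)), R u) := by rw [← h2, e.left_inv hue]
    rw [mem_preimage, h2, hew, Metric.mem_ball, Prod.dist_eq, Prod.dist_eq, max_lt_iff,
      max_lt_iff] at hub
    have h4 : ‖P (q u)‖ < ε := by simpa using hub.1.2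
    refine ⟨h4, ?_⟩
    have h5 := hconst (P (q u)) (R u) h4 hub.2
    rwa [← h3] at h5
  · intro k hk
    obtain ⟨h1, h2⟩ := hκ k (R w) hk (Metric.mem_ball_self hε)
    refine ⟨_, ⟨h1, ?_⟩, h2⟩
    rw [mem_preimage, e.right_inv (hball (hmemball k _ hk (Metric.mem_ball_self hε)))]
    exact hmemball k _ hk (Metric.mem_ball_self hε)

/-- The tangency points of a regular lightlike hypersurface of maximal rank form, locally, a
hypersurface of the conformal space, to which the corresponding hyperspheres are tangent. -/
theorem IsRegularLightlike.exists_local (hn : 1 ≤ n) {H : Set (Proj n)}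
    (hH : IsRegularLightlike H (n - 1)) {w : Amb n} (hw : w ∈ cone H) {N₀ : Set (Amb n)}
    (hN₀ : N₀ ∈ 𝓝 w) :
    ∃ N ∈ 𝓝 w, N ⊆ N₀ ∧ ∃ V : Set (Euc n),
      V = {p | p ∈ conformalSpace n ∧ ∃ u ∈ cone H ∩ N,
        HyperplaneTouchesAt (tangentHyperplane H u) (darboux p)} ∧
      IsConformalHypersurface V ∧
      ∀ u ∈ cone H ∩ N, ∀ q, HyperplaneTouchesAt (tangentHyperplane H u) (darboux q) →
        ∀ hu : u ≠ 0, TangentAt V (hypersphere (Projectivization.mk ℝ u hu)) q := by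
  obtain ⟨D, g, q, p, m, hD, hwD, hDN, hg, hq, hgH, hgs, hdata, hpS, hmn, hpm, hqw, htrans,
    himage⟩ := hH.exists_transversal hn hw hN₀
  obtain ⟨P, hP, hPK⟩ := exists_pairProj hpS hmn hpm
  have hcone : ∀ u ∈ D, (u ∈ cone H ↔ g u = 0) := by
    intro u hu
    have : u ∈ cone H ∩ D ↔ u ∈ D ∧ g u = 0 := by rw [hgH]; rfl
    simpa [hu] using this
  have hTker : ∀ u ∈ cone H ∩ D, Function.Surjective (fderiv ℝ g u) →
      ∀ ξ, ξ ∈ tangentHyperplane H u ↔ fderiv ℝ g u ξ = 0 := by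
    intro u hu hs ξ
    rw [tangentHyperplane, tangentSubspace_eq_ker hD hg hgH hu hs]
    rfl
  have hperp : ∀ u ∈ cone H ∩ D, ∀ ξ ∈ tangentHyperplane H u,
      inner ℝ (q u) (fderiv ℝ q u ξ) = 0 ∧ inner ℝ u.1 (fderiv ℝ q u ξ) = 0 :=
    fun u hu ξ hξ => inner_fderiv_touching_eq_zero hD hq (fun u hu => (hdata u hu).1) hu hξ
  have hPw : P (q w) = 0 := by
    ext1
    rw [hP, hqw, inner_self_of_mem hpS, real_inner_comm, hpm]
    simp
  have hPs : ∀ k, ∃ ξ, fderiv ℝ g w ξ = 0 ∧ P (fderiv ℝ q w ξ) = k := by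
    intro k
    have hk : (k : Euc n) ∈ (tangentHyperplane H w).map (fderiv ℝ q w : Amb n →ₗ[ℝ] Euc n) := by
      rw [himage]; exact k.2
    obtain ⟨ξ, hξ, hk2⟩ := hk
    have hk3 : fderiv ℝ q w ξ = k := hk2
    exact ⟨ξ, (hTker w ⟨hw, hwD⟩ hgs ξ).1 hξ, by rw [hk3, hPK]⟩
  have hzero : ∀ u ∈ D, g u = 0 → Function.Surjective (fderiv ℝ g u) → ∀ ξ, fderiv ℝ g u ξ = 0 →
      P (fderiv ℝ q u ξ) = 0 → fderiv ℝ q u ξ = 0 := by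
    intro u hu hgu hs ξ hξ h1
    have huc : u ∈ cone H ∩ D := ⟨(hcone u hu).2 hgu, hu⟩
    obtain ⟨h2, h3⟩ := hperp u huc ξ ((hTker u huc hs ξ).2 hξ)
    generalize fderiv ℝ q u ξ = x at h1 h2 h3
    have h4 : inner ℝ (u.1 - u.2 • q u) x = (0 : ℝ) := by
      rw [inner_sub_left, real_inner_smul_left, h2, h3]; ring
    rw [real_inner_comm, inner_eq_pairProj hP, h1, Submodule.coe_zero, inner_zero_left,
      zero_add] at h2 h4
    have hδ := (htrans u hu).2
    -- The coordinates of `x` along `p` and `m` solve a homogeneous linear system with determinant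
    -- `hδ`. The combinations below are Cramer's rule.
    refine eq_of_pairProj_eq hP (y := 0) (by rw [h1, map_zero]) ?_ ?_
    · rw [inner_zero_right]
      refine (mul_eq_zero.1 ?_).resolve_right hδ
      linear_combination inner ℝ m (u.1 - u.2 • q u) * h2 - inner ℝ m (q u) * h4
    · rw [inner_zero_right]
      refine (mul_eq_zero.1 ?_).resolve_right hδ
      linear_combination inner ℝ p (q u) * h4 - inner ℝ p (u.1 - u.2 • q u) * h2
  obtain ⟨N, ε, Q, hN, hwN, hND, hQ, hcoord, hex, hsurj⟩ :=
    exists_constant_rank hD hg hq hwD ((hcone w hwD).1 hw) hPw hgs hPs hzero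
  obtain ⟨V, hV⟩ : ∃ V : Set (Euc n), V = {p | p ∈ conformalSpace n ∧ ∃ u ∈ cone H ∩ N,
        HyperplaneTouchesAt (tangentHyperplane H u) (darboux p)} := ⟨_, rfl⟩
  have hVq : ∀ x, x ∈ V ↔ ∃ u ∈ cone H ∩ N, x = q u := by
    intro x
    rw [hV]
    constructor
    · rintro ⟨hx, u, hu, hut⟩
      exact ⟨u, hu, hut.eq_of_darboux (hdata u ⟨hu.1, hND hu.2⟩).1⟩
    · rintro ⟨u, hu, rfl⟩
      have := (hdata u ⟨hu.1, hND hu.2⟩).1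
      exact ⟨this.mem_conformalSpace, u, hu, this⟩
  have hVS : V ⊆ conformalSpace n := by rw [hV]; exact fun x hx => hx.1
  -- The image of `q` is a graph over the complement of `p` and `m`: `c` is its coordinate along
  -- `m`, and the sphere supplies the one along `p`.
  obtain ⟨c, hc⟩ : ∃ c : (pairCoord p m).ker → ℝ, c = fun k => inner ℝ m (Q k) := ⟨_, rfl⟩
  have hcs : ContDiffOn ℝ ∞ c (Metric.ball 0 ε) := by rw [hc]; exact contDiffOn_const.inner ℝ hQ
  obtain ⟨O, hO, hOo, hfs, hfd, hv₀⟩ := sphereGraph_level hpS hmn hpm hP hcs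
  obtain ⟨f, hf⟩ : ∃ f : Euc n → ℝ, f = fun x => inner ℝ m x - c (P x) := ⟨_, rfl⟩
  rw [← hf] at hfs
  simp only [← hf] at hfd hv₀
  have hfq : ∀ u ∈ cone H ∩ N, f (q u) = 0 := by
    intro u hu
    rw [hf, hc]
    simp only
    rw [← (hcoord u hu.2 ((hcone u (hND hu.2)).1 hu.1)).2, sub_self]
  have hVO : V ⊆ O := by
    intro x hx
    obtain ⟨u, hu, rfl⟩ := (hVq x).1 hx
    rw [hO]
    exact ⟨(htrans u (hND hu.2)).1, (hcoord u hu.2 ((hcone u (hND hu.2)).1 hu.1)).1⟩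
  have hVeq : V ∩ O = {x | x ∈ conformalSpace n ∧ x ∈ O ∧ f x = 0} := by
    ext x
    constructor
    · rintro ⟨hx, hxO⟩
      refine ⟨hVS hx, hxO, ?_⟩
      obtain ⟨u, hu, rfl⟩ := (hVq x).1 hx
      exact hfq u hu
    · rintro ⟨hxS, hxO, hfx⟩
      refine ⟨(hVq x).2 ?_, hxO⟩
      rw [hO] at hxO
      -- The point `q u` above the same projection has the same `m`-coordinate as `x`. Both lie on
      -- the sphere with positive `p`-coordinate, so they coincide.
      obtain ⟨u, huN, hgu, hPu⟩ := hex (P x) hxO.2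
      have hu : u ∈ cone H ∩ N := ⟨(hcone u (hND huN)).2 hgu, huN⟩
      refine ⟨u, hu, ?_⟩
      have h1 := hfq u hu
      rw [hf] at h1 hfx
      simp only [hPu] at h1 hfx
      exact eq_of_pairProj_eq_of_pos hP hxS (hdata u ⟨hu.1, hND huN⟩).1.mem_conformalSpace
        hPu.symm (by linarith) hxO.1 (htrans u (hND huN)).1
  have hv₀' : ∀ x ∈ O, ∃ v : Euc n, inner ℝ x v = 0 ∧ fderiv ℝ f x v ≠ 0 := fun x hx =>
    (hv₀ x hx).imp fun v hv => ⟨hv.1, by rw [hv.2]; exact one_ne_zero⟩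
  refine ⟨N, hN.mem_nhds hwN, hND.trans hDN, V, hV,
    ⟨hVS, fun x hx => ⟨O, f, hOo, hVO hx, hfs, hVeq, hv₀' x (hVO hx)⟩⟩, ?_⟩
  intro u hu x hux hu0
  have huD : u ∈ cone H ∩ D := ⟨hu.1, hND hu.2⟩
  obtain ⟨ht, hinc, hν⟩ := hdata u huD
  obtain rfl : x = q u := hux.eq_of_darboux ht
  have hxV : q u ∈ V := (hVq _).2 ⟨u, hu, rfl⟩
  have hxS := hVS hxV
  have hxσ : q u ∈ hypersphere (Projectivization.mk ℝ u hu0) :=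
    (mem_hypersphere_mk hu0).2 ⟨hxS, hinc⟩
  refine ⟨hxV, hxσ, ?_⟩
  have hfdx := contDiffOn_differentiableAt hOo hfs (hVO hxV)
  have hqd := contDiffOn_differentiableAt hD hq huD.2
  -- A vector tangent to `V` at `q u` is the image under `dq` of some `ξ` tangent to `H`, and such
  -- images are orthogonal to `u.1`.
  have hsub : ∀ t, inner ℝ (q u) t = 0 → fderiv ℝ f (q u) t = 0 → inner ℝ u.1 t = 0 := by
    intro t ht1 ht2
    obtain ⟨hs, hk⟩ := hsurj u hu.2
    obtain ⟨ξ, h1, h4⟩ := hk (P t)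
    have hξ := (hTker u huD hs ξ).2 h1
    obtain ⟨h2, h3⟩ := hperp u huD _ hξ
    have h5 : fderiv ℝ f (q u) (fderiv ℝ q u ξ) = 0 := by
      have h6 : fderiv ℝ (f ∘ q) u ξ = 0 := by
        refine mem_ker_of_mem_tangentSubspace (A := cone H) (hfdx.comp u hqd) ?_ hξ
        filter_upwards [hN.mem_nhds hu.2] with u' hu' huc
        exact (hfq u' ⟨huc, hu'⟩).trans (hfq u hu).symm
      rw [fderiv_comp u hfdx hqd] at h6
      exact h6
    have h6 : P (t - fderiv ℝ q u ξ) = 0 := by rw [map_sub, h4, sub_self]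
    have h7 : inner ℝ m (t - fderiv ℝ q u ξ) = (0 : ℝ) := by
      rw [← hfd _ (hVO hxV) _ h6, map_sub, ht2, h5, sub_self]
    have h8 : inner ℝ (q u) (t - fderiv ℝ q u ξ) = (0 : ℝ) := by
      rw [inner_sub_right, ht1, h2, sub_self]
    have h9 : inner ℝ p (t - fderiv ℝ q u ξ) = (0 : ℝ) := by
      have h10 := inner_eq_pairProj hP (t - fderiv ℝ q u ξ) (q u)
      rw [real_inner_comm, h8, h6, h7, Submodule.coe_zero, inner_zero_left] at h10
      have h12 : inner ℝ p (t - fderiv ℝ q u ξ) * inner ℝ p (q u) = (0 : ℝ) := by linarith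
      exact (mul_eq_zero.1 h12).resolve_right (htrans u huD.2).1.ne'
    have h10 : t - fderiv ℝ q u ξ = 0 := eq_of_pairProj_eq hP (by rw [h6, map_zero])
      (by rw [h9, inner_zero_right]) (by rw [h7, inner_zero_right])
    rw [sub_eq_zero.1 h10]
    exact h3
  ext t
  rw [mem_tangentSubspace_level hOo (hVO hxV) hfs hxV hVeq (hv₀' _ (hVO hxV)),
    mem_tangentSubspace_hypersphere (form_pos_of_mem_cone hH.1 hu.1) hxσ]
  refine ⟨fun h => ⟨h.1, hsub t h.1 h.2⟩, fun h => ⟨h.1, ?_⟩⟩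
  -- Both tangent spaces are hyperplanes in the tangent space of the sphere, so the inclusion `hsub`
  -- is an equality.
  obtain ⟨v₀, hv1, hv2⟩ := hv₀ _ (hVO hxV)
  refine eq_zero_of_kernels (inner_self_of_mem hxS) (fun t c => by
    rw [map_sub, map_smul, smul_eq_mul]) hv1 hv2 hsub ?_ t h.1 h.2
  rw [hinc]
  exact hν

end LocalStructure

/-! ### Homogeneous data on a conformal hypersurface and its normal map. -/

section Construction

open Module

variable {n : ℕ}

theorem hasFDerivAt_norm_euc {x : Euc n} (hx : x ≠ 0) :
    HasFDerivAt (fun y : Euc n => ‖y‖) (‖x‖⁻¹ • innerSL ℝ x) x := by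
  have h1 : DifferentiableAt ℝ (fun y : Euc n => ‖y‖) x := differentiableAt_id.norm ℝ hx
  have h2 : HasFDerivAt (fun y : Euc n => ‖y‖ ^ 2) _ x := h1.hasFDerivAt.pow 2
  have h3 := (hasStrictFDerivAt_norm_sq x).hasFDerivAt
  have h4 := h2.unique h3
  have h5 : fderiv ℝ (fun y : Euc n => ‖y‖) x = ‖x‖⁻¹ • innerSL ℝ x := by
    ext v
    have h6 := congrArg (fun T : Euc n →L[ℝ] ℝ => T v) h4
    have hn : ‖x‖ ≠ 0 := norm_ne_zero_iff.2 hx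
    simp at h6
    simp
    field_simp
    linarith
  rw [← h5]
  exact h1.hasFDerivAt

/-- A defining function of a hypersurface of the conformal space that is homogeneous of degree
zero, with a normal field homogeneous of degree one. -/
structure IsConeData (V O : Set (Euc n)) (f : Euc n → ℝ) (M : Euc n → Euc n) : Prop where
  isOpen : IsOpen O
  ne_zero : ∀ x ∈ O, x ≠ 0
  smooth : ContDiffOn ℝ ∞ f O
  smooth_normal : ContDiffOn ℝ ∞ M O
  smul_mem : ∀ x ∈ O, ∀ c : ℝ, 0 < c → c • x ∈ O
  apply_smul : ∀ x ∈ O, ∀ c : ℝ, 0 < c → f (c • x) = f x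
  normal_smul : ∀ x ∈ O, ∀ c : ℝ, 0 < c → M (c • x) = c • M x
  normal_ne_zero : ∀ x ∈ O, M x ≠ 0
  inner_normal : ∀ x ∈ O, inner ℝ x (M x) = (0 : ℝ)
  inner_normal_eq : ∀ x ∈ O, ∀ t, inner ℝ (M x) t = ‖x‖ ^ 2 * fderiv ℝ f x t
  level : V ∩ O = {q | q ∈ conformalSpace n ∧ q ∈ O ∧ f q = 0}

/-- Composition with the radial projection makes `f` homogeneous of degree zero. Its gradient has
degree minus one and is orthogonal to `x` by Euler's relation, so the factor `‖x‖ ^ 2` yields a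
normal field of degree one. -/
theorem IsConformalHypersurface.exists_isConeData {V : Set (Euc n)}
    (hV : IsConformalHypersurface V) {p : Euc n} (hp : p ∈ V) :
    ∃ O f M, IsConeData V O f M ∧ p ∈ O := by
  obtain ⟨O, f, hO, hpO, hf, hVO, v, hv1, hv2⟩ := hV.2 p hp
  have hpS := hV.1 hp
  have hp1 := mem_conformalSpace.1 hpS
  obtain ⟨pr, hpr⟩ : ∃ pr : Euc n → Euc n, pr = fun x => ‖x‖⁻¹ • x := ⟨_, rfl⟩
  have hprs : ContDiffOn ℝ ∞ pr {0}ᶜ := by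
    rw [hpr]
    have h0 : ∀ x ∈ ({0}ᶜ : Set (Euc n)), x ≠ 0 := fun x hx => hx
    have h1 : ContDiffOn ℝ ∞ (fun x : Euc n => ‖x‖) {0}ᶜ := contDiffOn_id.norm ℝ h0
    exact (h1.inv fun x hx => norm_ne_zero_iff.2 (h0 x hx)).smul contDiffOn_id
  have hpr1 : ∀ x : Euc n, ‖x‖ = 1 → pr x = x := by
    intro x hx; rw [hpr]; simp [hx]
  have hprc : ∀ (x : Euc n) (c : ℝ), 0 < c → pr (c • x) = pr x := by
    intro x c hc
    rw [hpr]
    simp only [norm_smul, Real.norm_of_nonneg hc.le, smul_smul]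
    congr 1
    field_simp
  have hO₁ : IsOpen ({0}ᶜ ∩ pr ⁻¹' O) :=
    hprs.continuousOn.isOpen_inter_preimage isOpen_compl_singleton hO
  set O₁ : Set (Euc n) := {0}ᶜ ∩ pr ⁻¹' O with hO₁def
  have hF : ContDiffOn ℝ ∞ (f ∘ pr) O₁ :=
    hf.comp (hprs.mono inter_subset_left) fun x hx => hx.2
  obtain ⟨F, hFdef⟩ : ∃ F, F = f ∘ pr := ⟨_, rfl⟩
  rw [← hFdef] at hF
  have hFc : ∀ (x : Euc n) (c : ℝ), 0 < c → F (c • x) = F x := by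
    intro x c hc; rw [hFdef, Function.comp, Function.comp, hprc x c hc]
  have hO₁c : ∀ x ∈ O₁, ∀ c : ℝ, 0 < c → c • x ∈ O₁ := by
    intro x hx c hc
    refine ⟨smul_ne_zero hc.ne' hx.1, ?_⟩
    rw [mem_preimage, hprc x c hc]
    exact hx.2
  have hFd := fun x (hx : x ∈ O₁) => contDiffOn_differentiableAt hO₁ hF hx
  have hd0 : ∀ x ∈ O₁, fderiv ℝ F x x = 0 := by
    intro x hx
    have h1 : HasFDerivAt (fun t : ℝ => t • x)
      ((ContinuousLinearMap.id ℝ ℝ).smulRight x) 1 := (hasFDerivAt_id (1 : ℝ)).smul_const x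
    have h2 : HasFDerivAt F (fderiv ℝ F x) ((1 : ℝ) • x) := by
      rw [one_smul]; exact (hFd x hx).hasFDerivAt
    have h3 : F ∘ (fun t : ℝ => t • x) =ᶠ[𝓝 1] fun _ => F x := by
      filter_upwards [isOpen_Ioi.mem_nhds (mem_Ioi.2 (one_pos : (0 : ℝ) < 1))] with t ht
      exact hFc x t ht
    have h4 := (h2.comp 1 h1).congr_of_eventuallyEq h3.symm
    have h5 := h4.unique (hasFDerivAt_const (F x) (1 : ℝ))
    have h6 := congrArg (fun T : ℝ →L[ℝ] ℝ => T 1) h5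
    simpa using h6
  have hdc : ∀ x ∈ O₁, ∀ c : ℝ, 0 < c → c • fderiv ℝ F (c • x) = fderiv ℝ F x := by
    intro x hx c hc
    have h1 : HasFDerivAt (fun y : Euc n => c • y) (c • ContinuousLinearMap.id ℝ (Euc n)) x :=
      (hasFDerivAt_id x).const_smul c
    have h2 := ((hFd _ (hO₁c x hx c hc)).hasFDerivAt.comp x h1)
    have h3 : F ∘ (fun y : Euc n => c • y) = F := funext fun y => hFc y c hc
    rw [h3] at h2
    rw [h2.fderiv]
    ext t
    simp
  obtain ⟨G, hG⟩ : ∃ G : Euc n → Euc n,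
    G = fun x => (InnerProductSpace.toDual ℝ (Euc n)).symm (fderiv ℝ F x) := ⟨_, rfl⟩
  have hGi : ∀ x t, inner ℝ (G x) t = fderiv ℝ F x t := by
    intro x t; rw [hG]; exact InnerProductSpace.toDual_symm_apply
  have hGs : ContDiffOn ℝ ∞ G O₁ := by
    rw [hG]
    exact (InnerProductSpace.toDual ℝ (Euc n)).symm.contDiff.comp_contDiffOn
      (hF.fderiv_of_isOpen hO₁ (by simp))
  have hGc : ∀ x ∈ O₁, ∀ c : ℝ, 0 < c → c • G (c • x) = G x := by
    intro x hx c hc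
    refine ext_inner_right ℝ fun t => ?_
    rw [real_inner_smul_left, hGi, hGi, ← hdc x hx c hc]
    rfl
  have hO₂ : IsOpen (O₁ ∩ G ⁻¹' {0}ᶜ) :=
    hGs.continuousOn.isOpen_inter_preimage hO₁ isOpen_compl_singleton
  have hp0 : p ≠ 0 := by rintro rfl; simp at hp1
  have hpO₁ : p ∈ O₁ := ⟨hp0, by rw [mem_preimage, hpr1 p hp1]; exact hpO⟩
  -- The radial projection has identity differential on vectors tangent to the sphere, so the
  -- differential of `F` is still nonzero on `v`.
  have hdF : fderiv ℝ F p v = fderiv ℝ f p v := by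
    have h1 : DifferentiableAt ℝ pr p :=
      contDiffOn_differentiableAt isOpen_compl_singleton hprs hp0
    have h2 : (fun x : Euc n => ‖x‖ • pr x) =ᶠ[𝓝 p] id := by
      filter_upwards [isOpen_compl_singleton.mem_nhds hp0] with x hx
      have : ‖x‖ ≠ 0 := norm_ne_zero_iff.2 hx
      rw [hpr]; simp [smul_smul, this]
    have h3 := ((hasFDerivAt_norm_euc hp0).smul h1.hasFDerivAt).congr_of_eventuallyEq h2.symm
    have h4 := congrArg (fun T : Euc n →L[ℝ] Euc n => T v) (h3.unique (hasFDerivAt_id p))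
    have h5 : fderiv ℝ pr p v = v := by simpa [hp1, hv1] using h4
    rw [hFdef, fderiv_comp p (by rw [hpr1 p hp1]; exact contDiffOn_differentiableAt hO hf hpO) h1,
      ContinuousLinearMap.comp_apply, h5, hpr1 p hp1]
  refine ⟨O₁ ∩ G ⁻¹' {0}ᶜ, F, fun x => ‖x‖ ^ 2 • G x, ?_, hpO₁, ?_⟩
  · constructor
    · exact hO₂
    · exact fun x hx => hx.1.1
    · exact hF.mono inter_subset_left
    · exact (contDiff_norm_sq ℝ).contDiffOn.smul (hGs.mono inter_subset_left)
    · intro x hx c hc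
      refine ⟨hO₁c x hx.1 c hc, fun h => hx.2 ?_⟩
      rw [mem_singleton_iff] at h ⊢
      rw [← hGc x hx.1 c hc, h, smul_zero]
    · exact fun x hx c hc => hFc x c hc
    · intro x hx c hc
      rw [← hGc x hx.1 c hc, norm_smul, mul_pow, Real.norm_of_nonneg hc.le, smul_smul, smul_smul]
      congr 1
      ring
    · intro x hx
      exact smul_ne_zero (pow_ne_zero 2 (norm_ne_zero_iff.2 hx.1.1)) hx.2
    · intro x hx
      rw [real_inner_smul_right, real_inner_comm, hGi, hd0 x hx.1, mul_zero]
    · intro x hx t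
      rw [real_inner_smul_left, hGi]
    · ext q
      have h1 : q ∈ conformalSpace n → F q = f q := by
        intro hq; rw [hFdef, Function.comp, hpr1 q (mem_conformalSpace.1 hq)]
      have h2 : q ∈ O₁ → q ∈ conformalSpace n → q ∈ O := by
        intro hq hqS
        have := hq.2
        rwa [mem_preimage, hpr1 q (mem_conformalSpace.1 hqS)] at this
      constructor
      · rintro ⟨hqV, hq⟩
        have hqS := hV.1 hqV
        have h3 : q ∈ V ∩ O := ⟨hqV, h2 hq.1 hqS⟩
        rw [hVO] at h3
        exact ⟨hqS, hq, (h1 hqS).trans h3.2.2⟩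
      · rintro ⟨hqS, hq, hFq⟩
        have h3 : q ∈ V ∩ O := by
          rw [hVO]; exact ⟨hqS, h2 hq.1 hqS, (h1 hqS).symm.trans hFq⟩
        exact ⟨h3.1, hq⟩
  · intro h
    apply hv2
    rw [mem_singleton_iff] at h
    rw [← hdF, ← hGi, h, inner_zero_left]

section ConeData

variable {V O : Set (Euc n)} {f : Euc n → ℝ} {M : Euc n → Euc n}

/-- Euler's relation for degree one. -/
theorem IsConeData.fderiv_normal_self (h : IsConeData V O f M) {x : Euc n} (hx : x ∈ O) :
    fderiv ℝ M x x = M x := by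
  have h1 : HasFDerivAt (fun t : ℝ => t • x)
    ((ContinuousLinearMap.id ℝ ℝ).smulRight x) 1 := (hasFDerivAt_id (1 : ℝ)).smul_const x
  have h2 : HasFDerivAt M (fderiv ℝ M x) ((1 : ℝ) • x) := by
    rw [one_smul]; exact (contDiffOn_differentiableAt h.isOpen h.smooth_normal hx).hasFDerivAt
  have h3 : M ∘ (fun t : ℝ => t • x) =ᶠ[𝓝 1] fun t => t • M x := by
    filter_upwards [isOpen_Ioi.mem_nhds (mem_Ioi.2 (one_pos : (0 : ℝ) < 1))] with t ht
    exact h.normal_smul x hx t ht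
  have h4 := (h2.comp 1 h1).congr_of_eventuallyEq h3.symm
  have h5 := h4.unique ((hasFDerivAt_id (1 : ℝ)).smul_const (M x))
  have h6 := congrArg (fun T : ℝ →L[ℝ] Euc n => T 1) h5
  simpa using h6

theorem IsConeData.inner_fderiv_normal (h : IsConeData V O f M) {x : Euc n} (hx : x ∈ O)
    (v : Euc n) : inner ℝ x (fderiv ℝ M x v) = -(inner ℝ (M x) v : ℝ) := by
  have hM := contDiffOn_differentiableAt h.isOpen h.smooth_normal hx
  have h1 : (fun y => (inner ℝ y (M y) : ℝ)) =ᶠ[𝓝 x] fun _ => 0 := by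
    filter_upwards [h.isOpen.mem_nhds hx] with y hy using h.inner_normal y hy
  have h2 := fderiv_inner_apply ℝ (f := fun y : Euc n => y) differentiableAt_fun_id hM v
  rw [h1.fderiv_eq] at h2
  simp only [fderiv_fun_const, Pi.zero_apply, zero_apply, fderiv_fun_id, ContinuousLinearMap.coe_id',
    id] at h2
  rw [real_inner_comm v (M x)]
  linarith

theorem IsConeData.isUnitNormal (h : IsConeData V O f M) {q : Euc n} (hqV : q ∈ V) (hqO : q ∈ O) :
    IsUnitNormal V q (‖M q‖⁻¹ • M q) := by
  have hq : q ∈ V ∩ O := ⟨hqV, hqO⟩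
  have hqS : q ∈ conformalSpace n := by rw [h.level] at hq; exact hq.1
  have hn : ‖M q‖ ≠ 0 := norm_ne_zero_iff.2 (h.normal_ne_zero q hqO)
  have hi := h.inner_normal_eq q hqO
  simp only [mem_conformalSpace.1 hqS, one_pow, one_mul] at hi
  refine ⟨hqS, hqV, ?_, ?_, fun t => ?_⟩
  · rw [norm_smul, norm_inv, norm_norm, inv_mul_cancel₀ hn]
  · rw [real_inner_smul_right, h.inner_normal q hqO, mul_zero]
  · rw [mem_tangentSubspace_level h.isOpen hqO h.smooth hqV h.level, real_inner_smul_left, hi]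
    · simp [hn]
    · refine ⟨M q, h.inner_normal q hqO, ?_⟩
      rw [← hi, real_inner_self_eq_norm_sq]
      exact pow_ne_zero 2 hn

/-- The points of the normal lines of `V`, in homogeneous coordinates. -/
noncomputable def normalMap (M : Euc n → Euc n) (z : Amb n) : Amb n :=
  (z.2 • z.1 + M z.1, z.2 * ‖z.1‖)

theorem IsConeData.normalMap_smul (h : IsConeData V O f M) {z : Amb n} (hz : z.1 ∈ O) {c : ℝ}
    (hc : 0 < c) : normalMap M (c • z.1, z.2) = c • normalMap M z := by
  simp only [normalMap, h.normal_smul z.1 hz c hc, norm_smul, Real.norm_of_nonneg hc.le]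
  refine Prod.ext ?_ ?_
  · simp only [Prod.smul_fst, smul_add, smul_smul, mul_comm]
  · simp only [Prod.smul_snd, smul_eq_mul]; ring

theorem IsConeData.contDiffOn_normalMap (h : IsConeData V O f M) :
    ContDiffOn ℝ ∞ (normalMap M) (O ×ˢ univ) := by
  refine ContDiffOn.prodMk ?_ ?_
  · exact (contDiff_snd.contDiffOn.smul contDiff_fst.contDiffOn).add
      (h.smooth_normal.comp contDiff_fst.contDiffOn fun z hz => hz.1)
  · exact contDiff_snd.contDiffOn.mul
      (contDiff_fst.contDiffOn.norm ℝ fun z hz => h.ne_zero _ hz.1)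

theorem IsConeData.fderiv_normalMap (h : IsConeData V O f M) {z : Amb n} (hz : z.1 ∈ O)
    (ζ : Amb n) : fderiv ℝ (normalMap M) z ζ =
      (z.2 • ζ.1 + ζ.2 • z.1 + fderiv ℝ M z.1 ζ.1,
        z.2 * (‖z.1‖⁻¹ * inner ℝ z.1 ζ.1) + ζ.2 * ‖z.1‖) := by
  have hM := (contDiffOn_differentiableAt h.isOpen h.smooth_normal hz).hasFDerivAt
  have h1 : HasFDerivAt (fun z : Amb n => z.1) (ContinuousLinearMap.fst ℝ _ _) z := hasFDerivAt_fst
  have h2 : HasFDerivAt (fun z : Amb n => z.2) (ContinuousLinearMap.snd ℝ _ _) z := hasFDerivAt_snd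
  have h3 : HasFDerivAt (normalMap M) _ z := ((h2.smul h1).add (hM.comp z h1)).prodMk
    (h2.mul ((hasFDerivAt_norm_euc (h.ne_zero _ hz)).comp z h1))
  rw [h3.fderiv]
  refine Prod.ext ?_ ?_
  · simp
  · simp [mul_comm]

/-- The variation of the parameter contributes nothing because `(x, ‖x‖)` is absolute; what remains
is ⟨x, dM⟩ = -⟨M, ·⟩. So the image of the level set of `f` has tangent hyperplanes polar to the foot
points. -/
theorem IsConeData.form_fderiv_normalMap (h : IsConeData V O f M) {z : Amb n} (hz : z.1 ∈ O)
    (ζ : Amb n) : form n (z.1, ‖z.1‖) (fderiv ℝ (normalMap M) z ζ) =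
      -(‖z.1‖ ^ 2 * fderiv ℝ f z.1 ζ.1) := by
  have hn : ‖z.1‖ ≠ 0 := norm_ne_zero_iff.2 (h.ne_zero _ hz)
  rw [h.fderiv_normalMap hz, form_apply, ← h.inner_normal_eq _ hz, ← h.inner_fderiv_normal hz]
  simp only [inner_add_right, real_inner_smul_right, real_inner_self_eq_norm_sq]
  field_simp
  ring

/-- Focal points on a normal line are bounded in terms of `dM`, so a large parameter avoids them. -/
theorem IsConeData.exists_injective_fderiv (h : IsConeData V O f M) {p : Euc n} (hp : p ∈ O)
    (hpS : p ∈ conformalSpace n) :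
    ∃ a : ℝ, 0 < a ∧ Function.Injective (fderiv ℝ (normalMap M) (p, a)) := by
  -- A kernel vector has a part `t` orthogonal to `p` with `a * ‖t‖` at most twice `‖dM‖ * ‖t‖`:
  -- once from `dM t` and once from the component along `M p`. This `a` forces `t = 0`.
  refine ⟨2 * ‖fderiv ℝ M p‖ + 1, by positivity, ?_⟩
  rw [injective_iff_map_eq_zero]
  rintro ⟨v, α⟩ hζ
  set K := ‖fderiv ℝ M p‖ with hK
  set a := 2 * K + 1 with ha
  have hKnn : 0 ≤ K := norm_nonneg _
  rw [h.fderiv_normalMap (z := (p, a)) hp, Prod.mk_eq_zero] at hζ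
  simp only [mem_conformalSpace.1 hpS, inv_one, one_mul, mul_one] at hζ
  obtain ⟨h1, h2⟩ := hζ
  set β := (inner ℝ p v : ℝ) with hβ
  obtain ⟨t, ht⟩ : ∃ t, t = v - β • p := ⟨_, rfl⟩
  have hv : v = t + β • p := by rw [ht]; abel
  have hpt : inner ℝ p t = (0 : ℝ) := by
    rw [ht, inner_sub_right, real_inner_smul_right, inner_self_of_mem hpS]; ring
  have hα : α = -(a * β) := by linarith
  have h3 : a • t + β • M p + fderiv ℝ M p t = 0 := by
    rw [← h1, hα, hv, map_add, map_smul, h.fderiv_normal_self hp]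
    module
  have hMt : inner ℝ (M p) t = (0 : ℝ) := by
    have h4 := congrArg (fun x : Euc n => (inner ℝ p x : ℝ)) h3
    simp only [inner_add_right, real_inner_smul_right, hpt, h.inner_normal p hp, inner_zero_right,
      h.inner_fderiv_normal hp] at h4
    linarith
  have hMn : 0 < ‖M p‖ := norm_pos_iff.2 (h.normal_ne_zero p hp)
  have hDt : ‖fderiv ℝ M p t‖ ≤ K * ‖t‖ := ContinuousLinearMap.le_opNorm _ _
  have hβM : ‖β • M p‖ ≤ K * ‖t‖ := by
    have h4 := congrArg (fun x : Euc n => (inner ℝ (M p) x : ℝ)) h3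
    simp only [inner_add_right, real_inner_smul_right, hMt, real_inner_self_eq_norm_sq,
      inner_zero_right] at h4
    have h5 := (abs_real_inner_le_norm (M p) (fderiv ℝ M p t)).trans
      (mul_le_mul_of_nonneg_left hDt hMn.le)
    have h6 : |β| * ‖M p‖ ^ 2 ≤ ‖M p‖ * (K * ‖t‖) := by
      refine le_trans (le_of_eq ?_) h5
      rw [show (inner ℝ (M p) (fderiv ℝ M p t) : ℝ) = -(β * ‖M p‖ ^ 2) by linarith, abs_neg,
        abs_mul, abs_of_nonneg (sq_nonneg ‖M p‖)]
    rw [norm_smul, Real.norm_eq_abs]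
    refine le_of_mul_le_mul_left ?_ hMn
    linarith
  have ht0 : t = 0 := by
    have h4 : a • t = -(β • M p + fderiv ℝ M p t) := by
      rw [eq_neg_iff_add_eq_zero, ← add_assoc]; exact h3
    have h5 : a * ‖t‖ ≤ K * ‖t‖ + K * ‖t‖ := by
      have h6 := congrArg norm h4
      rw [norm_smul, norm_neg, Real.norm_of_nonneg (by positivity)] at h6
      rw [h6]
      exact (norm_add_le _ _).trans (add_le_add hβM hDt)
    have h6 : ‖t‖ ≤ 0 := by rw [ha] at h5; linarith
    exact norm_le_zero_iff.1 h6
  have hβ0 : β = 0 := by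
    rw [ht0, smul_zero, map_zero, zero_add, add_zero] at h3
    exact (smul_eq_zero.1 h3).resolve_right (h.normal_ne_zero p hp)
  rw [hv, hα, ht0, hβ0]
  simp

end ConeData

end Construction

/-! ### The regular lightlike hypersurface swept by nearby normal lines. -/

section NormalChart

open Module

variable {n : ℕ}

/-- A domain `W` on which the normal map is a chart, small enough for the points of `W` with
proportional images to lie over the same point of the conformal space. -/
structure IsNormalChart (O : Set (Euc n)) (f : Euc n → ℝ) (M : Euc n → Euc n)
    (e : OpenPartialHomeomorph (Amb n) (Amb n)) (W : Set (Amb n)) : Prop where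
  isOpen : IsOpen W
  subset_source : W ⊆ e.source
  source_subset : e.source ⊆ O ×ˢ univ
  coe : ∀ z, e z = normalMap M z
  smooth_symm : ContDiffOn ℝ ∞ e.symm e.target
  pos : ∀ z ∈ W, 0 < z.2
  level_congr : ∀ z ∈ W, ∀ z' ∈ W, ∀ c : ℝ, normalMap M z = c • normalMap M z' → f z.1 = f z'.1

variable {V O : Set (Euc n)} {f : Euc n → ℝ} {M : Euc n → Euc n}
  {e : OpenPartialHomeomorph (Amb n) (Amb n)} {W : Set (Amb n)}

/-- Images of `z` and `z'` that are proportional with factor `c` become equal when the foot of `z'`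
is multiplied by `c`. If the rescaled point stays in the source, injectivity of the chart identifies
it with `z`, and `f` ignores the factor. -/
theorem IsConeData.exists_isNormalChart (h : IsConeData V O f M) {p : Euc n} (hp : p ∈ O)
    (hpS : p ∈ conformalSpace n) : ∃ a e W, IsNormalChart O f M e W ∧ (p, a) ∈ W := by
  obtain ⟨a, ha, hinj⟩ := h.exists_injective_fderiv hp hpS
  obtain ⟨e, hae, hes, hef, hesm⟩ := exists_smooth_chart (h.isOpen.prod isOpen_univ)
    h.contDiffOn_normalMap (a := ((p, a) : Amb n)) ⟨hp, mem_univ _⟩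
    (LinearEquiv.ofInjectiveEndo (fderiv ℝ (normalMap M) (p, a) : Amb n →ₗ[ℝ] Amb n)
      hinj).toContinuousLinearEquiv (by ext1 <;> rfl)
  have hS : IsOpen (e.source ∩ {z : Amb n | 0 < z.2}) :=
    e.open_source.inter (isOpen_lt continuous_const continuous_snd)
  have hpS' : ((p, a) : Amb n) ∈ e.source ∩ {z : Amb n | 0 < z.2} := ⟨hae, ha⟩
  have hpos : ∀ z ∈ e.source ∩ {z : Amb n | 0 < z.2}, 0 < (normalMap M z).2 := fun z hz =>
    mul_pos hz.2 (norm_pos_iff.2 (h.ne_zero _ (hes hz.1).1))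
  -- The map `R` rescales the foot of the second point by the ratio of the last coordinates, which
  -- is the only possible `c`. It is continuous and fixes the base point, so on a small `W` its
  -- values stay in the source.
  obtain ⟨R, hR⟩ : ∃ R : Amb n × Amb n → Amb n,
    R = fun y => (((normalMap M y.1).2 / (normalMap M y.2).2) • y.2.1, y.2.2) := ⟨_, rfl⟩
  have hc2 : ContinuousAt (fun z => (normalMap M z).2) ((p, a) : Amb n) :=
    continuous_snd.continuousAt.comp (h.contDiffOn_normalMap.continuousOn.continuousAt
      ((h.isOpen.prod isOpen_univ).mem_nhds ⟨hp, mem_univ _⟩))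
  have hRc : ContinuousAt R (((p, a) : Amb n), ((p, a) : Amb n)) := by
    have h1 : ContinuousAt (fun y : Amb n × Amb n => (normalMap M y.1).2)
      (((p, a) : Amb n), ((p, a) : Amb n)) := ContinuousAt.comp
        (g := fun z => (normalMap M z).2) (f := Prod.fst) hc2 continuousAt_fst
    have h2 : ContinuousAt (fun y : Amb n × Amb n => (normalMap M y.2).2)
      (((p, a) : Amb n), ((p, a) : Amb n)) := ContinuousAt.comp
        (g := fun z => (normalMap M z).2) (f := Prod.snd) hc2 continuousAt_snd
    rw [hR]
    exact ((h1.div h2 (hpos _ hpS').ne').smul (by fun_prop)).prodMk (by fun_prop)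
  have hR0 : R (((p, a) : Amb n), ((p, a) : Amb n)) = (p, a) := by
    rw [hR]; simp [(hpos _ hpS').ne']
  have hRn : R ⁻¹' (e.source ∩ {z : Amb n | 0 < z.2}) ∈
      𝓝 (((p, a) : Amb n), ((p, a) : Amb n)) := by
    refine hRc.preimage_mem_nhds ?_
    rw [hR0]; exact hS.mem_nhds hpS'
  obtain ⟨W₁, W₂, hW₁o, hW₁, hW₂o, hW₂, hW⟩ := mem_nhds_prod_iff'.1 hRn
  refine ⟨a, e, (W₁ ∩ W₂) ∩ (e.source ∩ {z : Amb n | 0 < z.2}),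
    ⟨(hW₁o.inter hW₂o).inter hS, fun z hz => hz.2.1, hes, hef, hesm, fun z hz => hz.2.2, ?_⟩,
    ⟨hW₁, hW₂⟩, hpS'⟩
  intro z hz z' hz' c hzc
  have h1 := hpos z hz.2
  have h2 := hpos z' hz'.2
  have h3 : (normalMap M z).2 = c * (normalMap M z').2 := by rw [hzc]; rfl
  have hc : 0 < c := by rw [h3] at h1; exact pos_of_mul_pos_left h1 h2.le
  have h4 : R (z, z') = (c • z'.1, z'.2) := by
    rw [hR]; simp only [h3]; rw [mul_div_cancel_right₀ _ h2.ne']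
  have h5 := hW (show ((z, z') : Amb n × Amb n) ∈ W₁ ×ˢ W₂ from ⟨hz.1.1, hz'.1.2⟩)
  rw [mem_preimage, h4] at h5
  have h6 : e z = e (c • z'.1, z'.2) := by
    rw [hef, hef, hzc, h.normalMap_smul (hes hz'.2.1).1 hc]
  rw [e.injOn hz.2.1 h5.1 h6]
  exact h.apply_smul _ (hes hz'.2.1).1 c hc

/-- The part of the normal lines that is covered by a chart. -/
def normalSurface (f : Euc n → ℝ) (M : Euc n → Euc n) (W : Set (Amb n)) : Set (Proj n) :=
  {x | ∃ z ∈ W, f z.1 = 0 ∧ ∃ h : normalMap M z ≠ 0, x = Projectivization.mk ℝ (normalMap M z) h}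

theorem IsNormalChart.snd_pos (hc : IsNormalChart O f M e W) (h : IsConeData V O f M) {z : Amb n}
    (hz : z ∈ W) : 0 < (normalMap M z).2 :=
  mul_pos (hc.pos z hz)
    (norm_pos_iff.2 (h.ne_zero _ (hc.source_subset (hc.subset_source hz)).1))

theorem IsNormalChart.mem_cone_iff (hc : IsNormalChart O f M e W) (h : IsConeData V O f M)
    {u : Amb n} : u ∈ cone (normalSurface f M W) ↔
      ∃ z ∈ W, f z.1 = 0 ∧ ∃ c : ℝ, c ≠ 0 ∧ u = c • normalMap M z := by
  constructor
  · rintro ⟨hu, z, hz, hfz, hz0, hzu⟩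
    obtain ⟨c, hcu⟩ := (Projectivization.mk_eq_mk_iff ℝ _ _ hu hz0).1 hzu
    exact ⟨z, hz, hfz, c, c.ne_zero, hcu.symm⟩
  · rintro ⟨z, hz, hfz, c, hc0, rfl⟩
    have hz0 : normalMap M z ≠ 0 := fun h0 => by
      have := hc.snd_pos h hz
      rw [h0] at this
      exact lt_irrefl _ this
    refine ⟨smul_ne_zero hc0 hz0, z, hz, hfz, hz0, ?_⟩
    exact (Projectivization.mk_eq_mk_iff ℝ _ _ _ _).2 ⟨Units.mk0 c hc0, rfl⟩

/-- The cone over the image of a chart, at the height `c`. -/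
def chartRegion (e : OpenPartialHomeomorph (Amb n) (Amb n)) (W : Set (Amb n)) (c : ℝ) :
    Set (Amb n) :=
  (fun u => c⁻¹ • u) ⁻¹' (e.target ∩ e.symm ⁻¹' W)

/-- The point of the conformal space, up to a factor, over which a point of a normal line lies. -/
noncomputable def footMap (e : OpenPartialHomeomorph (Amb n) (Amb n)) (c : ℝ) (u : Amb n) :
    Euc n :=
  (e.symm (c⁻¹ • u)).1

theorem IsNormalChart.isOpen_chartRegion (hc : IsNormalChart O f M e W) (c : ℝ) :
    IsOpen (chartRegion e W c) :=
  (e.symm.isOpen_inter_preimage hc.isOpen).preimage (continuous_const_smul _)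

theorem IsNormalChart.contDiffOn_footMap (hc : IsNormalChart O f M e W) (c : ℝ) :
    ContDiffOn ℝ ∞ (footMap e c) (chartRegion e W c) :=
  contDiff_fst.comp_contDiffOn
    (hc.smooth_symm.comp (contDiff_const_smul c⁻¹).contDiffOn fun _ hu => hu.1)

theorem IsNormalChart.footMap_mem (hc : IsNormalChart O f M e W) {c : ℝ} {u : Amb n}
    (hu : u ∈ chartRegion e W c) : footMap e c u ∈ O :=
  (hc.source_subset (hc.subset_source hu.2)).1

theorem IsNormalChart.eq_smul (hc : IsNormalChart O f M e W) {c : ℝ} (hc0 : c ≠ 0) {u : Amb n}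
    (hu : u ∈ chartRegion e W c) : u = c • normalMap M (e.symm (c⁻¹ • u)) := by
  rw [← hc.coe, e.right_inv hu.1, smul_smul, mul_inv_cancel₀ hc0, one_smul]

theorem IsNormalChart.smul_mem_chartRegion (hc : IsNormalChart O f M e W) {c : ℝ} (hc0 : c ≠ 0)
    {z : Amb n} (hz : z ∈ W) : c • normalMap M z ∈ chartRegion e W c ∧
      e.symm (c⁻¹ • c • normalMap M z) = z := by
  have h1 : c⁻¹ • c • normalMap M z = e z := by
    rw [smul_smul, inv_mul_cancel₀ hc0, one_smul, hc.coe]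
  have h2 := hc.subset_source hz
  refine ⟨⟨?_, ?_⟩, ?_⟩
  · simp only [h1]; exact e.map_source h2
  · simp only [mem_preimage, h1]; rwa [e.left_inv h2]
  · rw [h1, e.left_inv h2]

/-- A point of the cone may come from another `z` with a factor different from `c`. The condition
`level_congr` transfers the equation to the preimage chosen by the chart. -/
theorem IsNormalChart.cone_inter (hc : IsNormalChart O f M e W) (h : IsConeData V O f M) {c : ℝ}
    (hc0 : c ≠ 0) : cone (normalSurface f M W) ∩ chartRegion e W c =
      {u | u ∈ chartRegion e W c ∧ (f ∘ footMap e c) u = 0} := by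
  ext u
  constructor
  · rintro ⟨hu, hur⟩
    obtain ⟨z, hz, hfz, c', hc', huz⟩ := (hc.mem_cone_iff h).1 hu
    refine ⟨hur, ?_⟩
    rw [← hfz]
    refine hc.level_congr _ hur.2 _ hz (c⁻¹ * c') ?_
    rw [← hc.coe, e.right_inv hur.1, mul_smul, ← huz]
  · rintro ⟨hur, hfu⟩
    exact ⟨(hc.mem_cone_iff h).2 ⟨_, hur.2, hfu, c, hc0, hc.eq_smul hc0 hur⟩, hur⟩

theorem IsNormalChart.fderiv_footMap (hc : IsNormalChart O f M e W) (h : IsConeData V O f M) {c : ℝ}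
    (hc0 : c ≠ 0) {u : Amb n} (hu : u ∈ chartRegion e W c) (ζ : Amb n) :
    fderiv ℝ (footMap e c) u (c • fderiv ℝ (normalMap M) (e.symm (c⁻¹ • u)) ζ) = ζ.1 := by
  have h1 := contDiffOn_differentiableAt e.open_target hc.smooth_symm hu.1
  have h2 : HasFDerivAt (fun u : Amb n => c⁻¹ • u) (c⁻¹ • ContinuousLinearMap.id ℝ (Amb n)) u :=
    (hasFDerivAt_id u).const_smul c⁻¹
  have h3 : HasFDerivAt (footMap e c) _ u := hasFDerivAt_fst.comp u (h1.hasFDerivAt.comp u h2)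
  rw [h3.fderiv]
  have h4 := fderiv_chart_symm_apply (h.isOpen.prod isOpen_univ) h.contDiffOn_normalMap
    hc.source_subset hc.coe hc.smooth_symm (hc.subset_source hu.2) ζ
  rw [e.right_inv hu.1] at h4
  simp only [ContinuousLinearMap.comp_apply, smul_apply, ContinuousLinearMap.id_apply, smul_smul,
    inv_mul_cancel₀ hc0, one_smul]
  rw [h4]
  rfl

theorem IsNormalChart.exists_fderiv_normalMap (hc : IsNormalChart O f M e W)
    (h : IsConeData V O f M) {c : ℝ} (hc0 : c ≠ 0) {u : Amb n} (hu : u ∈ chartRegion e W c)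
    (ξ : Amb n) : ∃ ζ, ξ = c • fderiv ℝ (normalMap M) (e.symm (c⁻¹ • u)) ζ := by
  refine ⟨fderiv ℝ e.symm (c⁻¹ • u) (c⁻¹ • ξ), ?_⟩
  rw [fderiv_apply_chart_symm (h.isOpen.prod isOpen_univ) h.contDiffOn_normalMap
    hc.source_subset hc.coe hc.smooth_symm hu.1, smul_smul, mul_inv_cancel₀ hc0, one_smul]

/-- This identifies the kernel of the defining equation with a polar hyperplane of the absolute,
which gives both regularity and lightlikeness. -/
theorem IsNormalChart.form_footMap (hc : IsNormalChart O f M e W) (h : IsConeData V O f M) {c : ℝ}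
    (hc0 : c ≠ 0) {u : Amb n} (hu : u ∈ chartRegion e W c) (ξ : Amb n) :
    form n (footMap e c u, ‖footMap e c u‖) ξ =
      -(c * ‖footMap e c u‖ ^ 2) * fderiv ℝ (f ∘ footMap e c) u ξ := by
  have hd := contDiffOn_differentiableAt (hc.isOpen_chartRegion c) (hc.contDiffOn_footMap c) hu
  have hf := contDiffOn_differentiableAt h.isOpen h.smooth (hc.footMap_mem hu)
  rw [fderiv_comp u hf hd, ContinuousLinearMap.comp_apply]
  obtain ⟨ζ, rfl⟩ := hc.exists_fderiv_normalMap h hc0 hu ξ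
  rw [hc.fderiv_footMap h hc0 hu, map_smul]
  have h1 := h.form_fderiv_normalMap (z := e.symm (c⁻¹ • u)) (hc.footMap_mem hu) ζ
  rw [smul_eq_mul, footMap, h1]
  ring

theorem IsNormalChart.fderiv_ne_zero (hc : IsNormalChart O f M e W) (h : IsConeData V O f M) {c : ℝ}
    (hc0 : c ≠ 0) {u : Amb n} (hu : u ∈ chartRegion e W c) :
    fderiv ℝ (f ∘ footMap e c) u ≠ 0 := by
  intro h0
  have hx := h.ne_zero _ (hc.footMap_mem hu)
  -- Paired with `(x, ‖x‖)`, the vector `(x, 0)` gives `‖x‖ ^ 2`, which is nonzero.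
  have h1 := hc.form_footMap h hc0 hu ((footMap e c u, 0) : Amb n)
  rw [h0, zero_apply, mul_zero, form_apply, real_inner_self_eq_norm_sq, mul_zero, sub_zero] at h1
  exact hx (norm_eq_zero.1 (pow_eq_zero_iff two_ne_zero |>.1 h1))

theorem IsNormalChart.isSmoothHypersurface (hc : IsNormalChart O f M e W)
    (h : IsConeData V O f M) : IsSmoothHypersurface (normalSurface f M W) := by
  intro w hw
  obtain ⟨z, hz, hfz, c, hc0, rfl⟩ := (hc.mem_cone_iff h).1 hw
  have hm := (hc.smul_mem_chartRegion hc0 hz).1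
  exact ⟨chartRegion e W c, f ∘ footMap e c, hc.isOpen_chartRegion c, hm,
    h.smooth.comp (hc.contDiffOn_footMap c) fun u hu => hc.footMap_mem hu, hc.cone_inter h hc0,
    hc.fderiv_ne_zero h hc0 hm⟩

theorem IsNormalChart.tangentHyperplane_eq_ker (hc : IsNormalChart O f M e W)
    (h : IsConeData V O f M) {c : ℝ} (hc0 : c ≠ 0) {u : Amb n}
    (hu : u ∈ cone (normalSurface f M W) ∩ chartRegion e W c) :
    tangentHyperplane (normalSurface f M W) u = (fderiv ℝ (f ∘ footMap e c) u).ker := by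
  refine tangentSubspace_eq_ker (hc.isOpen_chartRegion c)
    (h.smooth.comp (hc.contDiffOn_footMap c) fun u hu => hc.footMap_mem hu)
    (hc.cone_inter h hc0) hu ?_
  exact LinearMap.surjective (f := (fderiv ℝ (f ∘ footMap e c) u : Amb n →ₗ[ℝ] ℝ)) fun h0 =>
    hc.fderiv_ne_zero h hc0 hu.2 (ContinuousLinearMap.coe_injective h0)

theorem IsNormalChart.tangentHyperplane_eq_polar (hc : IsNormalChart O f M e W)
    (h : IsConeData V O f M) {c : ℝ} (hc0 : c ≠ 0) {u : Amb n}
    (hu : u ∈ cone (normalSurface f M W) ∩ chartRegion e W c) :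
    tangentHyperplane (normalSurface f M W) u =
      polar (Submodule.span ℝ {(footMap e c u, ‖footMap e c u‖)}) := by
  rw [hc.tangentHyperplane_eq_ker h hc0 hu]
  have hx : ‖footMap e c u‖ ≠ 0 := norm_ne_zero_iff.2 (h.ne_zero _ (hc.footMap_mem hu.2))
  ext ξ
  rw [mem_polar_span_singleton, hc.form_footMap h hc0 hu.2]
  simp [hc0, hx]

/-- The pole is `(x, ‖x‖)` with `x` the foot, and `dx` maps the tangent hyperplane onto the kernel
of `df`, of dimension `n`. The pole itself comes from a vector of this kernel, so the sum has
dimension `n = (n - 1) + 1`. -/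
theorem IsNormalChart.hasRankAt (hc : IsNormalChart O f M e W) (h : IsConeData V O f M)
    (hn : 1 ≤ n) {w : Amb n} (hw : w ∈ cone (normalSurface f M W)) :
    HasRankAt (normalSurface f M W) w (n - 1) := by
  obtain ⟨z, hz, hfz, c, hc0, hwz⟩ := (hc.mem_cone_iff h).1 hw
  have hm : w ∈ chartRegion e W c := by rw [hwz]; exact (hc.smul_mem_chartRegion hc0 hz).1
  have hX := hc.contDiffOn_footMap c
  have hx0 := h.ne_zero _ (hc.footMap_mem hm)
  refine ⟨chartRegion e W c, fun u => (footMap e c u, ‖footMap e c u‖), hc.isOpen_chartRegion c,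
    hm, hX.prodMk (hX.norm ℝ fun u hu => h.ne_zero _ (hc.footMap_mem hu)), fun u hu => ⟨?_, ?_⟩, ?_⟩
  · exact fun h0 => h.ne_zero _ (hc.footMap_mem hu.2) (Prod.mk_eq_zero.1 h0).1
  · exact hc.tangentHyperplane_eq_polar h hc0 hu
  have hd := contDiffOn_differentiableAt (hc.isOpen_chartRegion c) hX hm
  have hf := contDiffOn_differentiableAt h.isOpen h.smooth (hc.footMap_mem hm)
  have hDY : fderiv ℝ (fun u => ((footMap e c u, ‖footMap e c u‖) : Amb n)) w = _ :=
    (hd.hasFDerivAt.prodMk ((hasFDerivAt_norm_euc hx0).comp w hd.hasFDerivAt)).fderiv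
  obtain ⟨x, hx⟩ : ∃ x, x = footMap e c w := ⟨_, rfl⟩
  have hker : tangentHyperplane (normalSurface f M W) w =
      (fderiv ℝ f x).ker.comap (fderiv ℝ (footMap e c) w : Amb n →ₗ[ℝ] Euc n) := by
    rw [hc.tangentHyperplane_eq_ker h hc0 ⟨hw, hm⟩, fderiv_comp w hf hd, hx]
    rfl
  have hsurj : Function.Surjective (fderiv ℝ (footMap e c) w : Amb n →ₗ[ℝ] Euc n) := fun v =>
    ⟨_, hc.fderiv_footMap h hc0 hm (v, 0)⟩
  obtain ⟨j, hj⟩ : ∃ j : Euc n →ₗ[ℝ] Amb n,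
    j = LinearMap.prod LinearMap.id (‖x‖⁻¹ • innerSL ℝ x : Euc n →L[ℝ] ℝ) := ⟨_, rfl⟩
  have hji : Function.Injective j := by
    intro v v' hv
    rw [hj] at hv
    exact congrArg Prod.fst hv
  have hmap : (fderiv ℝ (fun u => ((footMap e c u, ‖footMap e c u‖) : Amb n)) w :
      Amb n →ₗ[ℝ] Amb n) = j ∘ₗ (fderiv ℝ (footMap e c) w : Amb n →ₗ[ℝ] Euc n) := by
    rw [hDY, hj, hx]
    rfl
  have hxO : x ∈ O := hx ▸ hc.footMap_mem hm
  replace hx0 : x ≠ 0 := hx ▸ hx0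
  have hxker : x ∈ (fderiv ℝ f x).ker := by
    have h1 := h.inner_normal_eq x hxO x
    rw [real_inner_comm, h.inner_normal x hxO] at h1
    have h2 : ‖x‖ ^ 2 ≠ 0 := pow_ne_zero 2 (norm_ne_zero_iff.2 hx0)
    exact (mul_eq_zero.1 h1.symm).resolve_left h2
  have hYj : ((x, ‖x‖) : Amb n) = j x := by
    rw [hj]
    refine Prod.ext rfl ?_
    have : ‖x‖ ≠ 0 := norm_ne_zero_iff.2 hx0
    simp
    field_simp
  have hsup : Submodule.span ℝ {((x, ‖x‖) : Amb n)} ⊔ Submodule.map j (fderiv ℝ f x).ker =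
      Submodule.map j (fderiv ℝ f x).ker := by
    rw [sup_eq_right, Submodule.span_singleton_le_iff_mem, hYj]
    exact Submodule.mem_map_of_mem hxker
  rw [hmap, Submodule.map_comp, hker, Submodule.map_comap_eq_of_surjective hsurj]
  change finrank ℝ ↥(Submodule.span ℝ {((footMap e c w, ‖footMap e c w‖) : Amb n)} ⊔ _) = _
  rw [← hx, hsup, (Submodule.equivMapOfInjective j hji _).symm.finrank_eq]
  have hfs : fderiv ℝ f x ≠ 0 := by
    intro h0
    have h1 := h.inner_normal_eq x hxO (M x)
    rw [h0, zero_apply, mul_zero] at h1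
    exact h.normal_ne_zero x hxO (inner_self_eq_zero.1 h1)
  have hfsurj : Function.Surjective (fderiv ℝ f x : Euc n →ₗ[ℝ] ℝ) :=
    LinearMap.surjective fun h0 => hfs (ContinuousLinearMap.coe_injective h0)
  have h1 := LinearMap.finrank_range_add_finrank_ker (fderiv ℝ f x : Euc n →ₗ[ℝ] ℝ)
  rw [LinearMap.range_eq_top.2 hfsurj, finrank_top, finrank_self, finrank_euclideanSpace_fin] at h1
  have h2 : finrank ℝ (fderiv ℝ f x).ker = finrank ℝ (fderiv ℝ f x : Euc n →ₗ[ℝ] ℝ).ker := rfl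
  omega

end NormalChart

/-! ### Gluing the local descriptions into the bijection. -/

section Correspondence

open Module

variable {n : ℕ}

theorem span_pair_eq_normalLine {p N : Euc n} (hp : p ∈ conformalSpace n) (hN : ‖N‖ = 1)
    (hpN : inner ℝ p N = 0) {u : Amb n} (hu : 0 < form n u u) (huL : u ∈ normalLine p N) {c : ℝ}
    (hc : c ≠ 0) : Submodule.span ℝ {u, c • darboux p} = normalLine p N := by
  have hd := darboux_mem_normalLine p N
  apply le_antisymm
  · rw [Submodule.span_le, insert_subset_iff, singleton_subset_iff]
    exact ⟨huL, Submodule.smul_mem _ c hd⟩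
  · have hu' : u ∈ Submodule.span ℝ {u, c • darboux p} := Submodule.subset_span (by simp)
    have hd' : darboux p ∈ Submodule.span ℝ {u, c • darboux p} := by
      have h1 : c • darboux p ∈ Submodule.span ℝ {u, c • darboux p} :=
        Submodule.subset_span (by simp)
      simpa [smul_smul, hc] using Submodule.smul_mem _ c⁻¹ h1
    obtain ⟨a, b, rfl⟩ := mem_normalLine.1 huL
    rw [form_normalLine hp hN hpN] at hu
    have hb : b ≠ 0 := by rintro rfl; simp at hu
    rw [normalLine, Submodule.span_le, insert_subset_iff, singleton_subset_iff]
    refine ⟨hd', ?_⟩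
    have h2 := Submodule.smul_mem _ b⁻¹ (Submodule.sub_mem _ hu' (Submodule.smul_mem _ a hd'))
    rwa [add_sub_cancel_left, smul_smul, inv_mul_cancel₀ hb, one_smul] at h2

theorem IsUnitNormal.lineTouchesAt {V : Set (Euc n)} {p N : Euc n} (h : IsUnitNormal V p N) :
    LineTouchesAt (normalLine p N) (darboux p) :=
  lineTouchesAt_normalLine h.1 h.2.2.1 h.2.2.2.1

/-- The isotropic line through a point of a normal line over the tangency point of the tangent
hyperplane is this normal line. -/
theorem isIsotropicLineAt_iff_eq {H : Set (Proj n)} {u : Amb n} {p N : Euc n}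
    (hp : p ∈ conformalSpace n) (hN : ‖N‖ = 1) (hpN : inner ℝ p N = 0) (hu : 0 < form n u u)
    (huL : u ∈ normalLine p N) (ht : HyperplaneTouchesAt (tangentHyperplane H u) (darboux p))
    {L : Submodule ℝ (Amb n)} : IsIsotropicLineAt H u L ↔ L = normalLine p N := by
  constructor
  · rintro ⟨v, hv, rfl⟩
    obtain ⟨c, hc, rfl⟩ := exists_smul_of_polar_eq hv.1.1 (hv.2.symm.trans ht.2)
    exact span_pair_eq_normalLine hp hN hpN hu huL hc
  · rintro rfl
    refine ⟨_, ht, ?_⟩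
    have := span_pair_eq_normalLine hp hN hpN hu huL one_ne_zero
    rw [one_smul] at this
    exact this.symm

theorem IsNormalChart.touches {V O : Set (Euc n)} {f : Euc n → ℝ} {M : Euc n → Euc n}
    {e : OpenPartialHomeomorph (Amb n) (Amb n)} {W : Set (Amb n)} (hc : IsNormalChart O f M e W)
    (h : IsConeData V O f M) {z : Amb n} (hz : z ∈ W) (hfz : f z.1 = 0) {c : ℝ} (hc0 : c ≠ 0) :
    ∃ N, IsUnitNormal V (‖z.1‖⁻¹ • z.1) N ∧ 0 < form n (c • normalMap M z) (c • normalMap M z) ∧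
      c • normalMap M z ∈ normalLine (‖z.1‖⁻¹ • z.1) N ∧
      HyperplaneTouchesAt (tangentHyperplane (normalSurface f M W) (c • normalMap M z))
        (darboux (‖z.1‖⁻¹ • z.1)) := by
  have hzO : z.1 ∈ O := (hc.source_subset (hc.subset_source hz)).1
  have hz0 := norm_pos_iff.2 (h.ne_zero _ hzO)
  obtain ⟨q, hq⟩ : ∃ q, q = ‖z.1‖⁻¹ • z.1 := ⟨_, rfl⟩
  have hzq : z.1 = ‖z.1‖ • q := by rw [hq, smul_smul, mul_inv_cancel₀ hz0.ne', one_smul]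
  have hqS : q ∈ conformalSpace n := by
    rw [mem_conformalSpace, hq, norm_smul, norm_inv, norm_norm, inv_mul_cancel₀ hz0.ne']
  have hqO : q ∈ O := hq ▸ h.smul_mem _ hzO _ (inv_pos.2 hz0)
  have hqV : q ∈ V := by
    have : q ∈ V ∩ O := by
      rw [h.level]
      exact ⟨hqS, hqO, by rw [hq, h.apply_smul _ hzO _ (inv_pos.2 hz0), hfz]⟩
    exact this.1
  have hMq := norm_pos_iff.2 (h.normal_ne_zero q hqO)
  have hun := h.isUnitNormal hqV hqO
  have hMz : M z.1 = ‖z.1‖ • M q := by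
    conv_lhs => rw [hzq, h.normal_smul q hqO _ hz0]
  have hcomb : c • normalMap M z = (c * (z.2 * ‖z.1‖)) • darboux q +
      (c * (‖z.1‖ * ‖M q‖)) • ((‖M q‖⁻¹ • M q, 0) : Amb n) := by
    refine Prod.ext ?_ ?_
    · simp only [normalMap, darboux, Prod.smul_fst, Prod.fst_add, smul_add, smul_smul, hMz]
      congr 1
      · conv_lhs => rw [hzq, smul_smul]
        congr 1; ring
      · congr 1; field_simp
    · simp [normalMap, darboux]
  rw [← hq]
  refine ⟨‖M q‖⁻¹ • M q, hun, ?_, mem_normalLine.2 ⟨_, _, hcomb.symm⟩, isAbsolutePoint_darboux hqS,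
    ?_⟩
  · rw [hcomb, form_normalLine hqS hun.2.2.1 hun.2.2.2.1]
    exact (sq_nonneg _).lt_of_ne' (pow_ne_zero 2 (mul_ne_zero hc0 (mul_pos hz0 hMq).ne'))
  · obtain ⟨hm, hs⟩ := hc.smul_mem_chartRegion hc0 hz
    rw [hc.tangentHyperplane_eq_polar h hc0 ⟨(hc.mem_cone_iff h).2 ⟨z, hz, hfz, c, hc0, rfl⟩, hm⟩,
      footMap, hs, ← span_singleton_smul_eq' hz0.ne' (darboux q)]
    congr 3
    refine Prod.ext hzq ?_
    simp [darboux]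

/-- Near the normal line at a point, the normal lines of a hypersurface of the conformal space are
the isotropic lines of a regular lightlike hypersurface of maximal rank. -/
theorem IsConformalHypersurface.exists_isRegularLightlike (hn : 1 ≤ n) {V : Set (Euc n)}
    (hV : IsConformalHypersurface V) {p : Euc n} (hp : p ∈ V) :
    ∃ H : Set (Proj n), IsRegularLightlike H (n - 1) ∧
      (∀ u ∈ cone H, ∃ q N, IsUnitNormal V q N ∧
        HyperplaneTouchesAt (tangentHyperplane H u) (darboux q) ∧ u ∈ normalLine q N) ∧
      ∃ w ∈ cone H, HyperplaneTouchesAt (tangentHyperplane H w) (darboux p) ∧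
        ∀ D ∈ 𝓝 w, ∃ B ∈ 𝓝 p, ∀ q ∈ V ∩ B, ∃ w' ∈ cone H ∩ D,
          HyperplaneTouchesAt (tangentHyperplane H w') (darboux q) := by
  obtain ⟨O, f, M, h, hpO⟩ := hV.exists_isConeData hp
  obtain ⟨a, e, W, hc, hpW⟩ := h.exists_isNormalChart hpO (hV.1 hp)
  have hlev : ∀ q ∈ V, q ∈ O → f q = 0 := by
    intro q hqV hqO
    have : q ∈ V ∩ O := ⟨hqV, hqO⟩
    rw [h.level] at this
    exact this.2.2
  have hcone : ∀ q ∈ V, ((q, a) : Amb n) ∈ W →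
      normalMap M (q, a) ∈ cone (normalSurface f M W) ∧
      HyperplaneTouchesAt (tangentHyperplane (normalSurface f M W) (normalMap M (q, a)))
        (darboux q) := by
    intro q hqV hq
    have hfq : f q = 0 := hlev q hqV (hc.source_subset (hc.subset_source hq)).1
    refine ⟨(hc.mem_cone_iff h).2 ⟨_, hq, hfq, 1, one_ne_zero, (one_smul ℝ _).symm⟩, ?_⟩
    obtain ⟨N, -, -, -, ht⟩ := hc.touches h hq hfq one_ne_zero
    simpa [mem_conformalSpace.1 (hV.1 hqV)] using ht
  refine ⟨normalSurface f M W, ⟨?_, hc.isSmoothHypersurface h, ?_, fun w => hc.hasRankAt h hn⟩, ?_,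
    normalMap M (p, a), (hcone p hp hpW).1, (hcone p hp hpW).2, ?_⟩
  · rintro _ ⟨z, hz, hfz, hz0, rfl⟩
    obtain ⟨N, -, hpos, -⟩ := hc.touches h hz hfz one_ne_zero
    rw [one_smul] at hpos
    exact (mem_deSitter_mk hz0).2 hpos
  · intro u hu
    obtain ⟨z, hz, hfz, c, hc0, rfl⟩ := (hc.mem_cone_iff h).1 hu
    obtain ⟨N, -, -, -, ht⟩ := hc.touches h hz hfz hc0
    exact ⟨_, ht⟩
  · intro u hu
    obtain ⟨z, hz, hfz, c, hc0, rfl⟩ := (hc.mem_cone_iff h).1 hu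
    obtain ⟨N, hN, -, hL, ht⟩ := hc.touches h hz hfz hc0
    exact ⟨_, N, hN, ht, hL⟩
  · intro D hD
    -- Keeping the parameter `a` fixed and moving only the foot `q` gives a point of the cone that
    -- depends continuously on `q`.
    have h1 : ContinuousAt (fun q : Euc n => ((q, a) : Amb n)) p := by fun_prop
    have h2 : ContinuousAt (normalMap M) ((p, a) : Amb n) :=
      h.contDiffOn_normalMap.continuousOn.continuousAt
        ((h.isOpen.prod isOpen_univ).mem_nhds ⟨hpO, mem_univ _⟩)
    have h3 : ContinuousAt (fun q : Euc n => normalMap M (q, a)) p :=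
      ContinuousAt.comp (g := normalMap M) (f := fun q : Euc n => ((q, a) : Amb n)) h2 h1
    refine ⟨_, Filter.inter_mem (h1.preimage_mem_nhds (hc.isOpen.mem_nhds hpW))
      (h3.preimage_mem_nhds hD), fun q hq => ?_⟩
    obtain ⟨h4, h5⟩ := hcone q hq.1 hq.2.1
    exact ⟨_, ⟨h4, hq.2.2⟩, h5⟩

/-- By `mem_generators_iff` the only generators are normal lines, so generators whose tangency
points are close have close feet on `V`, and the local construction covers them. -/
theorem IsConformalHypersurface.isLightlikeHypersurface (hn : 1 ≤ n) {V : Set (Euc n)}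
    (hV : IsConformalHypersurface V) : IsLightlikeHypersurface (tangentHyperspheres V) (n - 1) := by
  refine ⟨fun x hx => hx.1, ?_, ?_⟩
  · refine mk_rep_cases fun u hu hx => ?_
    have hpos := (mem_deSitter_mk hu).1 hx.1
    obtain ⟨p, N, hN, huL⟩ := (mem_tangentHyperspheres_iff hV hpos).1 hx
    exact ⟨_, hN.normalLine_mem_generators, (mem_points_mk hu).2 huL⟩
  intro L hL
  obtain ⟨p, N, hN, rfl⟩ := hV.mem_generators_iff.1 hL
  obtain ⟨H, hH, hHV, w, hw, hwp, hnear⟩ := hV.exists_isRegularLightlike hn hN.2.1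
  have key : ∀ u ∈ cone H, ∀ q N, IsUnitNormal V q N →
      HyperplaneTouchesAt (tangentHyperplane H u) (darboux q) → ∀ L',
      (IsIsotropicLineAt H u L' ↔ L' = normalLine q N) := by
    intro u hu q N hN ht L'
    obtain ⟨q', N', hN', ht', huL⟩ := hHV u hu
    obtain rfl := ht.eq_of_darboux ht'
    rw [hN.unique_normalLine hN']
    exact isIsotropicLineAt_iff_eq hN'.1 hN'.2.2.1 hN'.2.2.2.1 (form_pos_of_mem_cone hH.1 hu) huL ht
  refine ⟨H, hH, fun u hu L' hL' => ?_, w, hw, (key w hw p N hN hwp _).2 rfl, ?_⟩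
  · obtain ⟨q, N', hN', ht, -⟩ := hHV u hu
    rw [(key u hu q N' hN' ht L').1 hL']
    exact hN'.normalLine_mem_generators
  intro v hv D hD
  obtain ⟨B, hB, hBq⟩ := hnear D hD
  have hv0 := hv.2.1.exists_darboux.1
  have hvp : v.2⁻¹ • v.1 = p :=
    hv.darboux.eq_of_darboux hv.2.1.exists_darboux.2.1 hN.1 hN.lineTouchesAt
  have hcont : ContinuousAt (fun v : Amb n => v.2⁻¹ • v.1) v :=
    (continuousAt_snd.inv₀ hv0).smul continuousAt_fst
  refine ⟨_, hcont.preimage_mem_nhds (by rw [hvp]; exact hB), fun L' hL' v' hv' ht' => ?_⟩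
  obtain ⟨q, N', hN', rfl⟩ := hV.mem_generators_iff.1 hL'
  have hq : v'.2⁻¹ • v'.1 = q :=
    ht'.darboux.eq_of_darboux ht'.2.1.exists_darboux.2.1 hN'.1 hN'.lineTouchesAt
  rw [mem_preimage, hq] at hv'
  obtain ⟨w', hw', hwq⟩ := hBq q ⟨hN'.2.1, hv'⟩
  exact ⟨w', hw', (key w' hw'.1 q N' hN' hwq _).2 rfl⟩

theorem IsUnitNormal.congr {V V' B : Set (Euc n)} {p N : Euc n} (h : IsUnitNormal V' p N)
    (hB : B ∈ 𝓝 p) (hVB : V ∩ B = V' ∩ B) : IsUnitNormal V p N := by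
  have hp : p ∈ V ∩ B := by rw [hVB]; exact ⟨h.2.1, mem_of_mem_nhds hB⟩
  refine ⟨h.1, hp.1, h.2.2.1, h.2.2.2.1, ?_⟩
  rw [tangentSubspace_congr hB hVB]
  exact h.2.2.2.2

theorem isConformalHypersurface_of_locally {V : Set (Euc n)} (hS : V ⊆ conformalSpace n)
    (h : ∀ p ∈ V, ∃ V' : Set (Euc n), IsConformalHypersurface V' ∧ ∃ B ∈ 𝓝 p, V ∩ B = V' ∩ B) :
    IsConformalHypersurface V := by
  refine ⟨hS, fun p hp => ?_⟩
  obtain ⟨V', hV', B, hB, hVB⟩ := h p hp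
  have hp' : p ∈ V' ∩ B := hVB ▸ ⟨hp, mem_of_mem_nhds hB⟩
  obtain ⟨O, f, hO, hpO, hf, hVO, hv⟩ := hV'.2 p hp'.1
  refine ⟨O ∩ interior B, f, hO.inter isOpen_interior, ⟨hpO, mem_interior_iff_mem_nhds.2 hB⟩,
    hf.mono inter_subset_left, ?_, hv⟩
  ext q
  have h1 : q ∈ V ∩ B ↔ q ∈ V' ∩ B := by rw [hVB]
  have h2 : q ∈ V' ∩ O ↔ q ∈ conformalSpace n ∧ q ∈ O ∧ f q = 0 := by rw [hVO]; rfl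
  have h3 : q ∈ interior B → q ∈ B := fun hq => interior_subset hq
  simp only [mem_inter_iff, mem_ofPred_eq] at h1 h2 ⊢
  tauto

/-- Near each of its generators, a lightlike hypersurface of maximal rank consists of the normal
lines of a hypersurface of the conformal space. -/
theorem IsLightlikeHypersurface.exists_local (hn : 1 ≤ n) {U : Set (Proj n)}
    (hU : IsLightlikeHypersurface U (n - 1)) {L : Submodule ℝ (Amb n)} (hL : L ∈ generators U)
    {p : Euc n} (hp : p ∈ conformalSpace n) (hLp : LineTouchesAt L (darboux p)) :
    ∃ V' : Set (Euc n), IsConformalHypersurface V' ∧ ∃ B ∈ 𝓝 p,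
      {q | q ∈ conformalSpace n ∧ ∃ L ∈ generators U, LineTouchesAt L (darboux q)} ∩ B = V' ∩ B ∧
      ∃ N, IsUnitNormal V' p N ∧ L = normalLine p N := by
  obtain ⟨H, hH, hHU, w, hw, hwL, hnear⟩ := hU.2.2 L hL
  obtain ⟨D, hD, -, V', hV'def, hV', htan⟩ := hH.exists_local hn hw Filter.univ_mem
  have hline : ∀ u ∈ cone H ∩ D, ∀ q, HyperplaneTouchesAt (tangentHyperplane H u) (darboux q) →
      ∃ N, IsUnitNormal V' q N ∧ ∀ L', IsIsotropicLineAt H u L' ↔ L' = normalLine q N := by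
    intro u hu q hq
    have hpos := form_pos_of_mem_cone hH.1 hu.1
    have ht := htan u hu q hq (ne_zero_of_form_pos hpos)
    obtain ⟨N, hN⟩ := hV'.exists_isUnitNormal ht.1
    exact ⟨N, hN, fun L' => isIsotropicLineAt_iff_eq hN.1 hN.2.2.1 hN.2.2.2.1 hpos
      ((hN.tangentAt_iff hpos).1 ht) hq⟩
  have hnormal : ∀ u ∈ cone H ∩ D, ∀ L', IsIsotropicLineAt H u L' → ∀ q ∈ conformalSpace n,
      LineTouchesAt L' (darboux q) → ∃ N, IsUnitNormal V' q N ∧ L' = normalLine q N := by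
    intro u hu L' hL' q hq hq'
    obtain ⟨v, hv, -⟩ := id hL'
    obtain ⟨N, hN, h1⟩ := hline u hu _ hv.darboux
    rw [h1] at hL'
    have h2 : q = v.2⁻¹ • v.1 := hq'.eq_of_darboux hq hN.1 (hL' ▸ hN.lineTouchesAt)
    exact ⟨N, h2 ▸ hN, h2 ▸ hL'⟩
  -- The closeness clause, applied to the neighbourhood `D` that defines `V'`, says that every
  -- generator touching the absolute near `p` comes from a point of `H` in `D`. Hence the locus of
  -- tangency points agrees with `V'` near `p`.
  obtain ⟨B, hB, hBL⟩ := hnear _ hLp D hD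
  have hcont : Continuous (darboux : Euc n → Amb n) := by unfold darboux; fun_prop
  refine ⟨V', hV', _, hcont.continuousAt.preimage_mem_nhds hB, ?_,
    hnormal w ⟨hw, mem_of_mem_nhds hD⟩ L hwL p hp hLp⟩
  ext q
  refine and_congr_left fun hqB => ⟨?_, fun hq => ?_⟩
  · rintro ⟨hqS, L', hL', hq⟩
    obtain ⟨w', hw', hiso⟩ := hBL L' hL' _ hqB hq
    obtain ⟨N, hN, -⟩ := hnormal w' hw' L' hiso q hqS hq
    exact hN.2.1
  · have hq' := hq
    rw [hV'def] at hq'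
    obtain ⟨hqS, u, hu, ht⟩ := hq'
    obtain ⟨N, hN, h1⟩ := hline u hu q ht
    exact ⟨hqS, _, hHU u hu.1 _ ((h1 _).2 rfl), hN.lineTouchesAt⟩

/-- Being a hypersurface and having a given normal line are local properties, so the locus of all
tangency points inherits both from the local pieces. Uniqueness of the normal line at a point then
matches the generators of `U` with the normal lines of `V`. -/
theorem IsLightlikeHypersurface.exists_conformalHypersurface (hn : 1 ≤ n) {U : Set (Proj n)}
    (hU : IsLightlikeHypersurface U (n - 1)) :
    ∃ V : Set (Euc n), IsConformalHypersurface V ∧ tangentHyperspheres V = U := by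
  obtain ⟨V, hVdef⟩ : ∃ V : Set (Euc n), V =
    {q | q ∈ conformalSpace n ∧ ∃ L ∈ generators U, LineTouchesAt L (darboux q)} := ⟨_, rfl⟩
  have hloc := @IsLightlikeHypersurface.exists_local n hn U hU
  rw [← hVdef] at hloc
  have hV : IsConformalHypersurface V := by
    refine isConformalHypersurface_of_locally (fun p hp => ?_) fun p hp => ?_
    · rw [hVdef] at hp; exact hp.1
    · rw [hVdef] at hp
      obtain ⟨hpS, L, hL, hLp⟩ := hp
      obtain ⟨V', hV', B, hB, hVB, -⟩ := hloc hL hpS hLp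
      exact ⟨V', hV', B, hB, hVB⟩
  have hgen : ∀ L ∈ generators U, ∀ p ∈ conformalSpace n, LineTouchesAt L (darboux p) →
      ∃ N, IsUnitNormal V p N ∧ L = normalLine p N := by
    intro L hL p hp hLp
    obtain ⟨V', hV', B, hB, hVB, N, hN, hLN⟩ := hloc hL hp hLp
    exact ⟨N, hN.congr hB hVB, hLN⟩
  refine ⟨V, hV, Subset.antisymm ?_ ?_⟩
  · refine mk_rep_cases fun u hu hx => ?_
    obtain ⟨p, N, hN, huL⟩ := (mem_tangentHyperspheres_iff hV ((mem_deSitter_mk hu).1 hx.1)).1 hx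
    have hp := hN.2.1
    rw [hVdef] at hp
    obtain ⟨hpS, L, hL, hLp⟩ := hp
    obtain ⟨N', hN', hLN⟩ := hgen L hL p hpS hLp
    refine hL.2 ⟨(mem_points_mk hu).2 ?_, hx.1⟩
    rw [hLN, ← hN.unique_normalLine hN']
    exact huL
  · refine mk_rep_cases fun u hu hx => ?_
    obtain ⟨L, hL, huL⟩ := hU.2.1 _ hx
    obtain ⟨v, hv⟩ := hL.1
    obtain ⟨N, hN, hLN⟩ := hgen L hL _ hv.2.1.exists_darboux.2.1 hv.darboux
    refine (mem_tangentHyperspheres_iff hV ((mem_deSitter_mk hu).1 (hU.1 hx))).2 ⟨_, N, hN, ?_⟩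
    rw [← hLN]
    exact (mem_points_mk hu).1 huL

end Correspondence

end DeSitter

theorem theorem3 (n : ℕ) (hn : 2 ≤ n) :
    -- the one-to-one correspondence
    Set.BijOn (fun V : Set (DeSitter.Euc n) => DeSitter.tangentHyperspheres V)
      {V | DeSitter.IsConformalHypersurface V}
      {U | DeSitter.IsLightlikeHypersurface U (n - 1)} ∧
    (∀ V : Set (DeSitter.Euc n), DeSitter.IsConformalHypersurface V →
      -- its inverse: `V` is traced by the points where the generators touch the absolute
      V = {p | p ∈ DeSitter.conformalSpace n ∧
            ∃ L ∈ DeSitter.generators (DeSitter.tangentHyperspheres V),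
              DeSitter.LineTouchesAt L (DeSitter.darboux p)} ∧
      -- the generators correspond one-to-one to the pencils of hyperspheres tangent to `V`
      Set.BijOn (fun L : Submodule ℝ (DeSitter.Amb n) => DeSitter.pencilOfLine L)
        (DeSitter.generators (DeSitter.tangentHyperspheres V))
        ((fun p => DeSitter.tangentPencil V p) '' V) ∧
      ∀ p ∈ V,
        -- these pencils are parabolic
        DeSitter.IsParabolicPencil (DeSitter.tangentPencil V p) p ∧
        -- the line polar-conjugate to the tangent subspace of `V` at `p` is the generator
        -- that corresponds to the pencil at `p`
        DeSitter.polar (DeSitter.projTangent V p) ∈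
          DeSitter.generators (DeSitter.tangentHyperspheres V) ∧
        DeSitter.LineTouchesAt (DeSitter.polar (DeSitter.projTangent V p))
          (DeSitter.darboux p) ∧
        DeSitter.pencilOfLine (DeSitter.polar (DeSitter.projTangent V p)) =
          DeSitter.tangentPencil V p) ∧
    -- every regular lightlike hypersurface of maximal rank is locally a part of the
    -- hypersurface that corresponds to the locus of its tangency points with the absolute
    (∀ H : Set (DeSitter.Proj n), DeSitter.IsRegularLightlike H (n - 1) →
      ∀ w ∈ DeSitter.cone H, ∃ N ∈ nhds w, ∃ V : Set (DeSitter.Euc n),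
        V = {p | p ∈ DeSitter.conformalSpace n ∧ ∃ u ∈ DeSitter.cone H ∩ N,
              DeSitter.HyperplaneTouchesAt (DeSitter.tangentHyperplane H u)
                (DeSitter.darboux p)} ∧
        DeSitter.IsConformalHypersurface V ∧
        ∀ u ∈ DeSitter.cone H ∩ N, ∀ hu : u ≠ 0,
          Projectivization.mk ℝ u hu ∈ DeSitter.tangentHyperspheres V) := by
  have hn1 : 1 ≤ n := by omega
  refine ⟨⟨fun V hV => hV.isLightlikeHypersurface hn1, ?_, ?_⟩, ?_, ?_⟩
  · intro V hV V' hV' hVV'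
    dsimp only at hVV'
    rw [DeSitter.IsConformalHypersurface.eq_setOf_touches hV,
      DeSitter.IsConformalHypersurface.eq_setOf_touches hV', hVV']
  · intro U hU
    exact DeSitter.IsLightlikeHypersurface.exists_conformalHypersurface hn1 hU
  · intro V hV
    refine ⟨hV.eq_setOf_touches, hV.bijOn_pencilOfLine, fun p hp => ?_⟩
    obtain ⟨N, hN⟩ := hV.exists_isUnitNormal hp
    rw [hN.polar_projTangent]
    exact ⟨hN.isParabolicPencil, hN.normalLine_mem_generators, hN.lineTouchesAt,
      hN.pencilOfLine_eq⟩
  · intro H hH w hw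
    obtain ⟨N, hN, -, V, hVdef, hV, htan⟩ := hH.exists_local hn1 hw Filter.univ_mem
    refine ⟨N, hN, V, hVdef, hV, fun u hu hu0 => ?_⟩
    obtain ⟨v, hv⟩ := hH.2.2.1 u hu.1
    have ht := htan u hu _ hv.darboux hu0
    exact ⟨(DeSitter.mem_deSitter_mk hu0).2 (DeSitter.form_pos_of_mem_cone hH.1 hu.1), _, ht.1, ht⟩
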